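/- A probabilistic BPP (pBPP) $\mathcal S=(\Gamma,\hookrightarrow,\mathit{Prob})$ consists of a finite set $\Gamma$ of types, a finite set ${\hookrightarrow}\subseteq\Gamma\times\mathbb N^\Gamma$ of rules $X\hookrightarrow\beta$ containing at least one rule for each $X\in\Gamma$, and rational probabilities $\mathit{Prob}(X\hookrightarrow\beta)\in(0,1]$ such that for each $X$ the probabilities of the rules of $X$ sum to $1$. Configurations are elements of $\mathbb N^\Gamma$. Scheduling a type $X$ with $\alpha(X)\ge 1$ in a configuration $\alpha$ leads to $\alpha-X+\beta$ with probability $\mathit{Prob}(X\hookrightarrow\beta)$; the empty configuration $\varepsilon$ is absorbing. In the Markov chain $\mathcal M_{\mathrm{type}}(\mathcal S)$ the type to be scheduled is uniformly distributed on the types $X$ with $\alpha(X)\ge1$; in $\mathcal M_{\mathrm{proc}}(\mathcal S)$ the type $X$ is scheduled with probability $\alpha(X)/\sum_{Y\in\Gamma}\alpha(Y)$. In the Markov decision process $\mathcal D(\mathcal S)$ it is chosen, possibly at random, by a scheduler $\sigma$ that knows the history (in $\varepsilon$ only a dummy action is available). Let $\mathbb P_{\mathrm{type}}$, $\mathbb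 P_{\mathrm{proc}}$ and $\mathbb P_\sigma$ be the resulting probability measures on runs, and let $\alpha_0\models\Diamond F$ be the event that a run started in $\alpha_0$ visits $F$. A run is $k$-fair if every action that is enabled in $k$ consecutive states of the run is executed in at least one of these $k$ states; a scheduler is $k$-fair if all the runs from $\alpha_0$ that it produces (those whose finite prefixes all have positive probability) are $k$-fair. **Theorem.** The following problems are undecidable, where the input is a pBPP $\mathcal S$, a semilinear set $F\subseteq\mathbb N^\Gamma$ (given as a finite union of linear sets, each by its base vector and its finite list of periods), and a configuration $\alpha_0\in\mathbb N^\Gamma$: (a) whether $\mathbb P(\alpha_0\models\Diamond F)=1$ holds, both for $\mathbb P=\mathbb P_{\mathrm{type}}$ and for $\mathbb P=\mathbb P_{\mathrm{proc}}$; (b) whether $\mathbb P_\sigma(\alpha_0\models\Diamond F)=1$ holds for all $7$-fair schedulers $\sigma$; (c) whether $\mathbb P_\sigma(\alpha_0\models\Diamond F)=1$ holds for some scheduler $\sigma$. -/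

import Mathlib

open MeasureTheory ProbabilityTheory
open scoped ENNReal

namespace BPP

noncomputable section

/-! ### Stochastic processes on a countable state space -/

section Law

variable {E : Type*} [Countable E] [MeasurableSpace E] [MeasurableSingletonClass E]

/-- The one-step kernel that draws the element at time `n + 1` from `next n h`, where `h` lists the
elements at the times `0, …, n`. -/
def stepKernel (next : ∀ n : ℕ, (Finset.Iic n → E) → PMF E) (n : ℕ) :
    Kernel (Finset.Iic n → E) E where
  toFun h := (next n h).toMeasure
  measurable' := measurable_of_countable _

instance (next : ∀ n : ℕ, (Finset.Iic n → E) → PMF E) (n : ℕ) :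
    IsMarkovKernel (stepKernel next n) :=
  ⟨fun h => by change IsProbabilityMeasure (next n h).toMeasure; infer_instance⟩

/-- The law of the process whose element at time `0` has distribution `init` and whose element at
time `n + 1` has distribution `next n h`, given the elements `h` at the times `0, …, n`. -/
def processLaw (init : PMF E) (next : ∀ n : ℕ, (Finset.Iic n → E) → PMF E) : Measure (ℕ → E) :=
  Kernel.trajMeasure (X := fun _ => E) init.toMeasure (stepKernel next)

instance (init : PMF E) (next : ∀ n : ℕ, (Finset.Iic n → E) → PMF E) :
    IsProbabilityMeasure (processLaw init next) := by
  unfold processLaw; infer_instance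

theorem processLaw_cylinder_zero (init : PMF E) (next : ∀ n : ℕ, (Finset.Iic n → E) → PMF E)
    (e : E) : processLaw init next {ω | ω 0 = e} = init e := by
  have h0 : (processLaw init next).map (Preorder.frestrictLe 0) =
      init.toMeasure.map (MeasurableEquiv.piUnique (fun _ : Finset.Iic 0 => E)).symm := by
    unfold processLaw Kernel.trajMeasure
    rw [Measure.map_comp _ _ (by fun_prop), Kernel.traj_map_frestrictLe, Kernel.partialTraj_self,
      Measure.id_comp]
  have h1 : {ω : ℕ → E | ω 0 = e} = Preorder.frestrictLe (π := fun _ => E) 0 ⁻¹'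
      {x | x ⟨0, by simp⟩ = e} := rfl
  have h2 : MeasurableSet {x : Finset.Iic 0 → E | x ⟨0, by simp⟩ = e} :=
    (measurableSet_singleton e).preimage (measurable_pi_apply (⟨0, by simp⟩ : Finset.Iic 0))
  rw [h1, ← Measure.map_apply (by fun_prop) h2, h0, Measure.map_apply (by fun_prop) h2]
  rw [← PMF.toMeasure_apply_singleton init e (measurableSet_singleton e)]
  rfl

theorem processLaw_cylinder_succ (init : PMF E) (next : ∀ n : ℕ, (Finset.Iic n → E) → PMF E)
    (w : ℕ → E) (n : ℕ) :
    processLaw init next {ω | ∀ i ≤ n + 1, ω i = w i} =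
      processLaw init next {ω | ∀ i ≤ n, ω i = w i} * next n (fun i => w i) (w (n + 1)) := by
  have key := Kernel.map_frestrictLe_trajMeasure_compProd_eq_map_trajMeasure
    (X := fun _ => E) (μ₀ := init.toMeasure) (κ := stepKernel next) (a := n)
  have h1 : {ω : ℕ → E | ∀ i ≤ n + 1, ω i = w i} =
      (fun x => (Preorder.frestrictLe (π := fun _ => E) n x, x (n + 1))) ⁻¹'
        ({fun i : Finset.Iic n => w i} ×ˢ {w (n + 1)}) := by
    ext ω
    simp only [Set.mem_ofPred_eq, Set.mem_preimage, Set.mem_prod, Set.mem_singleton_iff, funext_iff,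
      Preorder.frestrictLe_apply, Subtype.forall, Finset.mem_Iic]
    exact ⟨fun h => ⟨fun a ha => h a (by omega), h _ le_rfl⟩, fun h i hi => by
      rcases Nat.le_succ_iff.1 hi with h' | rfl
      exacts [h.1 i h', h.2]⟩
  have h2 : {ω : ℕ → E | ∀ i ≤ n, ω i = w i} =
      Preorder.frestrictLe (π := fun _ => E) n ⁻¹' {fun i : Finset.Iic n => w i} := by
    ext ω
    simp [funext_iff]
  have m1 : MeasurableSet ({fun i : Finset.Iic n => w i} : Set (Finset.Iic n → E)) := measurableSet_singleton _
  have m2 : MeasurableSet ({w (n + 1)} : Set E) := measurableSet_singleton _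
  rw [h1, h2, processLaw, ← Measure.map_apply (by fun_prop) (m1.prod m2), ← key,
    Measure.compProd_apply_prod m1 m2, lintegral_singleton,
    ← Measure.map_apply (by fun_prop) m1, mul_comm]
  congr 1
  exact PMF.toMeasure_apply_singleton _ _ m2

end Law

/-! ### Markov chains -/

/-- The transition function of a Markov chain with state space `Q`. -/
abbrev MarkovChain (Q : Type*) := Q → PMF Q

namespace MarkovChain

variable {Q : Type*} [Countable Q] [MeasurableSpace Q] [MeasurableSingletonClass Q]

/-- The probability measure on runs that start in `s₀`. -/
def runLaw (M : MarkovChain Q) (s₀ : Q) : Measure (ℕ → Q) :=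
  processLaw (PMF.pure s₀) fun n h => M (h ⟨n, Finset.mem_Iic.2 le_rfl⟩)

theorem runLaw_cylinder_zero (M : MarkovChain Q) (s₀ : Q) :
    M.runLaw s₀ {ω | ω 0 = s₀} = 1 := by
  simp [runLaw, processLaw_cylinder_zero]

theorem runLaw_cylinder_succ (M : MarkovChain Q) (s₀ : Q) (w : ℕ → Q) (n : ℕ) :
    M.runLaw s₀ {ω | ∀ i ≤ n + 1, ω i = w i} =
      M.runLaw s₀ {ω | ∀ i ≤ n, ω i = w i} * M (w n) (w (n + 1)) :=
  processLaw_cylinder_succ _ _ w n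

/-- The probability that a run started in `s₀` hits `F`. -/
def hitProb (M : MarkovChain Q) (s₀ : Q) (F : Set Q) : ℝ≥0∞ :=
  M.runLaw s₀ {ω | ∃ i, ω i ∈ F}

end MarkovChain

/-! ### Markov decision processes -/

/-- A Markov decision process. The value `δ s a` matters only for actions `a` enabled in `s`. -/
structure MDP (Q A : Type*) where
  /-- the actions enabled in a state -/
  En : Q → Set A
  En_nonempty : ∀ s, (En s).Nonempty
  /-- the transition function -/
  δ : Q → A → PMF Q

namespace MDP

variable {Q A : Type*}

/-- A (randomised, history-dependent) scheduler. The history `s₀ a₁ s₁ ⋯ a_k s_k` is given as the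
list `[(s₀, a₁), …, (s_{k-1}, a_k)]` followed by its last state `s_k`. -/
structure Scheduler (D : MDP Q A) where
  /-- the distribution of the next action, given the history -/
  choose : List (Q × A) → Q → PMF A
  support_subset : ∀ w s, (choose w s).support ⊆ D.En s

/-- The list `[(s₀, a₁), …, (s_{n-1}, a_n)]` for the sequence `ω` with `ω i = (s_i, a_{i+1})`. -/
def history (ω : ℕ → Q × A) (n : ℕ) : List (Q × A) :=
  List.ofFn fun i : Fin n => ω i

/-- The sequence `s₀ a₁ s₁ a₂ ⋯`, given as `ω i = (s_i, a_{i+1})`, is a run from `s₀` that the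
scheduler `σ` can produce. -/
def IsRun (D : MDP Q A) (σ : D.Scheduler) (s₀ : Q) (ω : ℕ → Q × A) : Prop :=
  (ω 0).1 = s₀ ∧
    (∀ i, σ.choose (history ω i) (ω i).1 (ω i).2 ≠ 0) ∧
    ∀ i, D.δ (ω i).1 (ω i).2 (ω (i + 1)).1 ≠ 0

/-- A run is `k`-fair if each action that is enabled in `k` consecutive states is executed in at
least one of them. -/
def RunFair (D : MDP Q A) (k : ℕ) (ω : ℕ → Q × A) : Prop :=
  ∀ (i : ℕ) (a : A), (∀ j < k, a ∈ D.En (ω (i + j)).1) → ∃ j < k, (ω (i + j)).2 = a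

/-- A scheduler is `k`-fair (from the initial state `s₀`) if it produces only `k`-fair runs. -/
def Fair (D : MDP Q A) (k : ℕ) (s₀ : Q) (σ : D.Scheduler) : Prop :=
  ∀ ω, D.IsRun σ s₀ ω → D.RunFair k ω

variable [Countable Q] [MeasurableSpace Q] [MeasurableSingletonClass Q]
variable [Finite A] [MeasurableSpace A] [MeasurableSingletonClass A]

/-- The probability measure on runs from `s₀` under the scheduler `σ`. -/
def runLaw (D : MDP Q A) (σ : D.Scheduler) (s₀ : Q) : Measure (ℕ → Q × A) :=
  processLaw ((σ.choose [] s₀).map fun a => (s₀, a)) fun n h =>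
    (D.δ (h ⟨n, Finset.mem_Iic.2 le_rfl⟩).1 (h ⟨n, Finset.mem_Iic.2 le_rfl⟩).2).bind fun s =>
      (σ.choose (List.ofFn fun i : Fin (n + 1) =>
        h ⟨i, Finset.mem_Iic.2 (Nat.lt_succ_iff.1 i.isLt)⟩) s).map fun a => (s, a)

theorem runLaw_cylinder_zero (D : MDP Q A) (σ : D.Scheduler) (s₀ : Q) (a : A) :
    D.runLaw σ s₀ {ω | ω 0 = (s₀, a)} = σ.choose [] s₀ a := by
  classical
  rw [runLaw, processLaw_cylinder_zero, PMF.map_apply, tsum_eq_single a]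
  · simp
  · intro b hb
    simp [hb.symm]

theorem runLaw_cylinder_succ (D : MDP Q A) (σ : D.Scheduler) (s₀ : Q) (w : ℕ → Q × A) (n : ℕ) :
    D.runLaw σ s₀ {ω | ∀ i ≤ n + 1, ω i = w i} =
      D.runLaw σ s₀ {ω | ∀ i ≤ n, ω i = w i} * (D.δ (w n).1 (w n).2 (w (n + 1)).1 *
        σ.choose (history w (n + 1)) (w (n + 1)).1 (w (n + 1)).2) := by
  classical
  rw [runLaw, processLaw_cylinder_succ, PMF.bind_apply, tsum_eq_single (w (n + 1)).1]
  · rw [PMF.map_apply, tsum_eq_single (w (n + 1)).2]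
    · rw [if_pos rfl]
      rfl
    · intro b hb
      rw [if_neg]
      exact fun h => hb (congrArg Prod.snd h).symm
  · intro t ht
    rw [PMF.map_apply, ENNReal.tsum_eq_zero.2, mul_zero]
    intro b
    rw [if_neg]
    exact fun h => ht (congrArg Prod.fst h).symm

/-- The probability that a run started in `s₀` hits `F` under the scheduler `σ`. -/
def hitProb (D : MDP Q A) (σ : D.Scheduler) (s₀ : Q) (F : Set Q) : ℝ≥0∞ :=
  D.runLaw σ s₀ {ω | ∃ i, (ω i).1 ∈ F}

end MDP

/-! ### Probabilistic BPPs -/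

/-- Configurations: `α X` is the number of processes of type `X`. -/
abbrev Config (Γ : Type*) := Γ → ℕ

/-- A probabilistic BPP with finite set `Γ` of types: `β ∈ rules X` says that `X → β` is a rule, and
`prob X β` is its probability. As the probabilities of the rules of `X` sum to `1`, there is at
least one such rule, and each probability is at most `1`. -/
@[ext]
structure PBPP (Γ : Type*) where
  /-- the right-hand sides of the rules of a type -/
  rules : Γ → Finset (Config Γ)
  /-- the probability of a rule, set to `0` if there is no such rule -/
  prob : Γ → Config Γ → ℚ
  prob_pos : ∀ X, ∀ β ∈ rules X, 0 < prob X β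
  prob_eq_zero : ∀ X, ∀ β ∉ rules X, prob X β = 0
  sum_prob : ∀ X, ∑ β ∈ rules X, prob X β = 1

/-- The number of types present in a configuration. -/
def numTypes {Γ : Type*} [Fintype Γ] (α : Config Γ) : ℕ := (Finset.univ.filter (1 ≤ α ·)).card

/-- The number of processes in a configuration. -/
def numProcs {Γ : Type*} [Fintype Γ] (α : Config Γ) : ℕ := ∑ X, α X

/-- A type present in `α`, chosen uniformly among the types present. -/
def selectType {Γ : Type*} [Fintype Γ] (α : Config Γ) (h : α ≠ 0) : PMF Γ :=
  PMF.uniformOfFinset (Finset.univ.filter (1 ≤ α ·)) (by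
    obtain ⟨X, hX⟩ := Function.ne_iff.1 h
    exact ⟨X, by simpa [Nat.one_le_iff_ne_zero] using hX⟩)

/-- The type of a process of `α`, chosen uniformly among the processes. -/
def selectProc {Γ : Type*} [Fintype Γ] (α : Config Γ) (h : α ≠ 0) : PMF Γ :=
  PMF.ofFintype (fun X => (α X : ℝ≥0∞) / numProcs α) (by
    obtain ⟨X, hX⟩ := Function.ne_iff.1 h
    have h1 : (numProcs α : ℝ≥0∞) ≠ 0 := by
      have : numProcs α ≠ 0 := fun h0 => hX (Finset.sum_eq_zero_iff.1 h0 X (Finset.mem_univ X))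
      exact_mod_cast this
    simp_rw [div_eq_mul_inv]
    rw [← Finset.sum_mul, ← Nat.cast_sum]
    exact ENNReal.mul_inv_cancel h1 (ENNReal.natCast_ne_top _))

/-- The actions of the induced MDP: schedule a type, or the dummy action `idle`, which is the only
one enabled in the empty configuration. -/
inductive Act (Γ : Type*)
  | sched (X : Γ) : Act Γ
  | idle : Act Γ

instance {Γ : Type*} [Finite Γ] : Finite (Act Γ) :=
  Finite.of_injective (fun a : Act Γ => match a with | .sched X => some X | .idle => none)
    (by rintro (_ | _) (_ | _) h <;> simp_all)

instance {Γ : Type*} : MeasurableSpace (Act Γ) := ⊤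

instance {Γ : Type*} : MeasurableSingletonClass (Act Γ) := ⟨fun _ => trivial⟩

namespace PBPP

variable {Γ : Type*} [Fintype Γ] [DecidableEq Γ] (S : PBPP Γ)

/-- The distribution of the right-hand side of the rule chosen when `X` is scheduled. -/
def ruleDist (X : Γ) : PMF (Config Γ) :=
  PMF.ofFinset (fun β => ENNReal.ofReal (S.prob X β)) (S.rules X)
    (by
      rw [← ENNReal.ofReal_sum_of_nonneg fun β hβ => by exact_mod_cast (S.prob_pos X β hβ).le,
        ← Rat.cast_sum, S.sum_prob X]
      simp)
    fun β hβ => by simp [S.prob_eq_zero X β hβ]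

/-- The distribution of the successor `α - X + β` of `α` when `X` is scheduled in `α`. -/
def succDist (α : Config Γ) (X : Γ) : PMF (Config Γ) :=
  (S.ruleDist X).map fun β => α - Pi.single X 1 + β

/-- The induced Markov chain in which the type to be scheduled is uniform among the types present. -/
def typeChain : MarkovChain (Config Γ) := fun α =>
  if h : α = 0 then PMF.pure 0 else (selectType α h).bind (S.succDist α)

/-- The induced Markov chain in which the process to be scheduled is uniform among the processes. -/
def procChain : MarkovChain (Config Γ) := fun α =>
  if h : α = 0 then PMF.pure 0 else (selectProc α h).bind (S.succDist α)

/-- The induced Markov decision process. -/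
def mdp : MDP (Config Γ) (Act Γ) where
  En α := {a | match a with
    | .sched X => 1 ≤ α X
    | .idle => α = 0}
  En_nonempty α := by
    by_cases h : α = 0
    · exact ⟨.idle, h⟩
    · obtain ⟨X, hX⟩ := Function.ne_iff.1 h
      exact ⟨.sched X, Nat.one_le_iff_ne_zero.2 hX⟩
  δ α a := match a with
    | .sched X => S.succDist α X
    | .idle => PMF.pure α

theorem succDist_apply (α γ : Config Γ) (X : Γ) :
    S.succDist α X γ = ∑ β ∈ S.rules X,
      if γ = α - Pi.single X 1 + β then ENNReal.ofReal (S.prob X β) else 0 := by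
  classical
  rw [succDist, PMF.map_apply, tsum_eq_sum (s := S.rules X)]
  · refine Finset.sum_congr rfl fun β _ => ?_
    by_cases h : γ = α - Pi.single X 1 + β <;> simp [h, ruleDist]
  · intro β hβ
    simp [ruleDist, S.prob_eq_zero X β hβ]

theorem typeChain_apply (α γ : Config Γ) (h : α ≠ 0) :
    S.typeChain α γ = ∑ X, ∑ β ∈ S.rules X,
      if 1 ≤ α X ∧ γ = α - Pi.single X 1 + β then
        ENNReal.ofReal (S.prob X β) / numTypes α else 0 := by
  simp only [typeChain, dif_neg h, PMF.bind_apply, tsum_fintype]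
  refine Finset.sum_congr rfl fun X _ => ?_
  rw [S.succDist_apply, Finset.mul_sum]
  refine Finset.sum_congr rfl fun β _ => ?_
  rw [selectType, PMF.uniformOfFinset_apply, div_eq_mul_inv, numTypes]
  by_cases h1 : 1 ≤ α X <;> by_cases h2 : γ = α - Pi.single X 1 + β <;> simp [h1, h2, mul_comm]

theorem procChain_apply (α γ : Config Γ) (h : α ≠ 0) :
    S.procChain α γ = ∑ X, ∑ β ∈ S.rules X,
      if γ = α - Pi.single X 1 + β then
        α X * ENNReal.ofReal (S.prob X β) / numProcs α else 0 := by
  simp only [procChain, dif_neg h, PMF.bind_apply, tsum_fintype]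
  refine Finset.sum_congr rfl fun X _ => ?_
  rw [S.succDist_apply, Finset.mul_sum]
  refine Finset.sum_congr rfl fun β _ => ?_
  rw [selectProc, PMF.ofFintype_apply]
  by_cases h2 : γ = α - Pi.single X 1 + β
  · simp only [h2, if_true, div_eq_mul_inv]; ring
  · simp [h2]

end PBPP

/-! ### Semilinear sets and problem instances -/

/-- A presentation of a semilinear set: a finite list of linear sets, each given by its base and
its finitely many periods. -/
abbrev SemilinearPres (Γ : Type*) := List (Config Γ × List (Config Γ))

/-- The semilinear set with the given presentation. -/
def SemilinearPres.toSet {Γ : Type*} (F : SemilinearPres Γ) : Set (Config Γ) :=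
  {v | ∃ L ∈ F, ∃ u ∈ AddSubmonoid.closure {p | p ∈ L.2}, v = L.1 + u}

theorem isSemilinearSet_iff_exists_pres {Γ : Type*} (s : Set (Config Γ)) :
    IsSemilinearSet s ↔ ∃ F : SemilinearPres Γ, F.toSet = s := by
  constructor
  · rintro ⟨T, hT, hlin, rfl⟩
    have h : ∀ t ∈ T, ∃ L : Config Γ × List (Config Γ), SemilinearPres.toSet [L] = t := by
      intro t ht
      obtain ⟨a, p, hp, rfl⟩ := hlin t ht
      refine ⟨(a, hp.toFinset.toList), ?_⟩
      ext v
      simp [SemilinearPres.toSet, Set.mem_vadd_set, eq_comm]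
    choose! g hg using h
    refine ⟨hT.toFinset.toList.map g, ?_⟩
    ext v
    have h' : ∀ t ∈ T, (v ∈ t ↔ ∃ u ∈ AddSubmonoid.closure {p | p ∈ (g t).2},
        v = (g t).1 + u) := by
      intro t ht
      conv_lhs => rw [← hg t ht]
      simp [SemilinearPres.toSet]
    simp only [SemilinearPres.toSet, List.mem_map, Finset.mem_toList, Set.Finite.mem_toFinset,
      Set.mem_ofPred_eq, Set.mem_sUnion]
    constructor
    · rintro ⟨L, ⟨t, ht, rfl⟩, h⟩
      exact ⟨t, ht, (h' t ht).2 h⟩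
    · rintro ⟨t, ht, hv⟩
      exact ⟨g t, ⟨t, ht, rfl⟩, (h' t ht).1 hv⟩
  · rintro ⟨F, rfl⟩
    refine ⟨(fun L : Config Γ × List (Config Γ) => SemilinearPres.toSet [L]) '' {L | L ∈ F},
      (List.finite_toSet F).image _, ?_, ?_⟩
    · rintro _ ⟨L, -, rfl⟩
      refine ⟨L.1, {p | p ∈ L.2}, List.finite_toSet _, ?_⟩
      ext v
      simp [SemilinearPres.toSet, Set.mem_vadd_set, eq_comm]
    · ext v
      simp [SemilinearPres.toSet]

/-- An instance of the reachability problem with semilinear target sets; the types are numbered. -/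
structure Instance where
  /-- the number of types -/
  n : ℕ
  /-- the probabilistic BPP -/
  S : PBPP (Fin n)
  /-- the semilinear target set -/
  F : SemilinearPres (Fin n)
  /-- the initial configuration -/
  α₀ : Config (Fin n)

/-- Codes of instances as finite data: the number of types, the list of rules `X → β`, each with
its probability as numerator and denominator, the target set and the initial configuration.
A configuration is coded by the list of its entries. -/
abbrev Code :=
  ℕ × List (ℕ × List ℕ × ℕ × ℕ) × List (List ℕ × List (List ℕ)) × List ℕ

/-- `c` is a code of the instance `I`; the rules may be listed in any order. -/
def Instance.IsCode (I : Instance) (c : Code) : Prop :=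
  c.1 = I.n ∧
  (∀ r, r ∈ c.2.1 ↔ ∃ X, ∃ β ∈ I.S.rules X,
    r = ((X : ℕ), List.ofFn β, (I.S.prob X β).num.toNat, (I.S.prob X β).den)) ∧
  c.2.2.1 = I.F.map (fun L => (List.ofFn L.1, L.2.map fun p => List.ofFn p)) ∧
  c.2.2.2 = List.ofFn I.α₀

theorem Instance.exists_isCode (I : Instance) : ∃ c, I.IsCode c := by
  classical
  refine ⟨(I.n, (Finset.univ.biUnion fun X => (I.S.rules X).image fun β =>
    ((X : ℕ), List.ofFn β, (I.S.prob X β).num.toNat, (I.S.prob X β).den)).toList, _, _),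
    rfl, fun r => ?_, rfl, rfl⟩
  simp [eq_comm]

theorem Instance.eq_of_isCode {I J : Instance} {c : Code} (hI : I.IsCode c) (hJ : J.IsCode c) :
    I = J := by
  obtain ⟨n, S, F, α⟩ := I
  obtain ⟨m, T, G, β⟩ := J
  obtain ⟨h1, h2, h3, h4⟩ := hI
  obtain ⟨g1, g2, g3, g4⟩ := hJ
  obtain rfl : n = m := h1.symm.trans g1
  have e1 : α = β := List.ofFn_injective (h4.symm.trans g4)
  have e2 : F = G := by
    refine List.map_injective_iff.2 ?_ (h3.symm.trans g3)
    rintro ⟨a, p⟩ ⟨b, q⟩ h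
    simp only [Prod.mk.injEq] at h
    rw [List.ofFn_injective h.1, List.map_injective_iff.2 List.ofFn_injective h.2]
  have aux : ∀ (S T : PBPP (Fin n)), (∀ X, ∀ γ ∈ S.rules X, ∃ Y, ∃ δ ∈ T.rules Y,
      ((X : ℕ), List.ofFn γ, (S.prob X γ).num.toNat, (S.prob X γ).den) =
        ((Y : ℕ), List.ofFn δ, (T.prob Y δ).num.toNat, (T.prob Y δ).den)) →
      ∀ X, ∀ γ ∈ S.rules X, γ ∈ T.rules X ∧ S.prob X γ = T.prob X γ := by
    intro S T h X γ hγ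
    obtain ⟨Y, δ, hδ, he⟩ := h X γ hγ
    simp only [Prod.mk.injEq] at he
    obtain rfl := Fin.ext he.1
    obtain rfl := List.ofFn_injective he.2.1
    refine ⟨hδ, Rat.ext ?_ he.2.2.2⟩
    have p1 := Rat.num_pos.2 (S.prob_pos _ _ hγ)
    have p2 := Rat.num_pos.2 (T.prob_pos _ _ hδ)
    have := he.2.2.1
    omega
  have a1 := aux S T fun X γ hγ => (g2 _).1 ((h2 _).2 ⟨X, γ, hγ, rfl⟩)
  have a2 := aux T S fun X γ hγ => (h2 _).1 ((g2 _).2 ⟨X, γ, hγ, rfl⟩)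
  have e3 : S = T := by
    refine PBPP.ext (funext fun X => Finset.ext fun γ => ⟨fun h => (a1 X γ h).1,
      fun h => (a2 X γ h).1⟩) (funext fun X => funext fun γ => ?_)
    by_cases h : γ ∈ S.rules X
    · exact (a1 X γ h).2
    · rw [S.prob_eq_zero X γ h, T.prob_eq_zero X γ fun h' => h (a2 X γ h').1]
  subst e1 e2 e3
  rfl

/-- The decision problem `P` is undecidable: no computable function gives the right answer on all
codes of instances. -/
def Undecidable (P : Instance → Prop) : Prop :=
  ¬ ∃ f : Code → Bool, Computable f ∧ ∀ I c, I.IsCode c → (f c = true ↔ P I)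

end

end BPP

set_option linter.unusedSectionVars false

/-! The reduction starts from two computably inseparable sets: the codes of programs that output 0,
respectively 1, on their own code. A fixed two-counter machine with `2 ^ k` in one counter reaches
the state `h0` for `k ∈ A` and `h1` for `k ∈ B`. A fixed pBPP simulates it, and only the initial
configuration depends on `k`. Inseparability makes diverging inputs irrelevant, so everything
happens on finite runs: for `k ∈ B` each relevant run hits the target, and for `k ∈ A` a trap
disjoint from the target is entered with positive probability before any hit. Only the supports of
the distributions matter, never the values of the probabilities.

A BPP has neither synchronisation nor zero tests, so the simulation guesses and the semilinear
target checks. The control carries the state, a random guess of the next test outcome, and a clock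
modulo 3. One process of each counter is turned into a marker whose random label should copy the
control. A late marker returns to its counter or vanishes, depending on its label, and this performs
the decrement. The early phase keeps a fresh marker from being resolved at once, which would undo
the progress of the round. A round has seven steps. `goodSet` holds the faithful configurations and
`wrongSet` those after an unlucky random choice; scheduling a type out of turn leads outside both.
`Forced` records this pattern. A control in `h0` becomes the permanent `fin`, while in `h1` every
guess counts as wrong.

For (a) and (b) the target is the complement of `goodSet ∪ finSet`. If the machine reaches `h1`, all
runs hit the target, whatever is scheduled (`Forced.exists_notMem`). If it reaches `h0`, the
faithful run has positive probability and ends in `finSet` for ever (`Forced.exists_path`,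
`Forced.avoid`). The scheduler `pick` serves the seven groups of types cyclically, hence is 7-fair.

For (c) the scheduler wants to hit the target and must be made to simulate faithfully. Each step may
raise an alarm, and alarms never disappear. A first alarm in a good configuration, or a wrong random
choice with at most one alarm, is a hit. After a deviation an alarm can be raised outside `goodSet`
and `wrongSet`; the next step can bring a second one, and then no hit is possible. So a cheating
scheduler risks the trap, and a faithful one hits surely in the case `h1` but may end in `finSet` in
the case `h0` (`Forced.exists_mem_alarmTarget`, `Forced.avoid_alarm`).

The counter machine is obtained as by Minsky: registers are exponents in the prime factorisation of
one number, loops over registers compute primitive recursive functions and a search, and a second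
counter serves for division and multiplication. -/

namespace BPP

/-! ### Almost sure events and positive paths. -/

section Law

variable {E : Type*} [Countable E] [MeasurableSpace E] [MeasurableSingletonClass E]

theorem measurableSet_cylinder {E : Type*} [MeasurableSpace E] [MeasurableSingletonClass E]
    (w : ℕ → E) (n : ℕ) :
    MeasurableSet {ω : ℕ → E | ∀ i ≤ n, ω i = w i} := by
  have : {ω : ℕ → E | ∀ i ≤ n, ω i = w i} = ⋂ i ≤ n, (fun ω : ℕ → E => ω i) ⁻¹' {w i} := by
    ext; simp
  rw [this]
  exact MeasurableSet.iInter fun i => MeasurableSet.iInter fun _ =>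
    (measurableSet_singleton _).preimage (measurable_pi_apply i)

/-- Almost surely, all steps of the process have positive probability. -/
theorem processLaw_ae_pos (init : PMF E) (next : ∀ n : ℕ, (Finset.Iic n → E) → PMF E) :
    ∀ᵐ ω ∂processLaw init next, init (ω 0) ≠ 0 ∧ ∀ n, next n (fun i => ω i) (ω (n + 1)) ≠ 0 := by
  rw [Filter.eventually_and, ae_all_iff]
  constructor
  · have : {ω : ℕ → E | ¬ init (ω 0) ≠ 0} ⊆ ⋃ e ∈ {e | init e = 0}, {ω : ℕ → E | ω 0 = e} := by
      intro ω hω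
      simpa using hω
    refine measure_mono_null this ((measure_biUnion_null_iff (Set.to_countable _)).2 ?_)
    intro e he
    rw [processLaw_cylinder_zero]
    exact he
  · intro n
    have : {ω : ℕ → E | ¬ next n (fun i => ω i) (ω (n + 1)) ≠ 0} ⊆
        ⋃ v ∈ {v : (Finset.Iic n → E) × E | next n v.1 v.2 = 0},
          {ω : ℕ → E | (∀ i : Finset.Iic n, ω i = v.1 i) ∧ ω (n + 1) = v.2} := by
      intro ω hω
      simp only [ne_eq, not_not, Set.mem_ofPred_eq] at hω
      simp only [Set.mem_iUnion]
      exact ⟨⟨fun i => ω i, ω (n + 1)⟩, hω, fun _ => rfl, rfl⟩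
    refine measure_mono_null this ((measure_biUnion_null_iff (Set.to_countable _)).2 ?_)
    rintro ⟨v, e⟩ he
    let w : ℕ → E := fun i => if h : i ≤ n then v ⟨i, Finset.mem_Iic.2 h⟩ else e
    have hw : {ω : ℕ → E | (∀ i : Finset.Iic n, ω i = v i) ∧ ω (n + 1) = e} ⊆
        {ω | ∀ i ≤ n + 1, ω i = w i} := by
      rintro ω ⟨h1, h2⟩ i hi
      rcases Nat.le_succ_iff.1 hi with h | rfl
      · simpa [w, h] using h1 ⟨i, Finset.mem_Iic.2 h⟩
      · simpa [w] using h2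
    refine measure_mono_null hw ?_
    rw [processLaw_cylinder_succ]
    have h1 : (fun i : Finset.Iic n => w i) = v := by
      funext i
      simp [w, Finset.mem_Iic.1 i.2]
    have h2 : w (n + 1) = e := by simp [w]
    rw [h1, h2]
    exact mul_eq_zero_of_right _ he

/-- An event that holds on all trajectories with positive steps is almost sure. -/
theorem processLaw_eq_one (init : PMF E) (next : ∀ n : ℕ, (Finset.Iic n → E) → PMF E)
    {A : Set (ℕ → E)}
    (hA : ∀ ω, init (ω 0) ≠ 0 → (∀ n, next n (fun i => ω i) (ω (n + 1)) ≠ 0) → ω ∈ A) :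
    processLaw init next A = 1 := by
  rw [← measure_univ (μ := processLaw init next)]
  refine measure_congr ?_
  filter_upwards [processLaw_ae_pos init next] with ω hω
  exact propext ⟨fun _ => trivial, fun _ => hA ω hω.1 hω.2⟩

/-- An event that holds on no trajectory with positive steps that extends a given path of positive
probability is not almost sure. -/
theorem processLaw_ne_one (init : PMF E) (next : ∀ n : ℕ, (Finset.Iic n → E) → PMF E)
    {A : Set (ℕ → E)} (w : ℕ → E) (n : ℕ)
    (hw : processLaw init next {ω | ∀ i ≤ n, ω i = w i} ≠ 0)
    (hA : ∀ ω, (∀ i ≤ n, ω i = w i) → init (ω 0) ≠ 0 → (∀ n, next n (fun i => ω i) (ω (n + 1)) ≠ 0) → ω ∉ A) :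
    processLaw init next A ≠ 1 := by
  intro h1
  have h2 : processLaw init next A ≤ processLaw init next {ω | ∀ i ≤ n, ω i = w i}ᶜ := by
    refine measure_mono_ae ?_
    filter_upwards [processLaw_ae_pos init next] with ω hω hωA hωw
    exact hA ω hωw hω.1 hω.2 hωA
  rw [h1, prob_compl_eq_one_sub (measurableSet_cylinder w n)] at h2
  exact (ENNReal.sub_lt_self ENNReal.one_ne_top one_ne_zero hw).not_ge h2

end Law

namespace MarkovChain

variable {Q : Type*} [Countable Q] [MeasurableSpace Q] [MeasurableSingletonClass Q]

theorem hitProb_eq_one (M : MarkovChain Q) (s₀ : Q) (F : Set Q)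
    (h : ∀ ω : ℕ → Q, ω 0 = s₀ → (∀ n, M (ω n) (ω (n + 1)) ≠ 0) → ∃ i, ω i ∈ F) :
    M.hitProb s₀ F = 1 :=
  processLaw_eq_one _ _ fun ω h0 hω => h ω (by simpa [PMF.pure_apply] using h0) hω

theorem runLaw_cylinder_ne_zero (M : MarkovChain Q) (s₀ : Q) (w : ℕ → Q) (n : ℕ)
    (h0 : w 0 = s₀) (hw : ∀ i < n, M (w i) (w (i + 1)) ≠ 0) :
    M.runLaw s₀ {ω | ∀ i ≤ n, ω i = w i} ≠ 0 := by
  induction n with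
  | zero =>
    simp only [Nat.le_zero, forall_eq, h0, runLaw_cylinder_zero]
    exact one_ne_zero
  | succ n ih =>
    rw [runLaw_cylinder_succ]
    exact mul_ne_zero (ih fun i hi => hw i (by omega)) (hw n (by omega))

theorem hitProb_ne_one (M : MarkovChain Q) (s₀ : Q) (F : Set Q) (w : ℕ → Q) (n : ℕ)
    (h0 : w 0 = s₀) (hw : ∀ i < n, M (w i) (w (i + 1)) ≠ 0)
    (h : ∀ ω : ℕ → Q, (∀ i ≤ n, ω i = w i) → (∀ n, M (ω n) (ω (n + 1)) ≠ 0) → ∀ i, ω i ∉ F) :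
    M.hitProb s₀ F ≠ 1 := by
  refine processLaw_ne_one _ _ w n ?_ fun ω h1 _ h2 ⟨i, hi⟩ => h ω h1 h2 i hi
  exact M.runLaw_cylinder_ne_zero s₀ w n h0 hw

end MarkovChain

namespace MDP

variable {Q A : Type*} [Countable Q] [MeasurableSpace Q] [MeasurableSingletonClass Q]
variable [Finite A] [MeasurableSpace A] [MeasurableSingletonClass A]

/-- The law draws a state and the next action jointly, as a bind. The joint draw has positive
probability only if both factors do. -/
theorem isRun_of_pos (D : MDP Q A) (σ : D.Scheduler) (s₀ : Q) (ω : ℕ → Q × A)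
    (h0 : ((σ.choose [] s₀).map fun a => (s₀, a)) (ω 0) ≠ 0)
    (h : ∀ n, ((D.δ (ω n).1 (ω n).2).bind fun s =>
      (σ.choose (history ω (n + 1)) s).map fun a => (s, a)) (ω (n + 1)) ≠ 0) :
    D.IsRun σ s₀ ω := by
  have h' : ∀ n, D.δ (ω n).1 (ω n).2 (ω (n + 1)).1 ≠ 0 ∧
      σ.choose (history ω (n + 1)) (ω (n + 1)).1 (ω (n + 1)).2 ≠ 0 := by
    intro n
    obtain ⟨s, hs, hs'⟩ := (PMF.mem_support_bind_iff _ _ _).1 ((PMF.mem_support_iff _ _).2 (h n))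
    obtain ⟨a, ha, he⟩ := (PMF.mem_support_map_iff _ _ _).1 hs'
    rw [← he]
    exact ⟨hs, ha⟩
  obtain ⟨a, ha, he⟩ := (PMF.mem_support_map_iff _ _ _).1 ((PMF.mem_support_iff _ _).2 h0)
  refine ⟨by rw [← he], fun i => ?_, fun i => (h' i).1⟩
  cases i with
  | zero =>
    rw [← he]
    exact ha
  | succ n => exact (h' n).2

theorem hitProb_eq_one (D : MDP Q A) (σ : D.Scheduler) (s₀ : Q) (F : Set Q)
    (h : ∀ ω, D.IsRun σ s₀ ω → ∃ i, (ω i).1 ∈ F) : D.hitProb σ s₀ F = 1 :=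
  processLaw_eq_one _ _ fun ω h0 hω => h ω (D.isRun_of_pos σ s₀ ω h0 hω)

theorem hitProb_ne_one (D : MDP Q A) (σ : D.Scheduler) (s₀ : Q) (F : Set Q) (w : ℕ → Q × A)
    (n : ℕ) (hw : D.runLaw σ s₀ {ω | ∀ i ≤ n, ω i = w i} ≠ 0)
    (h : ∀ ω, (∀ i ≤ n, ω i = w i) → D.IsRun σ s₀ ω → ∀ i, (ω i).1 ∉ F) :
    D.hitProb σ s₀ F ≠ 1 :=
  processLaw_ne_one _ _ w n hw fun ω h1 h0 h2 ⟨i, hi⟩ => h ω h1 (D.isRun_of_pos σ s₀ ω h0 h2) i hi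

end MDP

/-! ### Supports of the step distributions. -/

namespace PBPP

variable {Γ : Type*} [Fintype Γ] [DecidableEq Γ] (S : PBPP Γ)

/-- Scheduling `X` in `α` can lead to `γ`. -/
def Step (α : Config Γ) (X : Γ) (γ : Config Γ) : Prop :=
  1 ≤ α X ∧ ∃ β ∈ S.rules X, γ = α - Pi.single X 1 + β

theorem ruleDist_ne_zero_iff (X : Γ) (β : Config Γ) : S.ruleDist X β ≠ 0 ↔ β ∈ S.rules X := by
  simp only [ruleDist, PMF.ofFinset_apply]
  constructor
  · intro h
    by_contra hβ
    simp [S.prob_eq_zero X β hβ] at h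
  · intro h
    have := S.prob_pos X β h
    simpa using this

theorem succDist_ne_zero_iff (α γ : Config Γ) (X : Γ) :
    S.succDist α X γ ≠ 0 ↔ ∃ β ∈ S.rules X, γ = α - Pi.single X 1 + β := by
  rw [← PMF.mem_support_iff, succDist, PMF.mem_support_map_iff]
  simp only [PMF.mem_support_iff, ruleDist_ne_zero_iff, eq_comm]

theorem typeChain_ne_zero_iff (α γ : Config Γ) :
    S.typeChain α γ ≠ 0 ↔ (∃ X, S.Step α X γ) ∨ α = 0 ∧ γ = 0 := by
  by_cases h : α = 0
  · subst h
    simp [typeChain, Step, PMF.pure_apply]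
  · rw [typeChain, dif_neg h, ← PMF.mem_support_iff, PMF.mem_support_bind_iff]
    simp [h, selectType, Step, succDist_ne_zero_iff]

/-- The two chains weight the present types differently, but both give each of them positive
probability. The supports agree, so one qualitative argument serves both chains. -/
theorem procChain_ne_zero_iff (α γ : Config Γ) :
    S.procChain α γ ≠ 0 ↔ (∃ X, S.Step α X γ) ∨ α = 0 ∧ γ = 0 := by
  by_cases h : α = 0
  · subst h
    simp [procChain, Step, PMF.pure_apply]
  · rw [procChain, dif_neg h, ← PMF.mem_support_iff, PMF.mem_support_bind_iff]
    simp [h, selectProc, Step, succDist_ne_zero_iff, Nat.one_le_iff_ne_zero]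

theorem step_of_isRun {σ : S.mdp.Scheduler} {α₀ : Config Γ} {ω : ℕ → Config Γ × Act Γ}
    (h : S.mdp.IsRun σ α₀ ω) (i : ℕ) :
    (∃ X, (ω i).2 = .sched X ∧ S.Step (ω i).1 X (ω (i + 1)).1) ∨
      (ω i).1 = 0 ∧ (ω (i + 1)).1 = 0 := by
  have h1 := σ.support_subset _ _ ((PMF.mem_support_iff _ _).2 (h.2.1 i))
  have h2 := h.2.2 i
  cases ha : (ω i).2 with
  | sched X =>
    rw [ha] at h1 h2
    exact Or.inl ⟨X, rfl, h1, (S.succDist_ne_zero_iff _ _ _).1 h2⟩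
  | idle =>
    rw [ha] at h1 h2
    have h1 : (ω i).1 = 0 := h1
    have h2 : PMF.pure (ω i).1 (ω (i + 1)).1 ≠ 0 := h2
    exact Or.inr ⟨h1, by simpa [h1, PMF.pure_apply] using h2⟩

end PBPP

/-! ### Rule systems without probabilities. -/

/-- Scheduling `X` in `α` can lead to `γ`, for the rules `X → β` with `β ∈ R X`. -/
def RStep {Γ : Type*} [DecidableEq Γ] (R : Γ → Finset (Config Γ)) (α : Config Γ) (X : Γ)
    (γ : Config Γ) : Prop :=
  1 ≤ α X ∧ ∃ β ∈ R X, γ = α - Pi.single X 1 + β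

/-- The probabilistic BPP in which all rules of a type have the same probability. -/
noncomputable def uniformPBPP {Γ : Type*} [DecidableEq Γ] (R : Γ → Finset (Config Γ))
    (hR : ∀ X, (R X).Nonempty) : PBPP Γ := by
  classical
  exact
  { rules := R
    prob := fun X β => if β ∈ R X then (1 : ℚ) / (R X).card else 0
    prob_pos := fun X β hβ => by
      have := (hR X).card_pos
      simp only [hβ, if_true]
      positivity
    prob_eq_zero := fun X β hβ => by simp [hβ]
    sum_prob := fun X => by
      have := (hR X).card_pos
      rw [Finset.sum_congr rfl (fun β hβ => if_pos hβ), Finset.sum_const, nsmul_eq_mul,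
        mul_one_div_cancel]
      exact_mod_cast this.ne' }

section Rename

variable {Γ : Type*} [DecidableEq Γ] {n : ℕ}

/-- The rules `R` for numbered types. -/
def renameRules (e : Γ ≃ Fin n) (R : Γ → Finset (Config Γ)) (i : Fin n) :
    Finset (Config (Fin n)) :=
  (R (e.symm i)).image (· ∘ e.symm)

theorem rStep_renameRules (e : Γ ≃ Fin n) (R : Γ → Finset (Config Γ)) (α : Config (Fin n))
    (X : Fin n) (γ : Config (Fin n)) :
    RStep (renameRules e R) α X γ ↔ RStep R (α ∘ e) (e.symm X) (γ ∘ e) := by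
  simp only [RStep, renameRules, Finset.mem_image, exists_exists_and_eq_and, Function.comp_apply,
    Equiv.apply_symm_apply]
  refine and_congr_right fun _ => exists_congr fun β => and_congr_right fun _ => ?_
  have key : (α - Pi.single X 1 + β ∘ e.symm) ∘ e = α ∘ e - Pi.single (e.symm X) 1 + β := by
    funext Y
    simp only [Function.comp_apply, Pi.add_apply, Pi.sub_apply, Equiv.symm_apply_apply,
      Pi.single_apply, Equiv.eq_symm_apply]
  rw [← key]
  exact ⟨fun h => h ▸ rfl, fun h => e.surjective.injective_comp_right h⟩

/-- For all rules, there is a probabilistic BPP that has these rules, with numbered types. -/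
theorem exists_pbpp (e : Γ ≃ Fin n) (R : Γ → Finset (Config Γ)) (hR : ∀ X, (R X).Nonempty) :
    ∃ S : PBPP (Fin n), ∀ α X γ, S.Step α X γ ↔ RStep R (α ∘ e) (e.symm X) (γ ∘ e) :=
  ⟨uniformPBPP (renameRules e R) fun _ => (hR _).image _, rStep_renameRules e R⟩

end Rename

/-! ### From step relations to hitting probabilities. -/

/-- A step of the system, where the empty configuration is absorbing. -/
def Succ {Γ : Type*} [DecidableEq Γ] (R : Γ → Finset (Config Γ)) (α γ : Config Γ) : Prop :=
  (∃ X, RStep R α X γ) ∨ α = 0 ∧ γ = 0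

/-- From the configuration at time `k`, an opponent of a scheduler that chooses only types allowed
by `P` can enforce, within finitely many steps and with positive probability, that `Z` is reached
before `F`. -/
inductive Avoid {Γ : Type*} [DecidableEq Γ] (R : Γ → Finset (Config Γ)) (F Z : Set (Config Γ))
    (P : ℕ → Config Γ → Γ → Prop) : ℕ → Config Γ → Prop
  | done (k : ℕ) (α : Config Γ) : α ∈ Z → Avoid R F Z P k α
  | step (k : ℕ) (α : Config Γ) (next : Γ → Config Γ) : α ∉ F → α ≠ 0 →
      (∀ X, 1 ≤ α X → P k α X → RStep R α X (next X)) →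
      (∀ X, 1 ≤ α X → P k α X → Avoid R F Z P (k + 1) (next X)) → Avoid R F Z P k α

section Prob

variable {Γ : Type*} [DecidableEq Γ] {n : ℕ} {e : Γ ≃ Fin n} {R : Γ → Finset (Config Γ)}
  {S : PBPP (Fin n)}
  {F Z : Set (Config Γ)} {α₀ : Config (Fin n)}

theorem comp_equiv_eq_zero (e : Γ ≃ Fin n) {α : Config (Fin n)} : α ∘ e = 0 ↔ α = 0 := by
  constructor
  · intro h
    funext i
    simpa using congrFun h (e.symm i)
  · rintro rfl
    rfl

theorem succ_of_step_or (hS : ∀ α X γ, S.Step α X γ ↔ RStep R (α ∘ e) (e.symm X) (γ ∘ e))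
    {α γ : Config (Fin n)} :
    ((∃ X, S.Step α X γ) ∨ α = 0 ∧ γ = 0) ↔ Succ R (α ∘ e) (γ ∘ e) := by
  simp only [Succ, comp_equiv_eq_zero, hS]
  refine or_congr ⟨fun ⟨X, h⟩ => ⟨_, h⟩, fun ⟨X, h⟩ => ⟨e X, by simpa using h⟩⟩ Iff.rfl

theorem chain_hitProb_eq_one {M : MarkovChain (Config (Fin n))}
    (hM : ∀ α γ, M α γ ≠ 0 ↔ (∃ X, S.Step α X γ) ∨ α = 0 ∧ γ = 0)
    (hS : ∀ α X γ, S.Step α X γ ↔ RStep R (α ∘ e) (e.symm X) (γ ∘ e))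
    (h : ∀ ω : ℕ → Config Γ, ω 0 = α₀ ∘ e → (∀ i, Succ R (ω i) (ω (i + 1))) → ∃ i, ω i ∈ F) :
    M.hitProb α₀ ((· ∘ e) ⁻¹' F) = 1 :=
  M.hitProb_eq_one _ _ fun ω h0 hω => h (fun i => ω i ∘ e) (by rw [h0])
    fun i => (succ_of_step_or hS).1 ((hM _ _).1 (hω i))

theorem mdp_hitProb_eq_one
    (hS : ∀ α X γ, S.Step α X γ ↔ RStep R (α ∘ e) (e.symm X) (γ ∘ e))
    (h : ∀ ω : ℕ → Config Γ, ω 0 = α₀ ∘ e → (∀ i, Succ R (ω i) (ω (i + 1))) → ∃ i, ω i ∈ F)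
    (σ : S.mdp.Scheduler) : S.mdp.hitProb σ α₀ ((· ∘ e) ⁻¹' F) = 1 :=
  MDP.hitProb_eq_one _ _ _ _ fun ω hω => h (fun i => (ω i).1 ∘ e) (by rw [hω.1]) fun i =>
    (succ_of_step_or hS).1 ((S.step_of_isRun hω i).imp (fun ⟨X, h⟩ => ⟨X, h.2⟩) id)

theorem mem_of_closed (hZ : ∀ α ∈ Z, ∀ γ, Succ R α γ → γ ∈ Z) {ω : ℕ → Config Γ} {N : ℕ}
    (hN : ω N ∈ Z) (hω : ∀ i, Succ R (ω i) (ω (i + 1))) {i : ℕ} (hi : N ≤ i) : ω i ∈ Z := by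
  induction i, hi using Nat.le_induction with
  | base => exact hN
  | succ i _ ih => exact hZ _ ih _ (hω i)

/-- The cylinder of `w` up to time `N` has positive probability. Its runs avoid `F` before `N`, and
from then on they stay in the closed set `Z`. -/
theorem chain_hitProb_ne_one {M : MarkovChain (Config (Fin n))}
    (hM : ∀ α γ, M α γ ≠ 0 ↔ (∃ X, S.Step α X γ) ∨ α = 0 ∧ γ = 0)
    (hS : ∀ α X γ, S.Step α X γ ↔ RStep R (α ∘ e) (e.symm X) (γ ∘ e))
    (hZ : ∀ α ∈ Z, ∀ γ, Succ R α γ → γ ∈ Z) (hZF : ∀ α ∈ Z, α ∉ F)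
    (w : ℕ → Config Γ) (N : ℕ) (h0 : w 0 = α₀ ∘ e) (hw : ∀ i < N, Succ R (w i) (w (i + 1)))
    (hN : w N ∈ Z) (hF : ∀ i < N, w i ∉ F) : M.hitProb α₀ ((· ∘ e) ⁻¹' F) ≠ 1 := by
  have key : ∀ i, (w i ∘ e.symm) ∘ e = w i := fun i => by funext; simp
  refine M.hitProb_ne_one _ _ (fun i => w i ∘ e.symm) N ?_ ?_ ?_
  · funext
    simp [h0]
  · intro i hi
    rw [hM, succ_of_step_or hS, key, key]
    exact hw i hi
  · intro ω h1 h2 i hi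
    have h3 : ∀ j ≤ N, ω j ∘ e = w j := fun j hj => by rw [h1 j hj, key]
    rcases lt_or_ge i N with h | h
    · exact hF i h (by simpa [h3 i h.le] using hi)
    · refine hZF (ω i ∘ e) (mem_of_closed (ω := fun i => ω i ∘ e) hZ (N := N) ?_ ?_ h) hi
      · simp only [h3 N le_rfl, hN]
      · exact fun j => (succ_of_step_or hS).1 ((hM _ _).1 (h2 j))

/-- The scheduler that schedules the type `pick k α` in the configuration `α` at time `k`. -/
noncomputable def pickScheduler (S : PBPP (Fin n)) (e : Γ ≃ Fin n) (pick : ℕ → Config Γ → Γ)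
    (hp : ∀ k (α : Config Γ), α ≠ 0 → 1 ≤ α (pick k α)) : S.mdp.Scheduler where
  choose w s := if s = 0 then PMF.pure .idle else PMF.pure (.sched (e (pick w.length (s ∘ e))))
  support_subset w s := by
    by_cases h : s = 0
    · rw [if_pos h, PMF.support_pure, Set.singleton_subset_iff]
      exact h
    · rw [if_neg h, PMF.support_pure, Set.singleton_subset_iff]
      exact hp w.length (s ∘ e) (by rwa [Ne, comp_equiv_eq_zero])

theorem history_length {Q A : Type*} (ω : ℕ → Q × A) (k : ℕ) :
    (MDP.history ω k).length = k := by
  simp [MDP.history]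

theorem pickScheduler_isRun (pick : ℕ → Config Γ → Γ) (hp : ∀ k (α : Config Γ), α ≠ 0 → 1 ≤ α (pick k α))
    {ω : ℕ → Config (Fin n) × Act (Fin n)}
    (h : S.mdp.IsRun (pickScheduler S e pick hp) α₀ ω) (i : ℕ) (hi : (ω i).1 ≠ 0) :
    (ω i).2 = .sched (e (pick i ((ω i).1 ∘ e))) := by
  have h1 := h.2.1 i
  simp only [pickScheduler, hi, if_false, history_length, PMF.pure_apply] at h1
  by_contra h2
  exact h1 (if_neg h2)

theorem pickScheduler_step (hS : ∀ α X γ, S.Step α X γ ↔ RStep R (α ∘ e) (e.symm X) (γ ∘ e))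
    (pick : ℕ → Config Γ → Γ) (hp : ∀ k (α : Config Γ), α ≠ 0 → 1 ≤ α (pick k α))
    {ω : ℕ → Config (Fin n) × Act (Fin n)}
    (h : S.mdp.IsRun (pickScheduler S e pick hp) α₀ ω) (i : ℕ) (hi : (ω i).1 ≠ 0) :
    RStep R ((ω i).1 ∘ e) (pick i ((ω i).1 ∘ e)) ((ω (i + 1)).1 ∘ e) := by
  rcases S.step_of_isRun h i with ⟨X, hX, h1⟩ | h1
  · rw [pickScheduler_isRun pick hp h i hi, Act.sched.injEq] at hX
    rw [hS, ← hX] at h1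
    simpa using h1
  · exact absurd h1.1 hi

theorem exists_scheduler_eq_one
    (hS : ∀ α X γ, S.Step α X γ ↔ RStep R (α ∘ e) (e.symm X) (γ ∘ e))
    (pick : ℕ → Config Γ → Γ) (hp : ∀ k (α : Config Γ), α ≠ 0 → 1 ≤ α (pick k α))
    (h : ∀ ω : ℕ → Config Γ, ω 0 = α₀ ∘ e →
      (∀ i, ω i ≠ 0 → RStep R (ω i) (pick i (ω i)) (ω (i + 1))) → ∃ i, ω i ∈ F) :
    ∃ σ : S.mdp.Scheduler, S.mdp.hitProb σ α₀ ((· ∘ e) ⁻¹' F) = 1 :=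
  ⟨pickScheduler S e pick hp, MDP.hitProb_eq_one _ _ _ _ fun ω hω =>
    h (fun i => (ω i).1 ∘ e) (by rw [hω.1]) fun i hi =>
      pickScheduler_step hS pick hp hω i (by rwa [Ne, comp_equiv_eq_zero] at hi)⟩

theorem mdp_step_δ (hS : ∀ α X γ, S.Step α X γ ↔ RStep R (α ∘ e) (e.symm X) (γ ∘ e))
    {α γ : Config (Fin n)} {X : Fin n} (h : RStep R (α ∘ e) (e.symm X) (γ ∘ e)) :
    S.mdp.δ α (.sched X) γ ≠ 0 :=
  (S.succDist_ne_zero_iff _ _ _).2 ((hS _ _ _).2 h).2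

/-- The scheduler may randomise and use the history, but any action it takes with positive
probability is answered by `Avoid` with a possible outcome. Following these answers builds a finite
path of positive probability that ends in `Z`. -/
theorem mdp_hitProb_ne_one
    (hS : ∀ α X γ, S.Step α X γ ↔ RStep R (α ∘ e) (e.symm X) (γ ∘ e))
    (hZ : ∀ α ∈ Z, ∀ γ, Succ R α γ → γ ∈ Z) (hZF : ∀ α ∈ Z, α ∉ F) (P : ℕ → Config Γ → Γ → Prop)
    (hA : Avoid R F Z P 0 (α₀ ∘ e)) (σ : S.mdp.Scheduler)
    (hP : ∀ w s X, σ.choose w s (.sched X) ≠ 0 → P w.length (s ∘ e) (e.symm X)) : S.mdp.hitProb σ α₀ ((· ∘ e) ⁻¹' F) ≠ 1 := by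
  -- In the path `w` the action at time `k` is already drawn, since the `k`-th entry consists of a
  -- state and the action taken there.
  have key : ∀ k α, Avoid R F Z P k α → ∀ w : ℕ → Config (Fin n) × Act (Fin n),
      (w k).1 ∘ e = α → S.mdp.runLaw σ α₀ {ω | ∀ i ≤ k, ω i = w i} ≠ 0 →
      (∀ i < k, (w i).1 ∘ e ∉ F) → σ.choose (MDP.history w k) (w k).1 (w k).2 ≠ 0 →
      S.mdp.hitProb σ α₀ ((· ∘ e) ⁻¹' F) ≠ 1 := by
    intro k α hα
    induction hα with
    | done k α hα =>
      intro w hk hw hF _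
      refine MDP.hitProb_ne_one _ _ _ _ w k hw fun ω h1 h2 i hi => ?_
      rcases lt_or_ge i k with h | h
      · exact hF i h (by rw [← h1 i h.le]; exact hi)
      · refine hZF ((ω i).1 ∘ e)
          (mem_of_closed (ω := fun i => (ω i).1 ∘ e) hZ (N := k) ?_ ?_ h) hi
        · simp only [h1 k le_rfl, hk, hα]
        · exact fun j =>
            (succ_of_step_or hS).1 ((S.step_of_isRun h2 j).imp (fun ⟨X, h⟩ => ⟨X, h.2⟩) id)
    | step k α next hαF hα0 hnext _ ih =>
      intro w hk hw hF hc
      have hen := σ.support_subset _ _ ((PMF.mem_support_iff _ _).2 hc)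
      obtain ⟨X, hX⟩ : ∃ X, (w k).2 = .sched X := by
        cases ha : (w k).2 with
        | sched X => exact ⟨X, rfl⟩
        | idle =>
          rw [ha] at hen
          exact absurd (hk ▸ (comp_equiv_eq_zero e).2 hen) hα0
      rw [hX] at hen
      have hPX : P k α (e.symm X) := by
        have := hP _ _ X (by rw [← hX]; exact hc)
        rwa [history_length, hk] at this
      have hαX : 1 ≤ α (e.symm X) := by
        rw [← hk]
        have h : 1 ≤ (w k).1 X := hen
        simpa using h
      have hih := ih (e.symm X) hαX hPX
      obtain ⟨γ, hγ'⟩ : ∃ γ, γ = next (e.symm X) := ⟨_, rfl⟩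
      have hγ := hnext (e.symm X) hαX hPX
      rw [← hγ'] at hih hγ
      -- The next action depends only on the history through time `k` and the new state `γ`; any
      -- action in the support will do.
      obtain ⟨a, ha⟩ := (σ.choose (MDP.history w (k + 1)) (γ ∘ e.symm)).support_nonempty
      rw [PMF.mem_support_iff] at ha
      have hγe : (γ ∘ e.symm) ∘ e = γ := by funext; simp
      let w' := Function.update w (k + 1) (γ ∘ e.symm, a)
      have hw'1 : w' (k + 1) = (γ ∘ e.symm, a) := Function.update_self ..
      have hw'2 : ∀ i ≤ k, w' i = w i := fun i hi => Function.update_of_ne (by omega) _ _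
      have hist : MDP.history w' (k + 1) = MDP.history w (k + 1) := by
        simp only [MDP.history]
        congr 1
        funext i
        exact hw'2 i (by omega)
      have hcyl : {ω : ℕ → Config (Fin n) × Act (Fin n) | ∀ i ≤ k, ω i = w' i} =
          {ω | ∀ i ≤ k, ω i = w i} := by
        ext ω
        exact forall₂_congr fun i hi => by rw [hw'2 i hi]
      refine hih w' (by rw [hw'1]; exact hγe) ?_ ?_ ?_
      · rw [MDP.runLaw_cylinder_succ, hcyl, hist, hw'1, hw'2 k le_rfl]
        refine mul_ne_zero hw (mul_ne_zero ?_ ha)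
        rw [hX]
        exact mdp_step_δ hS (by rw [hk, hγe]; exact hγ)
      · intro i hi
        rw [hw'2 i (by omega)]
        rcases Nat.lt_succ_iff_lt_or_eq.1 hi with h | rfl
        · exact hF i h
        · rwa [hk]
      · rw [hist, hw'1]
        exact ha
  obtain ⟨a, ha⟩ := (σ.choose [] α₀).support_nonempty
  rw [PMF.mem_support_iff] at ha
  refine key _ _ hA (fun _ => (α₀, a)) rfl ?_ (by simp) ha
  simp only [Nat.le_zero, forall_eq, MDP.runLaw_cylinder_zero]
  exact ha

theorem pickScheduler_hitProb_ne_one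
    (hS : ∀ α X γ, S.Step α X γ ↔ RStep R (α ∘ e) (e.symm X) (γ ∘ e))
    (hZ : ∀ α ∈ Z, ∀ γ, Succ R α γ → γ ∈ Z) (hZF : ∀ α ∈ Z, α ∉ F)
    (pick : ℕ → Config Γ → Γ) (hp : ∀ k (α : Config Γ), α ≠ 0 → 1 ≤ α (pick k α))
    (hA : Avoid R F Z (fun k α X => pick k α = X) 0 (α₀ ∘ e)) :
    S.mdp.hitProb (pickScheduler S e pick hp) α₀ ((· ∘ e) ⁻¹' F) ≠ 1 := by
  refine mdp_hitProb_ne_one hS hZ hZF _ hA _ fun w s X h => ?_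
  simp only [pickScheduler] at h
  split_ifs at h with hs
  · simp [PMF.pure_apply] at h
  · simp only [PMF.pure_apply, Act.sched.injEq, ne_eq, ite_eq_right_iff, one_ne_zero, imp_false,
      not_not] at h
    simp [h]

theorem pickScheduler_fair (hS : ∀ α X γ, S.Step α X γ ↔ RStep R (α ∘ e) (e.symm X) (γ ∘ e))
    (pick : ℕ → Config Γ → Γ) (hp : ∀ k (α : Config Γ), α ≠ 0 → 1 ≤ α (pick k α)) (k : ℕ)
    (hk : 0 < k)
    (h : ∀ ω : ℕ → Config Γ, ω 0 = α₀ ∘ e →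
      (∀ i, ω i ≠ 0 → RStep R (ω i) (pick i (ω i)) (ω (i + 1))) → (∀ i, ω i ≠ 0) ∧
      ∀ i X, (∀ j < k, 1 ≤ ω (i + j) X) → ∃ j < k, pick (i + j) (ω (i + j)) = X) :
    S.mdp.Fair k α₀ (pickScheduler S e pick hp) := by
  intro ω hω i a ha
  obtain ⟨h1, h2⟩ := h (fun i => (ω i).1 ∘ e) (by rw [hω.1]) fun i hi =>
    pickScheduler_step hS pick hp hω i (by rwa [Ne, comp_equiv_eq_zero] at hi)
  have h1' : ∀ i, (ω i).1 ≠ 0 := fun i => by simpa [comp_equiv_eq_zero] using h1 i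
  cases a with
  | idle => exact absurd (ha 0 hk) (h1' _)
  | sched X =>
    obtain ⟨j, hj, h3⟩ := h2 i (e.symm X) fun j hj => by
      have : 1 ≤ (ω (i + j)).1 X := ha j hj
      simpa using this
    refine ⟨j, hj, ?_⟩
    rw [pickScheduler_isRun pick hp hω _ (h1' _), h3, Equiv.apply_symm_apply]

end Prob

/-! ### Simulation of a two-counter machine by a BPP. -/

/-- A two-counter machine. In the state `q` it tests the counter `test q` and decrements it if it is
positive (`nz = true`). Then it goes to `target q nz` and adds `incr q nz` to the counters. -/
structure CounterMachine (Q : Type) where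
  test : Q → Bool
  target : Q → Bool → Q
  incr : Q → Bool → Bool → ℕ

namespace CounterMachine

variable {Q : Type} (M : CounterMachine Q)

/-- The outcome of the test in a state. -/
def outcome (s : Q × (Bool → ℕ)) : Bool := decide (s.2 (M.test s.1) ≠ 0)

/-- The number by which the counter `c` is decremented. -/
def decr (q : Q) (nz c : Bool) : ℕ := if nz = true ∧ c = M.test q then 1 else 0

/-- The successor of a configuration. -/
def next (s : Q × (Bool → ℕ)) : Q × (Bool → ℕ) :=
  (M.target s.1 (M.outcome s),
    fun c => s.2 c + M.incr s.1 (M.outcome s) c - M.decr s.1 (M.outcome s) c)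

end CounterMachine

/-- The control of the simulation of a counter machine: the state, the guessed outcome of the test,
and a clock. -/
abbrev Ctl (Q : Type) := Q × Bool × ZMod 3

/-- The types of the simulation of a counter machine: the counters, markers in two phases that are
labelled with a control, the controls, and the type that witnesses termination. -/
inductive Ty (Q : Type)
  | ctr (c : Bool)
  | mark (late : Bool) (c : Bool) (k : Ctl Q)
  | ctl (k : Ctl Q)
  | fin
  deriving DecidableEq

instance {Q : Type} [Finite Q] : Finite (Ty Q) := by
  let f : Ty Q → Bool ⊕ (Bool × Bool × Ctl Q) ⊕ Ctl Q ⊕ Unit := fun X => match X with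
    | .ctr c => .inl c
    | .mark l c k => .inr (.inl (l, c, k))
    | .ctl k => .inr (.inr (.inl k))
    | .fin => .inr (.inr (.inr ()))
  refine Finite.of_injective f ?_
  rintro (_ | _ | _ | _) (_ | _ | _ | _) h <;> simp_all [f]

namespace Sim

variable {Q : Type} [DecidableEq Q]

/-- The configuration with control `k` (`none` for `fin`), markers `m` and counters `n`. -/
def gconf (k : Option (Ctl Q)) (m : Bool → Option (Bool × Ctl Q)) (n : Bool → ℕ) : Config (Ty Q)
  | .ctr c => n c
  | .mark l c j => if m c = some (l, j) then 1 else 0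
  | .ctl j => if some j = k then 1 else 0
  | .fin => if k = none then 1 else 0

/-- The configuration with control `k`, markers `m` and counters `n`. -/
abbrev conf (k : Ctl Q) (m : Bool → Option (Bool × Ctl Q)) (n : Bool → ℕ) : Config (Ty Q) :=
  gconf (some k) m n

/-- The configuration with counters `n` only. -/
def counters (n : Bool → ℕ) : Config (Ty Q)
  | .ctr c => n c
  | .mark _ _ _ => 0
  | .ctl _ => 0
  | .fin => 0

variable [Fintype Q] (M : CounterMachine Q) (h0 h1 : Q)

/-- The possible next controls. -/
def succs (k : Ctl Q) : Finset (Ctl Q) :=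
  Finset.univ.image fun nz => (M.target k.1 k.2.1, nz, k.2.2 + 1)

/-- The decrement of the counter `c`. -/
abbrev drop (k : Ctl Q) (c : Bool) : ℕ := M.decr k.1 k.2.1 c

open Classical in
/-- The rules of the simulation. -/
noncomputable def rules : Ty Q → Finset (Config (Ty Q))
  | .ctr c => Finset.univ.image fun k => Pi.single (.mark false c k) 1
  | .mark false c k => {Pi.single (.mark true c k) 1}
  | .mark true c k => {Pi.single (.ctr c) (1 - drop M k c)}
  | .ctl k => if k.1 = h0 then {Pi.single .fin 1} else
      (succs M k).image fun j => Pi.single (.ctl j) 1 + counters (M.incr k.1 k.2.1)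
  | .fin => {Pi.single .fin 1}

variable {M h0 h1}

theorem mem_rules_ctr {c : Bool} {β : Config (Ty Q)} :
    β ∈ rules M h0 (.ctr c) ↔ ∃ k, β = Pi.single (.mark false c k) 1 := by
  simp [rules, eq_comm, -Prod.exists]

theorem mem_rules_ctl {k : Ctl Q} (hk : k.1 ≠ h0) {β : Config (Ty Q)} :
    β ∈ rules M h0 (.ctl k) ↔
      ∃ j ∈ succs M k, β = Pi.single (.ctl j) 1 + counters (M.incr k.1 k.2.1) := by
  simp only [rules, if_neg hk, Finset.mem_image, @eq_comm _ _ β]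

theorem rules_nonempty (X : Ty Q) (k : Ctl Q) : (rules M h0 X).Nonempty := by
  rcases X with c | ⟨_ | _, c, k⟩ | k | _
  · exact ⟨_, mem_rules_ctr.2 ⟨k, rfl⟩⟩
  · exact Finset.singleton_nonempty _
  · exact Finset.singleton_nonempty _
  · simp only [rules]
    split_ifs
    · exact Finset.singleton_nonempty _
    · simp [succs]
  · exact Finset.singleton_nonempty _

theorem conf_inj {k k' : Ctl Q} {m m' : Bool → Option (Bool × Ctl Q)} {n n' : Bool → ℕ} :
    conf k m n = conf k' m' n' ↔ k = k' ∧ m = m' ∧ n = n' := by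
  refine ⟨fun h => ⟨?_, ?_, ?_⟩, by rintro ⟨rfl, rfl, rfl⟩; rfl⟩
  · have := congrFun h (.ctl k)
    by_contra hk
    simp [gconf, hk] at this
  · funext c
    refine Option.ext fun ⟨l, j⟩ => ?_
    have := congrFun h (.mark l c j)
    simp only [gconf] at this
    split_ifs at this <;> simp_all
  · funext c
    exact congrFun h (.ctr c)

theorem step_ctl {k j : Ctl Q} {m : Bool → Option (Bool × Ctl Q)} {n : Bool → ℕ}
    {δ : Config (Ty Q)} (h : RStep (rules M h0) (conf k m n) (.ctl j) δ) :
    j = k ∧ (k.1 = h0 ∧ 1 ≤ δ .fin ∧ (∀ k' m' n', δ ≠ conf k' m' n') ∨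
      k.1 ≠ h0 ∧ δ .fin = 0 ∧ ∃ k' ∈ succs M k,
        δ = conf k' m fun c => n c + M.incr k.1 k.2.1 c) := by
  obtain ⟨h1, β, hβ, rfl⟩ := h
  obtain rfl : j = k := by
    by_contra hk
    simp [gconf, hk] at h1
  refine ⟨rfl, ?_⟩
  by_cases h : j.1 = h0
  · simp only [rules, h, if_true, Finset.mem_singleton] at hβ
    subst hβ
    refine Or.inl ⟨h, by simp, fun k' m' n' he => ?_⟩
    have := congrFun he .fin
    simp [gconf] at this
  · obtain ⟨k', hk', rfl⟩ := (mem_rules_ctl h).1 hβ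
    refine Or.inr ⟨h, by simp [gconf, counters], k', hk', ?_⟩
    funext Y
    rcases Y with c | ⟨l, c, i⟩ | i | _ <;> simp [gconf, counters, Pi.single_apply, eq_comm]

theorem step_ctl_of_mem {k k' : Ctl Q} {m : Bool → Option (Bool × Ctl Q)} {n : Bool → ℕ}
    (hk : k.1 ≠ h0) (h : k' ∈ succs M k) :
    RStep (rules M h0) (conf k m n) (.ctl k) (conf k' m fun c => n c + M.incr k.1 k.2.1 c) := by
  refine ⟨by simp [gconf], _, (mem_rules_ctl hk).2 ⟨k', h, rfl⟩, ?_⟩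
  funext Y
  rcases Y with c | ⟨l, c, i⟩ | i | _ <;> simp [gconf, counters, Pi.single_apply, eq_comm]

theorem step_early_iff {k : Option (Ctl Q)} {j : Ctl Q} {c : Bool} {m : Bool → Option (Bool × Ctl Q)} {n : Bool → ℕ}
    {δ : Config (Ty Q)} : RStep (rules M h0) (gconf k m n) (.mark false c j) δ ↔
    m c = some (false, j) ∧ δ = gconf k (Function.update m c (some (true, j))) n := by
  have key : m c = some (false, j) → gconf k m n - Pi.single (.mark false c j) 1 +
      Pi.single (.mark true c j) 1 = gconf k (Function.update m c (some (true, j))) n := by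
    intro h
    funext Y
    rcases Y with d | ⟨l, d, i⟩ | i | _ <;> simp [gconf, Pi.single_apply]
    rcases eq_or_ne d c with rfl | hd
    · cases l <;> by_cases hij : i = j <;> simp_all [eq_comm]
    · simp [hd]
  by_cases h : m c = some (false, j)
  · simp [RStep, rules, gconf, h, ← key h]
  · simp [RStep, gconf, h]

/-- The marker is a process borrowed from the counter. Giving it back or losing it is how the
decrement belonging to its label is carried out. -/
theorem step_late_iff {k : Option (Ctl Q)} {j : Ctl Q} {c : Bool} {m : Bool → Option (Bool × Ctl Q)} {n : Bool → ℕ}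
    {δ : Config (Ty Q)} : RStep (rules M h0) (gconf k m n) (.mark true c j) δ ↔
    m c = some (true, j) ∧ δ = gconf k (Function.update m c none)
      (fun d => n d + if d = c then 1 - drop M j c else 0) := by
  have key : m c = some (true, j) → gconf k m n - Pi.single (.mark true c j) 1 +
      Pi.single (.ctr c) (1 - drop M j c) = gconf k (Function.update m c none)
        (fun d => n d + if d = c then 1 - drop M j c else 0) := by
    intro h
    funext Y
    rcases Y with d | ⟨l, d, i⟩ | i | _ <;> simp [gconf, Pi.single_apply]
    rcases eq_or_ne d c with rfl | hd
    · cases l <;> by_cases hij : i = j <;> simp_all [eq_comm]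
    · simp [hd]
  by_cases h : m c = some (true, j)
  · simp [RStep, rules, gconf, h, ← key h]
  · simp [RStep, gconf, h]

theorem step_ctr_none_iff {k : Option (Ctl Q)} {c : Bool} {m : Bool → Option (Bool × Ctl Q)} {n : Bool → ℕ}
    {δ : Config (Ty Q)} (h : m c = none) : RStep (rules M h0) (gconf k m n) (.ctr c) δ ↔
    1 ≤ n c ∧ ∃ j, δ = gconf k (Function.update m c (some (false, j)))
      (fun d => n d - if d = c then 1 else 0) := by
  have key : ∀ j, gconf k m n - Pi.single (.ctr c) 1 +
      Pi.single (.mark false c j) 1 = gconf k (Function.update m c (some (false, j)))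
        (fun d => n d - if d = c then 1 else 0) := by
    intro j
    funext Y
    rcases Y with d | ⟨l, d, i⟩ | i | _ <;> simp [gconf, Pi.single_apply]
    rcases eq_or_ne d c with rfl | hd
    · cases l <;> by_cases hij : i = j <;> simp_all [eq_comm]
    · simp [hd]
  simp [RStep, rules, ← key, gconf, -Prod.exists]

/-- The counter would carry two markers, whereas the configurations `conf` have at most one for each
counter. -/
theorem step_ctr_some {k : Ctl Q} {c : Bool} {m : Bool → Option (Bool × Ctl Q)} {n : Bool → ℕ}
    {δ : Config (Ty Q)} (h : m c ≠ none) (hs : RStep (rules M h0) (conf k m n) (.ctr c) δ) :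
    (∀ k' m' n', δ ≠ conf k' m' n') ∧ δ .fin = 0 := by
  obtain ⟨⟨l, i⟩, hi⟩ := Option.ne_none_iff_exists'.1 h
  obtain ⟨h1, β, hβ, rfl⟩ := hs
  obtain ⟨j, rfl⟩ := mem_rules_ctr.1 hβ
  refine ⟨fun k' m' n' he => ?_, by simp [gconf]⟩
  have e1 := congrFun he (.mark l c i)
  have e2 := congrFun he (.mark false c j)
  simp only [gconf, Pi.add_apply, Pi.sub_apply, hi, Pi.single_apply] at e1 e2
  -- The second marker either equals the first, giving multiplicity two, or gives two different
  -- markers of the same counter.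
  by_cases hl : l = false ∧ i = j
  · obtain ⟨rfl, rfl⟩ := hl
    simp at e1
    split_ifs at e1
    omega
  · simp at e1 e2
    split_ifs at e1 e2; simp_all

theorem not_step_fin {k : Ctl Q} {m : Bool → Option (Bool × Ctl Q)} {n : Bool → ℕ}
    {δ : Config (Ty Q)} : ¬ RStep (rules M h0) (conf k m n) .fin δ := by
  simp [RStep, gconf]

end Sim

/-! ### Forced runs, good and wrong configurations. -/

/-- From `α` at time `k` there is a forced sequence of steps through `G` to `E`: at each time, the
type `pick` leads to the next configuration of the sequence or to `W`, and all other types lead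
outside of `G`, `W` and `T`. -/
inductive Forced {Γ : Type*} [DecidableEq Γ] (R : Γ → Finset (Config Γ))
    (pick : ℕ → Config Γ → Γ) (G W T E : Set (Config Γ)) : ℕ → Config Γ → Prop
  | base (k : ℕ) (α : Config Γ) : α ∈ E → Forced R pick G W T E k α
  | step (k : ℕ) (α γ : Config Γ) : α ∈ G → RStep R α (pick k α) γ →
      (∀ δ, RStep R α (pick k α) δ → δ = γ ∨ δ ∈ W) →
      (∀ Y, Y ≠ pick k α → ∀ δ, RStep R α Y δ → δ ∉ G ∧ δ ∉ W ∧ δ ∉ T) →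
      Forced R pick G W T E (k + 1) γ → Forced R pick G W T E k α

namespace Sim

variable {Q : Type} [DecidableEq Q] [Fintype Q] (M : CounterMachine Q) (h0 h1 : Q)

/-- The guess in the control `k`, made by the control `j`, is right. -/
def RightGuess (j k : Ctl Q) (n : Bool → ℕ) : Prop :=
  k.1 ≠ h1 ∧ k.2.1 = decide (n (M.test k.1) - drop M j (M.test k.1) ≠ 0)

/-- The configurations that occur in a faithful simulation. -/
def Good (k : Ctl Q) (m : Bool → Option (Bool × Ctl Q)) (n : Bool → ℕ) : Prop :=
  (m false = some (true, k) ∧ m true = some (true, k)) ∨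
  (∃ j, k ∈ succs M j ∧
    ((m false = some (true, j) ∧ m true = some (true, j) ∧ RightGuess M h1 j k n) ∨
     (m false = none ∧ m true = some (true, j)) ∨
     (m false = some (false, k) ∧ m true = some (true, j)))) ∨
  (m false = some (false, k) ∧ m true = none) ∨
  (m false = some (false, k) ∧ m true = some (false, k)) ∨
  (m false = some (true, k) ∧ m true = some (false, k))

/-- The configurations that result from a wrong random choice in a faithful simulation. -/
def Wrong (k : Ctl Q) (m : Bool → Option (Bool × Ctl Q)) (n : Bool → ℕ) : Prop :=
  (∃ j, k ∈ succs M j ∧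
    ((m false = some (true, j) ∧ m true = some (true, j) ∧ ¬ RightGuess M h1 j k n) ∨
     ∃ i, i ≠ k ∧ m false = some (false, i) ∧ m true = some (true, j))) ∨
  ∃ i, i ≠ k ∧ m false = some (false, k) ∧ m true = some (false, i)

/-- The common shape of good and wrong configurations. -/
def Shape (k : Ctl Q) (m : Bool → Option (Bool × Ctl Q)) : Prop :=
  (m false = some (true, k) ∧ m true = some (true, k)) ∨
  (∃ j, k.2.2 = j.2.2 + 1 ∧
    ((m false = some (true, j) ∧ m true = some (true, j)) ∨
     (m false = none ∧ m true = some (true, j)) ∨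
     (∃ i, m false = some (false, i) ∧ m true = some (true, j)))) ∨
  (m false = some (false, k) ∧ m true = none) ∨
  (∃ i, m false = some (false, k) ∧ m true = some (false, i)) ∨
  (m false = some (true, k) ∧ m true = some (false, k))

/-- The set of good configurations. -/
def goodSet : Set (Config (Ty Q)) := {α | ∃ k m n, α = conf k m n ∧ Good M h1 k m n}

/-- The set of wrong configurations. -/
def wrongSet : Set (Config (Ty Q)) := {α | ∃ k m n, α = conf k m n ∧ Wrong M h1 k m n}

/-- The set of configurations that witness termination. -/
def finSet (Q : Type) : Set (Config (Ty Q)) := {α | 1 ≤ α .fin}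

variable {M h0 h1}

theorem conf_mem_goodSet {k : Ctl Q} {m : Bool → Option (Bool × Ctl Q)} {n : Bool → ℕ} :
    conf k m n ∈ goodSet M h1 ↔ Good M h1 k m n := by
  constructor
  · rintro ⟨k', m', n', h, hg⟩
    obtain ⟨rfl, rfl, rfl⟩ := conf_inj.1 h
    exact hg
  · exact fun h => ⟨_, _, _, rfl, h⟩

theorem conf_mem_wrongSet {k : Ctl Q} {m : Bool → Option (Bool × Ctl Q)} {n : Bool → ℕ} :
    conf k m n ∈ wrongSet M h1 ↔ Wrong M h1 k m n := by
  constructor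
  · rintro ⟨k', m', n', h, hg⟩
    obtain ⟨rfl, rfl, rfl⟩ := conf_inj.1 h
    exact hg
  · exact fun h => ⟨_, _, _, rfl, h⟩

theorem conf_notMem_finSet {k : Ctl Q} {m : Bool → Option (Bool × Ctl Q)} {n : Bool → ℕ} :
    conf k m n ∉ finSet Q := by
  simp [finSet, gconf]

theorem mem_succs {j k : Ctl Q} :
    k ∈ succs M j ↔ k.1 = M.target j.1 j.2.1 ∧ k.2.2 = j.2.2 + 1 := by
  obtain ⟨q, g, z⟩ := k
  simp only [succs, Finset.mem_image, Finset.mem_univ, true_and, Prod.mk.injEq]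
  constructor
  · rintro ⟨_, rfl, rfl, rfl⟩
    exact ⟨rfl, rfl⟩
  · rintro ⟨rfl, rfl⟩
    exact ⟨g, rfl, rfl, rfl⟩

theorem Good.shape {k : Ctl Q} {m : Bool → Option (Bool × Ctl Q)} {n : Bool → ℕ}
    (h : Good M h1 k m n) : Shape k m := by
  simp only [Good, mem_succs] at h
  simp only [Shape]
  grind

theorem Wrong.shape {k : Ctl Q} {m : Bool → Option (Bool × Ctl Q)} {n : Bool → ℕ}
    (h : Wrong M h1 k m n) : Shape k m := by
  simp only [Wrong, mem_succs] at h
  simp only [Shape]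
  grind

theorem clock_ne {z w : ZMod 3} (h : z = w + 1) : z ≠ w := by
  revert z w; decide

/-- This is the reason for the modulus 3: modulo 2 a clock value would be both predecessor and
successor of its neighbour. -/
theorem clock_ne' {z w : ZMod 3} (h : z = w + 1) : w ≠ z + 1 := by
  revert z w; decide

theorem Good.not_wrong {k : Ctl Q} {m : Bool → Option (Bool × Ctl Q)} {n : Bool → ℕ}
    (h : Good M h1 k m n) : ¬ Wrong M h1 k m n := by
  simp only [Good, mem_succs] at h
  simp only [Wrong, mem_succs]
  have := @clock_ne
  grind

theorem notMem_of_not_shape {k : Ctl Q} {m : Bool → Option (Bool × Ctl Q)} {n : Bool → ℕ}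
    (h : ¬ Shape k m) : conf k m n ∉ goodSet M h1 ∧ conf k m n ∉ wrongSet M h1 :=
  ⟨fun h' => h (conf_mem_goodSet.1 h').shape, fun h' => h (conf_mem_wrongSet.1 h').shape⟩

theorem notMem_of_ne_conf {δ : Config (Ty Q)} (h : ∀ k' m' n', δ ≠ conf k' m' n') :
    δ ∉ goodSet M h1 ∧ δ ∉ wrongSet M h1 :=
  ⟨fun ⟨_, _, _, h', _⟩ => h _ _ _ h', fun ⟨_, _, _, h', _⟩ => h _ _ _ h'⟩

/-- The hypotheses say that each control or marker move other than `X`, and each new marker on an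
unmarked counter other than `X`, destroys the shape. Scheduling a counter that has a marker already
does so anyway. `fin` can only arise from a control in the state `h0`. -/
theorem stray {k : Ctl Q} {m : Bool → Option (Bool × Ctl Q)} {n : Bool → ℕ} {X : Ty Q}
    (hC : X = .ctl k ∨ ∀ j : Ctl Q, j.2.2 = k.2.2 + 1 → ¬ Shape j m)
    (hE : ∀ c j, m c = some (false, j) → X = .mark false c j ∨
      ¬ Shape k (Function.update m c (some (true, j))))
    (hL : ∀ c j, m c = some (true, j) → X = .mark true c j ∨ ¬ Shape k (Function.update m c none))
    (hN : ∀ c, m c = none → X = .ctr c ∨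
      ∀ j, ¬ Shape k (Function.update m c (some (false, j)))) :
    ∀ Y ≠ X, ∀ δ, RStep (rules M h0) (conf k m n) Y δ →
      δ ∉ goodSet M h1 ∧ δ ∉ wrongSet M h1 ∧ (k.1 ≠ h0 → δ ∉ finSet Q) := by
  intro Y hY δ h
  rcases Y with c | ⟨_ | _, c, j⟩ | j | _
  · by_cases hc : m c = none
    · obtain ⟨-, j, rfl⟩ := (step_ctr_none_iff hc).1 h
      have := notMem_of_not_shape (M := M) (h1 := h1)
        (n := fun d => n d - if d = c then 1 else 0) (((hN c hc).resolve_left hY.symm) j)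
      exact ⟨this.1, this.2, fun _ => conf_notMem_finSet⟩
    · have h' := step_ctr_some hc h
      have := notMem_of_ne_conf (M := M) (h1 := h1) h'.1
      exact ⟨this.1, this.2, fun _ => by simp [finSet, h'.2]⟩
  · obtain ⟨hm, rfl⟩ := step_early_iff.1 h
    have := notMem_of_not_shape (M := M) (h1 := h1) (n := n) ((hE c j hm).resolve_left hY.symm)
    exact ⟨this.1, this.2, fun _ => conf_notMem_finSet⟩
  · obtain ⟨hm, rfl⟩ := step_late_iff.1 h
    have := notMem_of_not_shape (M := M) (h1 := h1)
      (n := fun d => n d + if d = c then 1 - drop M j c else 0)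
      ((hL c j hm).resolve_left hY.symm)
    exact ⟨this.1, this.2, fun _ => conf_notMem_finSet⟩
  · obtain ⟨rfl, h' | h'⟩ := step_ctl h
    · have := notMem_of_ne_conf (M := M) (h1 := h1) h'.2.2
      exact ⟨this.1, this.2, fun hk => absurd h'.1 hk⟩
    · obtain ⟨-, -, i, hi, rfl⟩ := h'
      have := notMem_of_not_shape (M := M) (h1 := h1)
        (n := fun c => n c + M.incr j.1 j.2.1 c)
        (hC.resolve_left hY.symm i (mem_succs.1 hi).2)
      exact ⟨this.1, this.2, fun _ => conf_notMem_finSet⟩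
  · exact absurd h not_step_fin

/-- The position within a round at which a type is scheduled. -/
def group : Ty Q → ℕ
  | .ctl _ => 0
  | .fin => 0
  | .mark true false _ => 1
  | .ctr false => 2
  | .mark true true _ => 3
  | .ctr true => 4
  | .mark false false _ => 5
  | .mark false true _ => 6

open Classical in
/-- The scheduler of the simulation: schedule a type of the group that is due, or else a control. -/
noncomputable def pick (k : ℕ) (α : Config (Ty Q)) : Ty Q :=
  if h : ∃ X, group X = k % 7 ∧ 1 ≤ α X then h.choose
  else if h : ∃ X, group X = 0 ∧ 1 ≤ α X then h.choose
  else if h : ∃ X, 1 ≤ α X then h.choose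
  else .fin

theorem pick_pos (k : ℕ) (α : Config (Ty Q)) (hα : α ≠ 0) : 1 ≤ α (pick k α) := by
  have h3 : ∃ X, 1 ≤ α X := by
    obtain ⟨X, hX⟩ := Function.ne_iff.1 hα
    exact ⟨X, Nat.one_le_iff_ne_zero.2 hX⟩
  unfold pick
  split_ifs with h h'
  · exact h.choose_spec.2
  · exact h'.choose_spec.2
  · exact h3.choose_spec

theorem pick_eq {k : ℕ} {α : Config (Ty Q)} {X : Ty Q} (hg : group X = k % 7) (hX : 1 ≤ α X)
    (h : ∀ Y, group Y = group X → 1 ≤ α Y → Y = X) : pick k α = X := by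
  have h' : ∃ X, group X = k % 7 ∧ 1 ≤ α X := ⟨X, hg, hX⟩
  unfold pick
  rw [dif_pos h']
  exact h _ (h'.choose_spec.1.trans hg.symm) h'.choose_spec.2

/-- There is one control or `fin`, and at most one marker per counter, so each group contains at
most one present type. The arbitrary choice in `pick` is therefore determined when the due group is
present. -/
theorem pick_conf {k : ℕ} {j : Option (Ctl Q)} {m : Bool → Option (Bool × Ctl Q)} {n : Bool → ℕ} {X : Ty Q}
    (hg : group X = k % 7) (hX : 1 ≤ gconf j m n X) : pick k (gconf j m n) = X := by
  refine pick_eq hg hX fun Y hY hY1 => ?_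
  clear hg
  rcases X with ⟨_ | _⟩ | ⟨_ | _, _ | _, i⟩ | i | _ <;>
    rcases Y with ⟨_ | _⟩ | ⟨_ | _, _ | _, i'⟩ | i' | _ <;>
    simp only [group, gconf, reduceCtorEq] at hX hY hY1 ⊢ <;> grind

end Sim

end BPP

/-! ### The seven steps of a round. -/

namespace BPP
namespace Sim

variable {Q : Type} [DecidableEq Q] [Fintype Q] {M : CounterMachine Q} {h0 h1 : Q}

/-- The markers `a` and `b` of the two counters. -/
def marks (a b : Option (Bool × Ctl Q)) (c : Bool) : Option (Bool × Ctl Q) := if c then b else a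

@[simp] theorem marks_false (a b : Option (Bool × Ctl Q)) : marks a b false = a := rfl

@[simp] theorem marks_true (a b : Option (Bool × Ctl Q)) : marks a b true = b := rfl

@[simp] theorem update_marks_false (a b x : Option (Bool × Ctl Q)) :
    Function.update (marks a b) false x = marks x b := by
  funext c; cases c <;> simp

@[simp] theorem update_marks_true (a b x : Option (Bool × Ctl Q)) :
    Function.update (marks a b) true x = marks a x := by
  funext c; cases c <;> simp

variable {T E : Set (Config (Ty Q))} {t : ℕ}

/-- The condition on `T` excludes `T = finSet Q` when the control is in `h0`, because scheduling it
early would produce `fin`. -/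
theorem forced_step {k : Ctl Q} {m : Bool → Option (Bool × Ctl Q)} {n : Bool → ℕ} (X : Ty Q)
    {γ : Config (Ty Q)} (hg : group X = t % 7) (hG : Good M h1 k m n)
    (hT : T = ∅ ∨ T = finSet Q ∧ k.1 ≠ h0)
    (hC : X = .ctl k ∨ ∀ j : Ctl Q, j.2.2 = k.2.2 + 1 → ¬ Shape j m)
    (hE : ∀ c j, m c = some (false, j) → X = .mark false c j ∨
      ¬ Shape k (Function.update m c (some (true, j))))
    (hL : ∀ c j, m c = some (true, j) → X = .mark true c j ∨ ¬ Shape k (Function.update m c none))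
    (hN : ∀ c, m c = none → X = .ctr c ∨ ∀ j, ¬ Shape k (Function.update m c (some (false, j))))
    (hX : RStep (rules M h0) (conf k m n) X γ)
    (hR : ∀ δ, RStep (rules M h0) (conf k m n) X δ → δ = γ ∨ δ ∈ wrongSet M h1)
    (h : Forced (rules M h0) pick (goodSet M h1) (wrongSet M h1) T E (t + 1) γ) :
    Forced (rules M h0) pick (goodSet M h1) (wrongSet M h1) T E t (conf k m n) := by
  have hp : pick t (conf k m n) = X := pick_conf hg hX.1
  refine .step t _ γ (conf_mem_goodSet.2 hG) (hp.symm ▸ hX) (hp.symm ▸ hR) ?_ h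
  rw [hp]
  intro Y hY δ hδ
  obtain ⟨h1, h2, h3⟩ := stray hC hE hL hN Y hY δ hδ
  refine ⟨h1, h2, ?_⟩
  rcases hT with rfl | ⟨rfl, hT⟩
  · simp
  · exact h3 hT

/-- The random choice is the guess in the next control. The increments are made now, but the
decrements await the markers, which still carry `j`. The guess in `k` need not be right, so that the
step into `h1` is covered too. -/
theorem forced_control {j k : Ctl Q} {n : Bool → ℕ} (ht : t % 7 = 0) (hj : j.1 ≠ h0)
    (hT : T = ∅ ∨ T = finSet Q) (hk : k ∈ succs M j)
    (hR : ∀ i ∈ succs M j, i ≠ k → ¬ RightGuess M h1 j i fun c => n c + M.incr j.1 j.2.1 c)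
    (h : Forced (rules M h0) pick (goodSet M h1) (wrongSet M h1) T E (t + 1)
      (conf k (marks (some (true, j)) (some (true, j))) fun c => n c + M.incr j.1 j.2.1 c)) :
    Forced (rules M h0) pick (goodSet M h1) (wrongSet M h1) T E t
      (conf j (marks (some (true, j)) (some (true, j))) n) := by
  have hs : ¬ Shape j (marks none (some (true, j))) ∧ ¬ Shape j (marks (some (true, j)) none) := by
    have := @clock_ne j.2.2 j.2.2
    simp only [Shape, marks_false, marks_true]
    grind
  refine forced_step (.ctl j) (by simp [group, ht]) ?_ ?_ (Or.inl rfl) ?_ ?_ ?_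
    (step_ctl_of_mem hj hk) ?_ h
  · simp [Good]
  · simpa [hj] using hT
  · rintro (_ | _) i hi <;> simp at hi
  · rintro (_ | _) i hi <;> simp [hs]
  · rintro (_ | _) hi <;> simp at hi
  · intro δ hδ
    obtain ⟨-, h' | ⟨-, -, i, hi, rfl⟩⟩ := step_ctl hδ
    · exact absurd h'.1 hj
    · by_cases hik : i = k
      · exact Or.inl (by rw [hik])
      · exact Or.inr (conf_mem_wrongSet.2 (Or.inl ⟨j, hi, Or.inl ⟨rfl, rfl, hR i hi hik⟩⟩))

theorem forced_first {j k : Ctl Q} {n : Bool → ℕ} (ht : t % 7 = 1)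
    (hT : T = ∅ ∨ T = finSet Q ∧ k.1 ≠ h0) (hk : k ∈ succs M j) (hR : RightGuess M h1 j k n)
    (h : Forced (rules M h0) pick (goodSet M h1) (wrongSet M h1) T E (t + 1)
      (conf k (marks none (some (true, j)))
        fun c => n c + if c = false then 1 - drop M j false else 0)) :
    Forced (rules M h0) pick (goodSet M h1) (wrongSet M h1) T E t
      (conf k (marks (some (true, j)) (some (true, j))) n) := by
  have hc := (mem_succs.1 hk).2
  refine forced_step (.mark true false j) (by simp [group, ht]) ?_ hT (Or.inr ?_) ?_ ?_ ?_
    (step_late_iff.2 ⟨rfl, by simp⟩) ?_ h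
  · exact Or.inr (Or.inl ⟨j, hk, Or.inl ⟨rfl, rfl, hR⟩⟩)
  · intro i hi
    -- If the control moves again, its clock is two ahead of the label `j`, which modulo 3 is
    -- neither equal to it nor one ahead.
    have h1 := clock_ne' hc
    have h2 : i.2.2 ≠ j.2.2 + 1 := fun h => clock_ne hi (h.trans hc.symm)
    simp only [Shape, marks_false, marks_true]
    grind
  · rintro (_ | _) i hi <;> simp at hi
  · rintro (_ | _) i hi
    · left; simp at hi; rw [hi]
    · right
      simp [Shape]
  · rintro (_ | _) hi <;> simp at hi
  · intro δ hδ
    obtain ⟨-, rfl⟩ := step_late_iff.1 hδ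
    simp

/-- The counter cannot see the control, so the label of its new marker is random; a label other than
`k` gives a wrong configuration. -/
theorem forced_second {j k : Ctl Q} {n : Bool → ℕ} (ht : t % 7 = 2)
    (hT : T = ∅ ∨ T = finSet Q ∧ k.1 ≠ h0) (hk : k ∈ succs M j) (hn : 1 ≤ n false)
    (h : Forced (rules M h0) pick (goodSet M h1) (wrongSet M h1) T E (t + 1)
      (conf k (marks (some (false, k)) (some (true, j)))
        fun c => n c - if c = false then 1 else 0)) :
    Forced (rules M h0) pick (goodSet M h1) (wrongSet M h1) T E t
      (conf k (marks none (some (true, j))) n) := by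
  have hc := (mem_succs.1 hk).2
  refine forced_step (.ctr false) (by simp [group, ht]) ?_ hT (Or.inr ?_) ?_ ?_ ?_
    ((step_ctr_none_iff rfl).2 ⟨hn, k, by simp⟩) ?_ h
  · exact Or.inr (Or.inl ⟨j, hk, Or.inr (Or.inl ⟨rfl, rfl⟩)⟩)
  · intro i hi
    have h2 : i.2.2 ≠ j.2.2 + 1 := fun h => clock_ne hi (h.trans hc.symm)
    simp only [Shape, marks_false, marks_true]
    grind
  · rintro (_ | _) i hi <;> simp at hi
  · rintro (_ | _) i hi
    · simp at hi
    · right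
      simp [Shape]
  · rintro (_ | _) hi
    · exact Or.inl rfl
    · simp at hi
  · intro δ hδ
    obtain ⟨-, i, rfl⟩ := (step_ctr_none_iff rfl).1 hδ
    by_cases hik : i = k
    · subst hik
      simp
    · exact Or.inr (conf_mem_wrongSet.2
        (Or.inl ⟨j, hk, Or.inr ⟨i, hik, by simp, by simp⟩⟩))

theorem forced_third {j k : Ctl Q} {n : Bool → ℕ} (ht : t % 7 = 3)
    (hT : T = ∅ ∨ T = finSet Q ∧ k.1 ≠ h0) (hk : k ∈ succs M j)
    (h : Forced (rules M h0) pick (goodSet M h1) (wrongSet M h1) T E (t + 1)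
      (conf k (marks (some (false, k)) none)
        fun c => n c + if c = true then 1 - drop M j true else 0)) :
    Forced (rules M h0) pick (goodSet M h1) (wrongSet M h1) T E t
      (conf k (marks (some (false, k)) (some (true, j))) n) := by
  have hc := (mem_succs.1 hk).2
  refine forced_step (.mark true true j) (by simp [group, ht]) ?_ hT (Or.inr ?_) ?_ ?_ ?_
    (step_late_iff.2 ⟨rfl, by simp⟩) ?_ h
  · exact Or.inr (Or.inl ⟨j, hk, Or.inr (Or.inr ⟨rfl, rfl⟩)⟩)
  · intro i hi
    have h2 : i.2.2 ≠ j.2.2 + 1 := fun h => clock_ne hi (h.trans hc.symm)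
    simp only [Shape, marks_false, marks_true]
    grind
  · rintro (_ | _) i hi
    · right
      -- The two phases are needed here. The fresh marker can only become late, next to a late
      -- marker with another clock; if it could return at once, the configuration before it would
      -- reappear up to counter values.
      have := clock_ne hc
      simp at hi
      subst hi
      simp [Shape]
      grind
    · simp at hi
  · rintro (_ | _) i hi
    · simp at hi
    · left; simp at hi; rw [hi]
  · rintro (_ | _) hi <;> simp at hi
  · intro δ hδ
    obtain ⟨-, rfl⟩ := step_late_iff.1 hδ
    simp

theorem forced_fourth {k : Ctl Q} {n : Bool → ℕ} (ht : t % 7 = 4)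
    (hT : T = ∅ ∨ T = finSet Q ∧ k.1 ≠ h0) (hn : 1 ≤ n true)
    (h : Forced (rules M h0) pick (goodSet M h1) (wrongSet M h1) T E (t + 1)
      (conf k (marks (some (false, k)) (some (false, k)))
        fun c => n c - if c = true then 1 else 0)) :
    Forced (rules M h0) pick (goodSet M h1) (wrongSet M h1) T E t
      (conf k (marks (some (false, k)) none) n) := by
  refine forced_step (.ctr true) (by simp [group, ht]) ?_ hT (Or.inr ?_) ?_ ?_ ?_
    ((step_ctr_none_iff rfl).2 ⟨hn, k, by simp⟩) ?_ h
  · exact Or.inr (Or.inr (Or.inl ⟨rfl, rfl⟩))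
  · intro i hi
    have := clock_ne hi
    simp only [Shape, marks_false, marks_true]
    grind
  · rintro (_ | _) i hi
    · right
      simp [Shape]
    · simp at hi
  · rintro (_ | _) i hi <;> simp at hi
  · rintro (_ | _) hi
    · simp at hi
    · exact Or.inl rfl
  · intro δ hδ
    obtain ⟨-, i, rfl⟩ := (step_ctr_none_iff rfl).1 hδ
    by_cases hik : i = k
    · subst hik
      simp
    · exact Or.inr (conf_mem_wrongSet.2 (Or.inr ⟨i, hik, by simp, by simp⟩))

theorem forced_fifth {k : Ctl Q} {n : Bool → ℕ} (ht : t % 7 = 5)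
    (hT : T = ∅ ∨ T = finSet Q ∧ k.1 ≠ h0)
    (h : Forced (rules M h0) pick (goodSet M h1) (wrongSet M h1) T E (t + 1)
      (conf k (marks (some (true, k)) (some (false, k))) n)) :
    Forced (rules M h0) pick (goodSet M h1) (wrongSet M h1) T E t
      (conf k (marks (some (false, k)) (some (false, k))) n) := by
  refine forced_step (.mark false false k) (by simp [group, ht]) ?_ hT (Or.inr ?_) ?_ ?_ ?_
    (step_early_iff.2 ⟨rfl, by simp⟩) ?_ h
  · exact Or.inr (Or.inr (Or.inr (Or.inl ⟨rfl, rfl⟩)))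
  · intro i hi
    have := clock_ne hi
    simp only [Shape, marks_false, marks_true]
    grind
  · rintro (_ | _) i hi
    · left; simp at hi; rw [hi]
    · right
      have := @clock_ne k.2.2 k.2.2
      simp at hi
      subst hi
      simp [Shape]
  · rintro (_ | _) i hi <;> simp at hi
  · rintro (_ | _) hi <;> simp at hi
  · intro δ hδ
    obtain ⟨-, rfl⟩ := step_early_iff.1 hδ
    simp

theorem forced_sixth {k : Ctl Q} {n : Bool → ℕ} (ht : t % 7 = 6)
    (hT : T = ∅ ∨ T = finSet Q ∧ k.1 ≠ h0)
    (h : Forced (rules M h0) pick (goodSet M h1) (wrongSet M h1) T E (t + 1)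
      (conf k (marks (some (true, k)) (some (true, k))) n)) :
    Forced (rules M h0) pick (goodSet M h1) (wrongSet M h1) T E t
      (conf k (marks (some (true, k)) (some (false, k))) n) := by
  refine forced_step (.mark false true k) (by simp [group, ht]) ?_ hT (Or.inr ?_) ?_ ?_ ?_
    (step_early_iff.2 ⟨rfl, by simp⟩) ?_ h
  · exact Or.inr (Or.inr (Or.inr (Or.inr ⟨rfl, rfl⟩)))
  · intro i hi
    have := clock_ne hi
    simp only [Shape, marks_false, marks_true]
    grind
  · rintro (_ | _) i hi
    · simp at hi
    · left; simp at hi; rw [hi]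
  · rintro (_ | _) i hi
    · right
      simp [Shape]
    · simp at hi
  · rintro (_ | _) hi <;> simp at hi
  · intro δ hδ
    obtain ⟨-, rfl⟩ := step_early_iff.1 hδ
    simp

/-- The configuration of the simulation at the beginning of a round. -/
def start (s : Q × (Bool → ℕ)) (z : ZMod 3) (M : CounterMachine Q) : Config (Ty Q) :=
  conf (s.1, M.outcome s, z) (marks (some (true, s.1, M.outcome s, z))
    (some (true, s.1, M.outcome s, z))) s.2

/-- A counter is decremented only if its test found it positive. -/
theorem decr_le (s : Q × (Bool → ℕ)) (c : Bool) : M.decr s.1 (M.outcome s) c ≤ s.2 c := by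
  simp only [CounterMachine.decr, CounterMachine.outcome, ne_eq, decide_eq_true_eq]
  split_ifs with h
  · rw [h.2]
    omega
  · omega

theorem decr_le_one (q : Q) (nz c : Bool) : M.decr q nz c ≤ 1 := by
  unfold CounterMachine.decr
  split_ifs <;> omega

/-- The markers are extra processes beyond the counter values, so a process is left to become the
new marker even at value zero. -/
theorem forced_round {s : Q × (Bool → ℕ)} {z : ZMod 3} (ht : t % 7 = 0) (hs : s.1 ≠ h0)
    (hs' : (M.next s).1 ≠ h1) (hT : T = ∅ ∨ T = finSet Q ∧ (M.next s).1 ≠ h0)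
    (h : Forced (rules M h0) pick (goodSet M h1) (wrongSet M h1) T E (t + 7)
      (start (M.next s) (z + 1) M)) :
    Forced (rules M h0) pick (goodSet M h1) (wrongSet M h1) T E t (start s z M) := by
  obtain ⟨j, hj⟩ : ∃ j : Ctl Q, j = (s.1, M.outcome s, z) := ⟨_, rfl⟩
  obtain ⟨k, hk⟩ : ∃ k : Ctl Q, k = ((M.next s).1, M.outcome (M.next s), z + 1) := ⟨_, rfl⟩
  have hks : k ∈ succs M j := by
    rw [mem_succs, hj, hk]
    exact ⟨rfl, rfl⟩
  have hd := decr_le (M := M) s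
  have hd1 := fun c => decr_le_one (M := M) s.1 (M.outcome s) c
  -- Incrementing and subtracting the pending decrement gives the counter value in `M.next s`, so
  -- exactly one of the two guesses is right.
  have hguess : ∀ i ∈ succs M j, RightGuess M h1 j i (fun c => s.2 c + M.incr j.1 j.2.1 c) ↔
      i = k := by
    intro i hi
    rw [mem_succs] at hi
    have e1 : i.1 = (M.next s).1 := by rw [hi.1, hj]; rfl
    have e2 : decide (s.2 (M.test i.1) + M.incr j.1 j.2.1 (M.test i.1) -
        drop M j (M.test i.1) ≠ 0) = M.outcome (M.next s) := by
      rw [e1, hj]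
      rfl
    simp only [RightGuess, e1, hs', ne_eq, not_false_eq_true, true_and, hk]
    rw [Prod.ext_iff, Prod.ext_iff]
    simp only [e1, true_and, hi.2, hj, and_true]
    rw [e1, hj] at e2
    exact ⟨fun h => h.trans e2, fun h => h.trans e2.symm⟩
  have hkT : T = ∅ ∨ T = finSet Q ∧ k.1 ≠ h0 := by rw [hk]; exact hT
  have hj1 : ∀ c, drop M j c = M.decr s.1 (M.outcome s) c := fun c => by rw [hj]
  have hj2 : ∀ c, M.incr j.1 j.2.1 c = M.incr s.1 (M.outcome s) c := fun c => by rw [hj]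
  unfold start
  rw [← hj]
  refine forced_control ht (by rw [hj]; exact hs) (hT.imp id And.left) hks
    (fun i hi hik h => hik ((hguess i hi).1 h)) ?_
  refine forced_first (by omega) hkT hks ((hguess k hks).2 rfl) ?_
  refine forced_second (by omega) hkT hks ?_ ?_
  -- Either the old marker has returned to the counter, or it has vanished for a decrement and then
  -- `hd` makes the counter positive.
  · have := hd false
    have := hd1 false
    simp only [hj1, hj2, if_true]
    omega
  refine forced_third (by omega) hkT hks ?_
  refine forced_fourth (by omega) hkT ?_ ?_
  · have := hd true
    have := hd1 true
    simp only [hj1, hj2, if_true, Bool.true_eq_false, if_false]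
    omega
  refine forced_fifth (by omega) hkT ?_
  refine forced_sixth (by omega) hkT ?_
  unfold start at h
  rw [← hk] at h
  -- Each counter gained `incr + (1 - drop)` and lost one process to the new marker, in total `incr
  -- - drop`; by `hd` the truncated subtractions are exact.
  convert h using 2
  funext c
  have := hd c
  have := hd1 c
  simp only [hj1, hj2, CounterMachine.next]
  cases c <;> simp <;> omega

/-- `RightGuess` demands a state other than `h1`, so both possible successors of the control are
wrong. -/
theorem forced_wrong {s : Q × (Bool → ℕ)} {z : ZMod 3} (ht : t % 7 = 0) (hs : s.1 ≠ h0)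
    (hs' : (M.next s).1 = h1) :
    Forced (rules M h0) pick (goodSet M h1) (wrongSet M h1) (finSet Q) (wrongSet M h1) t
      (start s z M) := by
  have hk : ((M.next s).1, M.outcome s, z + 1) ∈ succs M (s.1, M.outcome s, z) := by
    rw [mem_succs]
    exact ⟨rfl, rfl⟩
  have hw : ∀ i ∈ succs M (s.1, M.outcome s, z), ∀ n,
      ¬ RightGuess M h1 (s.1, M.outcome s, z) i n := by
    intro i hi n h
    rw [mem_succs] at hi
    exact h.1 (hi.1.trans hs')
  refine forced_control ht hs (Or.inr rfl) hk (fun i hi _ => hw i hi _) (.base _ _ ?_)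
  exact conf_mem_wrongSet.2 (Or.inl ⟨_, hk, Or.inl ⟨rfl, rfl, hw _ hk _⟩⟩)

/-- In the state `h0` the control has the single rule that produces `fin`, so nothing is left to
chance. -/
theorem forced_fin {s : Q × (Bool → ℕ)} {z : ZMod 3} (ht : t % 7 = 0) (hs : s.1 = h0) :
    Forced (rules M h0) pick (goodSet M h1) (wrongSet M h1) ∅ (finSet Q) t (start s z M) := by
  obtain ⟨j, hj⟩ : ∃ j : Ctl Q, j = (s.1, M.outcome s, z) := ⟨_, rfl⟩
  have hj0 : j.1 = h0 := by rw [hj]; exact hs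
  unfold start
  rw [← hj]
  have hX : ∀ δ, RStep (rules M h0)
      (conf j (marks (some (true, j)) (some (true, j))) s.2) (.ctl j) δ ↔
      δ = conf j (marks (some (true, j)) (some (true, j))) s.2 - Pi.single (.ctl j) 1 +
        Pi.single .fin 1 := by
    intro δ
    simp [RStep, rules, hj0, gconf]
  have hp := pick_conf (k := t) (j := j) (m := marks (some (true, j)) (some (true, j)))
    (n := s.2) (X := .ctl j) (by simp [group, ht]) (by simp [gconf])
  refine .step t _ _ (conf_mem_goodSet.2 (Or.inl ⟨rfl, rfl⟩)) (hp.symm ▸ (hX _).2 rfl) ?_ ?_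
    (.base _ _ ?_)
  · rw [hp]
    exact fun δ hδ => Or.inl ((hX δ).1 hδ)
  · rw [hp]
    intro Y hY δ hδ
    have hs : ¬ Shape j (marks none (some (true, j))) ∧
        ¬ Shape j (marks (some (true, j)) none) := by
      have := @clock_ne j.2.2 j.2.2
      simp only [Shape, marks_false, marks_true]
      grind
    have := stray (h1 := h1) (Or.inl rfl) (by rintro (_ | _) i hi <;> simp at hi)
      (by rintro (_ | _) i hi <;> simp [hs]) (by rintro (_ | _) hi <;> simp at hi) Y hY δ hδ
    exact ⟨this.1, this.2.1, Set.notMem_empty _⟩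
  · simp [finSet]

end Sim
-- Consequences of forced runs.
section Forced

variable {Γ : Type*} [DecidableEq Γ] {R : Γ → Finset (Config Γ)}
  {pick : ℕ → Config Γ → Γ} {G W T E : Set (Config Γ)} {k : ℕ} {α : Config Γ}

theorem RStep.ne_zero {X : Γ} {γ : Config Γ} (h : RStep R α X γ) : α ≠ 0 := by
  rintro rfl
  simp [RStep] at h

/-- A run that follows the forced sequence ends in `W`. At the first deviation, by chance or by
scheduling, it lands outside `G ∪ T` immediately. No assumption on how types are scheduled enters.
-/
theorem Forced.exists_notMem (h : Forced R pick G W T W k α) (hG : ∀ α ∈ W, α ∉ G)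
    (hT : ∀ α ∈ W, α ∉ T) (ω : ℕ → Config Γ) (h0 : ω k = α)
    (hω : ∀ i, Succ R (ω i) (ω (i + 1))) : ∃ i, ω i ∈ (G ∪ T)ᶜ := by
  induction h with
  | base k α hα => exact ⟨k, by simp [h0, hG α hα, hT α hα]⟩
  | step k α γ _ hX hR hO _ ih =>
    subst h0
    rcases hω k with ⟨Y, hY⟩ | h
    · by_cases hYX : Y = pick k (ω k)
      · rcases hR _ (hYX ▸ hY) with h | h
        · exact ih h
        · exact ⟨k + 1, by simp [hG _ h, hT _ h]⟩
      · have := hO Y hYX _ hY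
        exact ⟨k + 1, by simp [this.1, this.2.2]⟩
    · exact absurd h.1 hX.ne_zero

theorem Forced.exists_path (h : Forced R pick G W T E k α) :
    ∃ (w : ℕ → Config Γ) (N : ℕ), w 0 = α ∧ (∀ i < N, Succ R (w i) (w (i + 1))) ∧ w N ∈ E ∧
      ∀ i < N, w i ∈ G := by
  induction h with
  | base k α hα => exact ⟨fun _ => α, 0, rfl, by simp, hα, by simp⟩
  | step k α γ hG hX _ _ _ ih =>
    obtain ⟨w, N, h0, h1, h2, h3⟩ := ih
    refine ⟨fun i => Nat.casesOn i α w, N + 1, rfl, ?_, h2, ?_⟩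
    · rintro (_ | i) hi
      · exact Or.inl ⟨_, h0 ▸ hX⟩
      · exact h1 i (by omega)
    · rintro (_ | i) hi
      · exact hG
      · exact h3 i (by omega)

theorem Forced.avoid {T' : Set (Config Γ)} (h : Forced R pick G W T E k α) :
    Avoid R (G ∪ T')ᶜ E (fun k α X => pick k α = X) k α := by
  induction h with
  | base k α hα => exact .done k α hα
  | step k α γ hG hX _ _ _ ih =>
    refine .step k α (fun _ => γ) (by simp [hG]) hX.ne_zero ?_ fun _ _ _ => ih
    rintro X - rfl
    exact hX

end Forced

/-! ### The alarm that enforces faithful scheduling. -/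

section Bang

variable {Γ : Type*} [DecidableEq Γ]

/-- The configuration that has `b` processes of the additional type `none`. -/
def lift (α : Config Γ) (b : ℕ) : Config (Option Γ)
  | some X => α X
  | none => b

@[simp] theorem lift_none (α : Config Γ) (b : ℕ) : lift α b none = b := rfl

@[simp] theorem lift_some (α : Config Γ) (b : ℕ) (X : Γ) : lift α b (some X) = α X := rfl

@[simp] theorem lift_comp_some (α : Config Γ) (b : ℕ) : lift α b ∘ some = α := rfl

theorem exists_lift_eq (α : Config (Option Γ)) : lift (α ∘ some) (α none) = α := by
  funext X
  cases X <;> rfl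

open Classical in
/-- The rules with an additional type `none`, the alarm: each step raises the alarm with positive
probability, and scheduling the alarm duplicates it. -/
noncomputable def alarmRules (R : Γ → Finset (Config Γ)) : Option Γ → Finset (Config (Option Γ))
  | some X => (R X).image (lift · 0) ∪ (R X).image (lift · 1)
  | none => {lift 0 2}

variable {R : Γ → Finset (Config Γ)}

theorem alarmRules_nonempty (hR : ∀ X, (R X).Nonempty) (X : Option Γ) :
    (alarmRules R X).Nonempty := by
  cases X <;> simp [alarmRules, hR]

theorem alarm_step_some {α : Config Γ} {b : ℕ} {X : Γ} {δ : Config (Option Γ)} :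
    RStep (alarmRules R) (lift α b) (some X) δ ↔
      ∃ γ, RStep R α X γ ∧ (δ = lift γ b ∨ δ = lift γ (b + 1)) := by
  have key : ∀ (β : Config Γ) (c : ℕ), lift α b - Pi.single (some X) 1 + lift β c =
      lift (α - Pi.single X 1 + β) (b + c) := by
    intro β c
    funext Y
    cases Y <;> simp [Pi.single_apply]
  simp only [RStep, alarmRules, Finset.mem_union, Finset.mem_image, lift_some]
  constructor
  · rintro ⟨h1, β, ⟨β, hβ, rfl⟩ | ⟨β, hβ, rfl⟩, rfl⟩
    · exact ⟨_, ⟨h1, β, hβ, rfl⟩, Or.inl (key β 0)⟩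
    · exact ⟨_, ⟨h1, β, hβ, rfl⟩, Or.inr (key β 1)⟩
  · rintro ⟨γ, ⟨h1, β, hβ, rfl⟩, rfl | rfl⟩
    · exact ⟨h1, _, Or.inl ⟨β, hβ, rfl⟩, (key β 0).symm⟩
    · exact ⟨h1, _, Or.inr ⟨β, hβ, rfl⟩, (key β 1).symm⟩

theorem alarm_step_none {α : Config Γ} {b : ℕ} {δ : Config (Option Γ)} :
    RStep (alarmRules R) (lift α b) none δ ↔ 1 ≤ b ∧ δ = lift α (b + 1) := by
  have key : 1 ≤ b → lift α b - Pi.single none 1 + lift 0 2 = lift α (b + 1) := by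
    intro hb
    funext Y
    cases Y
    · simp
      omega
    · simp
  simp only [RStep, alarmRules, Finset.mem_singleton, lift_none, exists_eq_left]
  exact and_congr_right fun h => by rw [key h]

/-- The target of the scheduler: an alarm was raised in a configuration of `G`, or `W` is reached. -/
def alarmTarget (G W : Set (Config Γ)) : Set (Config (Option Γ)) :=
  {δ | (δ none ≤ 1 ∧ δ ∘ some ∈ W) ∨ (δ none = 1 ∧ δ ∘ some ∈ G)}

/-- The configurations from which the target of the scheduler is unreachable. -/
def alarmTrap (Z : Set (Config Γ)) : Set (Config (Option Γ)) :=
  {δ | 2 ≤ δ none ∨ δ ∘ some ∈ Z}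

/-- The number of alarms never decreases, and steps of the original types follow `R`. The hypothesis
on `0` handles the absorbing empty configuration. -/
theorem alarmTrap_closed {Z : Set (Config Γ)} (hZ : ∀ α ∈ Z, ∀ γ, Succ R α γ → γ ∈ Z)
    (h0 : 0 ∉ Z) : ∀ α ∈ alarmTrap Z, ∀ γ, Succ (alarmRules R) α γ → γ ∈ alarmTrap Z := by
  intro α hα γ h
  obtain ⟨a, b, rfl⟩ : ∃ a b, α = lift a b := ⟨_, _, (exists_lift_eq α).symm⟩
  rcases h with ⟨X | X, hX⟩ | h
  · obtain ⟨hb, rfl⟩ := alarm_step_none.1 hX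
    rcases hα with h | h
    · exact Or.inl (by simp at h ⊢; omega)
    · exact Or.inr h
  · obtain ⟨c, hc, rfl | rfl⟩ := alarm_step_some.1 hX
    · rcases hα with h | h
      · exact Or.inl h
      · exact Or.inr (hZ _ h _ (Or.inl ⟨_, hc⟩))
    · rcases hα with h | h
      · exact Or.inl (by simp at h ⊢; omega)
      · exact Or.inr (hZ _ h _ (Or.inl ⟨_, hc⟩))
  · rw [h.1] at hα
    rcases hα with h | h
    · simp at h
    · exact absurd h h0

theorem alarmTrap_disjoint {G W Z : Set (Config Γ)} (hG : ∀ α ∈ Z, α ∉ G) (hW : ∀ α ∈ Z, α ∉ W) :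
    ∀ α ∈ alarmTrap Z, α ∉ alarmTarget G W := by
  rintro α (h | h) (h' | h')
  · omega
  · omega
  · exact hW _ h h'.2
  · exact hG _ h h'.2

open Classical in
/-- The scheduler that behaves like `pick` and ignores the alarm. -/
noncomputable def alarmPick (pick : ℕ → Config Γ → Γ) (k : ℕ) (α : Config (Option Γ)) : Option Γ :=
  if α ∘ some = 0 then none else some (pick k (α ∘ some))

theorem alarmPick_pos {pick : ℕ → Config Γ → Γ} (hp : ∀ k (α : Config Γ), α ≠ 0 → 1 ≤ α (pick k α))
    (k : ℕ) (α : Config (Option Γ)) (hα : α ≠ 0) : 1 ≤ α (alarmPick pick k α) := by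
  unfold alarmPick
  split_ifs with h
  · rw [Nat.one_le_iff_ne_zero]
    refine fun h' => hα (funext fun X => ?_)
    cases X with
    | none => exact h'
    | some X => exact congrFun h X
  · exact hp k _ h

variable {pick : ℕ → Config Γ → Γ} {G W T E : Set (Config Γ)} {k : ℕ} {α : Config Γ}

/-- Every outcome helps the scheduler that follows `pick`: an alarm is a hit, a wrong choice is a
hit, and otherwise the forced sequence proceeds towards `W`. -/
theorem Forced.exists_mem_alarmTarget (h : Forced R pick G W T W k α)
    (ω : ℕ → Config (Option Γ)) (h0 : ω k = lift α 0)
    (hω : ∀ i, ω i ≠ 0 → RStep (alarmRules R) (ω i) (alarmPick pick i (ω i)) (ω (i + 1))) :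
    ∃ i, ω i ∈ alarmTarget G W := by
  induction h with
  | base k α hα => exact ⟨k, by simp [h0, alarmTarget, hα]⟩
  | step k α γ _ hX hR _ hγ ih =>
    have hα := hX.ne_zero
    have h1 : ω k ≠ 0 := by
      rw [h0]
      exact fun h => hα (funext fun X => congrFun h (some X))
    have h2 := hω k h1
    rw [h0, alarmPick, lift_comp_some, if_neg hα, alarm_step_some] at h2
    obtain ⟨δ, hδ, h3⟩ := h2
    rcases hR δ hδ with rfl | hW
    · rcases h3 with h3 | h3
      · exact ih h3
      · refine ⟨k + 1, ?_⟩
        -- The next configuration of the sequence lies in `W` if it is the last one and in `G`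
        -- otherwise; either way its first alarm is a hit.
        cases hγ with
        | base _ _ h => simp [h3, alarmTarget, h]
        | step _ _ _ h => simp [h3, alarmTarget, h]
    · exact ⟨k + 1, by rcases h3 with h3 | h3 <;> simp [h3, alarmTarget, hW]⟩

/-- This is not yet a hit, and whichever type is scheduled, a second alarm can follow. -/
theorem avoid_alarm_of_notMem (hR : ∀ X, (R X).Nonempty) {Z : Set (Config Γ)} (hG : α ∉ G)
    (hW : α ∉ W) : Avoid (alarmRules R) (alarmTarget G W) (alarmTrap Z) (fun _ _ _ => True) k
      (lift α 1) := by
  choose β hβ using hR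
  refine .step k _ (fun X => match X with
    | none => lift α 2
    | some X => lift (α - Pi.single X 1 + β X) 2) ?_ ?_ ?_ ?_
  · simp [alarmTarget, hG, hW]
  · exact fun h => by simpa using congrFun h none
  · rintro (_ | X) h -
    · exact alarm_step_none.2 ⟨le_rfl, rfl⟩
    · exact alarm_step_some.2 ⟨_, ⟨h, _, hβ X, rfl⟩, Or.inr rfl⟩
  · rintro (_ | X) h - <;> exact .done _ _ (Or.inl (by simp))

/-- The opponent answers the type `pick` by the intended successor without alarm, and any other type
by an alarm, which is raised outside `G` and `W`. -/
theorem Forced.avoid_alarm (hR : ∀ X, (R X).Nonempty) (hGW : ∀ α ∈ W, α ∉ G)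
    (h : Forced R pick G W T E k α) :
    Avoid (alarmRules R) (alarmTarget G W) (alarmTrap E) (fun _ _ _ => True) k (lift α 0) := by
  classical
  induction h with
  | base k α hα => exact .done _ _ (Or.inr hα)
  | step k α γ hG hX _ hO hγ ih =>
    have hα := hX.ne_zero
    have hR' := hR
    choose β hβ using hR
    refine .step k _ (fun X => match X with
      | none => 0
      | some X => if X = pick k α then lift γ 0 else lift (α - Pi.single X 1 + β X) 1) ?_ ?_ ?_ ?_
    · simpa [alarmTarget] using fun h => hGW _ h hG
    · exact fun h => hα (funext fun X => congrFun h (some X))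
    · rintro (_ | X) h -
      · simp at h
      · by_cases hXp : X = pick k α
        · simp only [if_pos hXp]
          exact alarm_step_some.2 ⟨_, hXp ▸ hX, Or.inl rfl⟩
        · simp only [if_neg hXp]
          exact alarm_step_some.2 ⟨_, ⟨h, _, hβ X, rfl⟩, Or.inr rfl⟩
    · rintro (_ | X) h -
      · simp at h
      · by_cases hXp : X = pick k α
        · simp only [if_pos hXp]
          exact ih
        · simp only [if_neg hXp]
          have := hO X hXp _ ⟨h, _, hβ X, rfl⟩
          exact avoid_alarm_of_notMem hR' this.1 this.2.1

end Bang

/-! ### Forced runs of halting computations. -/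

namespace Sim

variable {Q : Type} [DecidableEq Q] [Fintype Q] {M : CounterMachine Q} {h0 h1 : Q}

theorem finSet_closed : ∀ α ∈ finSet Q, ∀ γ, Succ (rules M h0) α γ → γ ∈ finSet Q := by
  rintro α hα γ (⟨X, -, β, hβ, rfl⟩ | ⟨rfl, -⟩)
  · have hα : 1 ≤ α .fin := hα
    change 1 ≤ _
    by_cases hX : X = .fin
    · subst hX
      simp only [rules, Finset.mem_singleton] at hβ
      simp [hβ]
    · simp [Ne.symm hX]
      omega
  · simp [finSet] at hα

theorem goodSet_disjoint_wrongSet : ∀ α ∈ wrongSet M h1, α ∉ goodSet M h1 := by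
  rintro _ ⟨k, m, n, rfl, h⟩ h'
  exact (conf_mem_goodSet.1 h').not_wrong h

theorem wrongSet_disjoint_finSet : ∀ α ∈ wrongSet M h1, α ∉ finSet Q := by
  rintro _ ⟨k, m, n, rfl, h⟩
  exact conf_notMem_finSet

theorem goodSet_disjoint_finSet : ∀ α ∈ goodSet M h1, α ∉ finSet Q := by
  rintro _ ⟨k, m, n, rfl, h⟩
  exact conf_notMem_finSet

/-- The machine reaches the state `q` without visiting `h0` or `h1` before. -/
def _root_.BPP.CounterMachine.Reaches (M : CounterMachine Q) (h0 h1 : Q) (s : Q × (Bool → ℕ))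
    (q : Q) : Prop :=
  ∃ r, (M.next^[r] s).1 = q ∧ ∀ j < r, (M.next^[j] s).1 ≠ h0 ∧ (M.next^[j] s).1 ≠ h1

/-- In the last round the control is already in `h0`, so scheduling it too early yields `fin`; hence
`T` must be empty here. -/
theorem forced_of_reaches_h0 {s : Q × (Bool → ℕ)} (hs : s.1 ≠ h1) (h : M.Reaches h0 h1 s h0)
    (h01 : h0 ≠ h1) {t : ℕ}
    (ht : t % 7 = 0) (z : ZMod 3) :
    Forced (rules M h0) pick (goodSet M h1) (wrongSet M h1) ∅ (finSet Q) t (start s z M) := by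
  obtain ⟨r, hr, hj⟩ := h
  induction r generalizing s t z with
  | zero => exact forced_fin ht hr
  | succ r ih =>
    have hn : (M.next s).1 ≠ h1 := by
      rcases Nat.eq_zero_or_pos r with rfl | hr0
      · exact fun h => h01 (hr.symm.trans h)
      · exact (hj 1 (by omega)).2
    exact forced_round ht (hj 0 (by omega)).1 hn (Or.inl rfl)
      (ih hn (by omega) _ hr fun j hjr => hj (j + 1) (by omega))

/-- The state `h0` does not occur on the way, so no step out of turn produces `fin`, and `T` can be
`finSet Q`. -/
theorem forced_of_reaches_h1 {s : Q × (Bool → ℕ)} (hs : s.1 ≠ h1) (h : M.Reaches h0 h1 s h1)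
    {t : ℕ} (ht : t % 7 = 0) (z : ZMod 3) :
    Forced (rules M h0) pick (goodSet M h1) (wrongSet M h1) (finSet Q) (wrongSet M h1) t
      (start s z M) := by
  obtain ⟨r, hr, hj⟩ := h
  induction r generalizing s t z with
  | zero => exact absurd hr hs
  | succ r ih =>
    rcases Nat.eq_zero_or_pos r with rfl | hr0
    · exact forced_wrong ht (hj 0 (by omega)).1 hr
    · have hn := hj 1 (by omega)
      exact forced_round ht (hj 0 (by omega)).1 hn.2 (Or.inr ⟨rfl, hn.1⟩)
        (ih hn.2 (by omega) _ hr fun j hjr => hj (j + 1) (by omega))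

end Sim
end BPP

/-! ### Fairness of the cyclic scheduler. -/

namespace BPP
namespace Sim

variable {Q : Type} [DecidableEq Q] [Fintype Q] {M : CounterMachine Q} {h0 h1 : Q}

theorem gconf_ne_zero (k : Option (Ctl Q)) (m : Bool → Option (Bool × Ctl Q)) (n : Bool → ℕ) :
    gconf k m n ≠ 0 := by
  intro h
  cases k with
  | none => simpa [gconf] using congrFun h .fin
  | some k => simpa [gconf] using congrFun h (.ctl k)

theorem step_gconf_of_group_eq_zero {k : Option (Ctl Q)} {m : Bool → Option (Bool × Ctl Q)}
    {n : Bool → ℕ} {X : Ty Q} (hX : group X = 0) {δ : Config (Ty Q)}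
    (h : RStep (rules M h0) (gconf k m n) X δ) : ∃ k' n', δ = gconf k' m n' := by
  obtain ⟨h1, β, hβ, rfl⟩ := h
  rcases X with ⟨_ | _⟩ | ⟨_ | _, _ | _, j⟩ | j | _ <;> simp only [group, reduceCtorEq] at hX
  · obtain rfl : k = some j := by
      by_contra hk
      simp [gconf, Ne.symm hk] at h1
    by_cases hj : j.1 = h0
    · simp only [rules, hj, if_true, Finset.mem_singleton] at hβ
      subst hβ
      refine ⟨none, n, ?_⟩
      funext Y
      rcases Y with c | ⟨l, c, i⟩ | i | _ <;> simp [gconf, Pi.single_apply, eq_comm]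
    · obtain ⟨k', -, rfl⟩ := (mem_rules_ctl hj).1 hβ
      refine ⟨some k', fun c => n c + M.incr j.1 j.2.1 c, ?_⟩
      funext Y
      rcases Y with c | ⟨l, c, i⟩ | i | _ <;> simp [gconf, counters, Pi.single_apply, eq_comm]
  · obtain rfl : k = none := by
      by_contra hk
      simp [gconf, hk] at h1
    simp only [rules, Finset.mem_singleton] at hβ
    subst hβ
    refine ⟨none, n, ?_⟩
    funext Y
    rcases Y with c | ⟨l, c, i⟩ | i | _ <;> simp [gconf]

/-- The phases that the markers can have at the position `p` of a round. -/
def PhaseOK (p : ℕ) (m : Bool → Option (Bool × Ctl Q)) : Prop :=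
  (∀ l j, m false = some (l, j) → (l = true ∧ (p = 6 ∨ p = 0 ∨ p = 1)) ∨
    (l = false ∧ (p = 3 ∨ p = 4 ∨ p = 5))) ∧
  (∀ l j, m true = some (l, j) → (l = true ∧ (p = 0 ∨ p = 1 ∨ p = 2 ∨ p = 3)) ∨
    (l = false ∧ (p = 5 ∨ p = 6)))

/-- A configuration that can occur at time `t` under the scheduler `pick`. -/
def Regular (t : ℕ) (α : Config (Ty Q)) : Prop :=
  ∃ k m n, α = gconf k m n ∧ PhaseOK (t % 7) m

theorem pick_spec {t : ℕ} {α : Config (Ty Q)} (h : ∃ X, group X = 0 ∧ 1 ≤ α X) :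
    group (pick t α) = t % 7 ∨
      (∀ X, group X = t % 7 → α X = 0) ∧ group (pick t α) = 0 := by
  unfold pick
  split_ifs with h'
  · exact Or.inl h'.choose_spec.1
  · push Not at h'
    exact Or.inr ⟨fun X hX => by simpa using h' X hX, h.choose_spec.1⟩

theorem exists_group_eq_zero (k : Option (Ctl Q)) (m : Bool → Option (Bool × Ctl Q))
    (n : Bool → ℕ) : ∃ X, group X = 0 ∧ 1 ≤ gconf k m n X := by
  cases k with
  | none => exact ⟨.fin, rfl, by simp [gconf]⟩
  | some k => exact ⟨.ctl k, rfl, by simp [gconf]⟩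

/-- Fairness concerns all runs of `pick`, including those with wrong guesses, so this invariant
ignores labels and counters. A counter comes due only when it has no marker, which prevents a second
one. -/
theorem Regular.step {t : ℕ} {α δ : Config (Ty Q)} (h : Regular t α)
    (hδ : RStep (rules M h0) α (pick t α) δ) : Regular (t + 1) δ := by
  obtain ⟨k, m, n, rfl, hm⟩ := h
  have ht : (t + 1) % 7 = if t % 7 = 6 then 0 else t % 7 + 1 := by
    split_ifs <;> omega
  have ht7 : t % 7 < 7 := Nat.mod_lt _ (by norm_num)
  have hspec := pick_spec (t := t) (exists_group_eq_zero k m n)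
  have hpos := hδ.1
  obtain ⟨X, hX⟩ : ∃ X, X = pick t (gconf k m n) := ⟨_, rfl⟩
  rw [← hX] at hδ hspec hpos
  unfold Regular
  rw [ht]
  clear ht hX
  generalize t % 7 = p at *
  by_cases hX0 : group X = 0
  · obtain ⟨k', n', rfl⟩ := step_gconf_of_group_eq_zero hX0 hδ
    refine ⟨k', m, n', rfl, ?_⟩
    -- If `pick` falls back on the control or `fin`, the due group is absent. The phases allowed at
    -- `p` but not at the next position are then ruled out.
    have habs : p ≠ 0 → ∀ l c j, group (.mark l c j : Ty Q) = p → m c ≠ some (l, j) := by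
      intro hp l c j hg hm
      rcases hspec with h | h
      · omega
      · have := h.1 _ hg
        simp [gconf, hm] at this
    have a1 := fun j hp hg => habs hp true false j hg
    have a2 := fun j hp hg => habs hp true true j hg
    have a3 := fun j hp hg => habs hp false false j hg
    have a4 := fun j hp hg => habs hp false true j hg
    simp only [group] at a1 a2 a3 a4
    clear habs hspec
    refine ⟨fun l j hlj => ?_, fun l j hlj => ?_⟩
    · have b := hm.1 l j hlj
      have a1 := a1 j
      have a3 := a3 j
      cases l <;> simp only [hlj] at a1 a3 <;> grind
    · have b := hm.2 l j hlj
      have a2 := a2 j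
      have a4 := a4 j
      cases l <;> simp only [hlj] at a2 a4 <;> grind
  · have hXp : group X = p := hspec.resolve_right fun h => hX0 h.2
    clear hspec
    subst hXp
    rcases X with c | ⟨_ | _, c, j⟩ | j | _
    · have hc : m c = none := by
        rcases hmc : m c with _ | ⟨l, j⟩
        · rfl
        · cases c
          · have := hm.1 l j hmc
            simp [group] at this
          · have := hm.2 l j hmc
            simp [group] at this
      obtain ⟨-, j, rfl⟩ := (step_ctr_none_iff hc).1 hδ
      refine ⟨k, _, _, rfl, ?_⟩
      cases c
      · have := hm.2
        simp [PhaseOK, group] at this ⊢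
        grind
      · have := hm.1
        simp [PhaseOK, group] at this ⊢
        grind
    · obtain ⟨-, rfl⟩ := step_early_iff.1 hδ
      refine ⟨k, _, _, rfl, ?_⟩
      cases c
      · have := hm.2
        simp [PhaseOK, group] at this ⊢
        grind
      · have := hm.1
        simp [PhaseOK, group] at this ⊢
        grind
    · obtain ⟨-, rfl⟩ := step_late_iff.1 hδ
      refine ⟨k, _, _, rfl, ?_⟩
      cases c
      · have := hm.2
        simp [PhaseOK, group] at this ⊢
        grind
      · have := hm.1
        simp [PhaseOK, group] at this ⊢
        grind
    · exact absurd rfl hX0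
    · exact absurd rfl hX0

theorem regular_start (s : Q × (Bool → ℕ)) (z : ZMod 3) : Regular 0 (start s z M) := by
  refine ⟨_, _, _, rfl, ?_⟩
  simp [PhaseOK, marks]

/-- Each group is due once among seven consecutive times, and then its only present type is picked.
-/
theorem pick_fair {ω : ℕ → Config (Ty Q)} (h : ∀ t, Regular t (ω t)) (i : ℕ) (X : Ty Q)
    (hX : ∀ j < 7, 1 ≤ ω (i + j) X) : ∃ j < 7, pick (i + j) (ω (i + j)) = X := by
  have hg : group X < 7 := by
    rcases X with ⟨_ | _⟩ | ⟨_ | _, _ | _, j⟩ | j | _ <;> simp [group]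
  obtain ⟨j, hj, hij⟩ : ∃ j < 7, group X = (i + j) % 7 :=
    ⟨(group X + 7 - i % 7) % 7, Nat.mod_lt _ (by norm_num), by omega⟩
  refine ⟨j, hj, ?_⟩
  obtain ⟨k, m, n, hω, -⟩ := h (i + j)
  have := hX j hj
  rw [hω] at this ⊢
  exact pick_conf hij this

theorem regular_of_pick {ω : ℕ → Config (Ty Q)} (h0' : Regular 0 (ω 0))
    (h : ∀ i, ω i ≠ 0 → RStep (rules M h0) (ω i) (pick i (ω i)) (ω (i + 1))) (t : ℕ) :
    Regular t (ω t) := by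
  induction t with
  | zero => exact h0'
  | succ t ih =>
    refine ih.step (M := M) (h0 := h0) (h t ?_)
    obtain ⟨k, m, n, hω, -⟩ := ih
    exact hω ▸ gconf_ne_zero k m n

end Sim
-- Semilinearity of the target sets.
section Semilinear

theorem isSemilinearSet_nat_le (d : ℕ) : IsSemilinearSet {x : ℕ | x ≤ d} :=
  .of_finite (Set.finite_le_nat d)

theorem isSemilinearSet_apply {Γ : Type*} [Finite Γ] {s : Set ℕ} (hs : IsSemilinearSet s) (X : Γ) :
    IsSemilinearSet {α : Config Γ | α X ∈ s} :=
  hs.preimage (Pi.evalAddMonoidHom (fun _ : Γ => ℕ) X)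

theorem isSemilinearSet_comp {Γ Γ' : Type*} [Finite Γ] [Finite Γ'] {s : Set (Config Γ')}
    (hs : IsSemilinearSet s) (f : Γ' → Γ) : IsSemilinearSet {α : Config Γ | α ∘ f ∈ s} :=
  hs.preimage (LinearMap.funLeft ℕ ℕ f)

theorem isSemilinearSet_const {Γ : Type*} [Finite Γ] (p : Prop) :
    IsSemilinearSet {_α : Config Γ | p} := by
  by_cases hp : p
  · simp [hp, IsSemilinearSet.univ]
  · simp [hp, IsSemilinearSet.empty]

theorem isSemilinearSet_or {Γ : Type*} [Finite Γ] {p q : Config Γ → Prop}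
    (hp : IsSemilinearSet {α | p α}) (hq : IsSemilinearSet {α | q α}) :
    IsSemilinearSet {α | p α ∨ q α} :=
  hp.union hq

theorem isSemilinearSet_and {Γ : Type*} [Finite Γ] {p q : Config Γ → Prop}
    (hp : IsSemilinearSet {α | p α}) (hq : IsSemilinearSet {α | q α}) :
    IsSemilinearSet {α | p α ∧ q α} :=
  hp.inter hq

theorem isSemilinearSet_not {Γ : Type*} [Finite Γ] {p : Config Γ → Prop}
    (hp : IsSemilinearSet {α | p α}) : IsSemilinearSet {α | ¬ p α} :=
  hp.compl

theorem isSemilinearSet_exists {Γ ι : Type*} [Finite Γ] [Finite ι] {p : ι → Config Γ → Prop}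
    (hp : ∀ i, IsSemilinearSet {α | p i α}) : IsSemilinearSet {α | ∃ i, p i α} := by
  rw [Set.ofPred_exists]
  exact .iUnion hp

theorem isSemilinearSet_alarmTarget {Γ : Type*} [Finite Γ] {G W : Set (Config Γ)}
    (hG : IsSemilinearSet G) (hW : IsSemilinearSet W) : IsSemilinearSet (alarmTarget G W) :=
  isSemilinearSet_or
    (isSemilinearSet_and (isSemilinearSet_apply (isSemilinearSet_nat_le 1) none)
      (isSemilinearSet_comp hW some))
    (isSemilinearSet_and (isSemilinearSet_apply (IsSemilinearSet.singleton 1) none)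
      (isSemilinearSet_comp hG some))

end Semilinear

namespace Sim

variable {Q : Type} [DecidableEq Q] [Fintype Q] {M : CounterMachine Q} {h0 h1 : Q}

theorem isSemilinearSet_finSet : IsSemilinearSet (finSet Q) := by
  have : finSet Q = {α : Config (Ty Q) | α .fin ∈ {x : ℕ | x ≤ 0}ᶜ} := by
    ext α
    simp [finSet, Nat.one_le_iff_ne_zero]
  rw [this]
  exact isSemilinearSet_apply (isSemilinearSet_nat_le 0).compl _

/-- Apart from a constant condition, a single counter is required to be at most `drop`, or to exceed
it. -/
theorem isSemilinearSet_rightGuess (j k : Ctl Q) :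
    IsSemilinearSet {n | RightGuess M h1 j k n} := by
  refine isSemilinearSet_and (isSemilinearSet_const _) ?_
  have key : IsSemilinearSet {x : ℕ | k.2.1 = decide (x - drop M j (M.test k.1) ≠ 0)} := by
    cases k.2.1
    · convert isSemilinearSet_nat_le (drop M j (M.test k.1)) using 1
      ext x
      simp [Nat.sub_eq_zero_iff_le]
    · convert (isSemilinearSet_nat_le (drop M j (M.test k.1))).compl using 1
      ext x
      simp [Nat.sub_eq_zero_iff_le]
  exact isSemilinearSet_apply key (M.test k.1)

/-- There are finitely many controls and markings, and for fixed ones the configuration is affine in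
the counters. -/
theorem isSemilinearSet_conf (P : Ctl Q → (Bool → Option (Bool × Ctl Q)) → (Bool → ℕ) → Prop)
    (hP : ∀ k m, IsSemilinearSet {n | P k m n}) :
    IsSemilinearSet {α | ∃ k m n, α = conf k m n ∧ P k m n} := by
  refine isSemilinearSet_exists fun k => isSemilinearSet_exists fun m => ?_
  let f : (Bool → ℕ) →+ Config (Ty Q) :=
    { toFun := counters
      map_zero' := by
        funext X
        cases X <;> rfl
      map_add' := fun x y => by
        funext X
        cases X <;> rfl }
  convert ((hP k m).image f).vadd (conf k m 0) using 1
  ext α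
  simp only [Set.mem_ofPred_eq, Set.mem_vadd_set, Set.mem_image, vadd_eq_add,
    exists_exists_and_eq_and]
  refine exists_congr fun n => ?_
  rw [and_comm]
  refine and_congr_right fun _ => ?_
  have : conf k m 0 + f n = conf k m n := by
    funext X
    cases X <;> simp [f, gconf, counters]
  rw [this, eq_comm]

theorem isSemilinearSet_goodSet : IsSemilinearSet (goodSet M h1) := by
  refine isSemilinearSet_conf _ fun k m => ?_
  exact isSemilinearSet_or (isSemilinearSet_const _) (isSemilinearSet_or
    (isSemilinearSet_exists fun j => isSemilinearSet_and (isSemilinearSet_const _)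
      (isSemilinearSet_or
        (isSemilinearSet_and (isSemilinearSet_const _)
          (isSemilinearSet_and (isSemilinearSet_const _) (isSemilinearSet_rightGuess j k)))
        (isSemilinearSet_const _)))
    (isSemilinearSet_const _))

theorem isSemilinearSet_wrongSet : IsSemilinearSet (wrongSet M h1) := by
  refine isSemilinearSet_conf _ fun k m => ?_
  exact isSemilinearSet_or
    (isSemilinearSet_exists fun j => isSemilinearSet_and (isSemilinearSet_const _)
      (isSemilinearSet_or
        (isSemilinearSet_and (isSemilinearSet_const _)
          (isSemilinearSet_and (isSemilinearSet_const _)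
            (isSemilinearSet_not (isSemilinearSet_rightGuess j k))))
        (isSemilinearSet_const _)))
    (isSemilinearSet_const _)

end Sim

/-! ### Reduction from inseparable sets. -/

/-- No computable set separates `B` from `A`. -/
def Inseparable (A B : Set ℕ) : Prop :=
  ∀ g : ℕ → Bool, Computable g → ∃ k, (k ∈ A ∧ g k = true) ∨ (k ∈ B ∧ g k = false)

/-- A decision procedure applied to the codes would separate `B` from `A`. Only the last component
of the code varies with `k`, so `S` and `F` need only exist. -/
theorem undecidable_of_inseparable {A B : Set ℕ} (hAB : Inseparable A B) (P : Instance → Prop)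
    {n : ℕ} (S : PBPP (Fin n)) (F : SemilinearPres (Fin n)) (α : ℕ → Config (Fin n))
    (hα : ∀ i, Computable fun k => α k i) (hA : ∀ k ∈ A, ¬ P ⟨n, S, F, α k⟩)
    (hB : ∀ k ∈ B, P ⟨n, S, F, α k⟩) : Undecidable P := by
  rintro ⟨f, hf, hfP⟩
  obtain ⟨c, hc⟩ := (⟨n, S, F, α 0⟩ : Instance).exists_isCode
  have hcode : ∀ k, (⟨n, S, F, α k⟩ : Instance).IsCode (c.1, c.2.1, c.2.2.1, List.ofFn (α k)) :=
    fun k => ⟨hc.1, hc.2.1, hc.2.2.1, rfl⟩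
  have hcomp : Computable fun k => f (c.1, c.2.1, c.2.2.1, List.ofFn (α k)) :=
    hf.comp ((Computable.const _).pair ((Computable.const _).pair ((Computable.const _).pair
      (Computable.list_ofFn hα))))
  obtain ⟨k, ⟨hk, h⟩ | ⟨hk, h⟩⟩ := hAB _ hcomp
  · exact hA k hk ((hfP _ _ (hcode k)).1 h)
  · have := (hfP _ _ (hcode k)).2 (hB k hk)
    rw [this] at h
    exact Bool.noConfusion h

theorem exists_pres {Γ : Type*} {n : ℕ} (e : Γ ≃ Fin n) {F : Set (Config Γ)}
    (hF : IsSemilinearSet F) : ∃ G : SemilinearPres (Fin n), G.toSet = (· ∘ e) ⁻¹' F := by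
  have : Finite Γ := .of_equiv _ e.symm
  exact (isSemilinearSet_iff_exists_pres _).1 (isSemilinearSet_comp hF e)

section Main

variable {Q : Type} [DecidableEq Q] [Fintype Q] {M : CounterMachine Q} {q₀ h0 h1 : Q}
  {A B : Set ℕ}

/-- The initial counters for the input `k`. -/
def input (k : ℕ) (c : Bool) : ℕ := if c then 0 else 2 ^ k

/-- The initial configuration of the simulation for the input `k`. -/
def simStart (M : CounterMachine Q) (q₀ : Q) (k : ℕ) : Config (Ty Q) :=
  Sim.start (q₀, input k) 0 M

theorem computable_two_pow : Computable fun k : ℕ => 2 ^ k := by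
  have := (Primrec.nat_rec₁ (f := fun _ y => 2 * y) 1
    (Primrec.nat_mul.comp (Primrec.const 2) Primrec.snd)).to_comp
  refine this.of_eq fun k => ?_
  induction k with
  | zero => rfl
  | succ k ih => rw [pow_succ, mul_comm, ← ih]

/-- The initial state tests the counter holding `2 ^ k > 0`, so the initial guess is always `true`
and only this counter depends on `k`. -/
theorem computable_simStart (hq : M.test q₀ = false) (X : Ty Q) :
    Computable fun k => simStart M q₀ k X := by
  have h : ∀ k, M.outcome (q₀, input k) = true := fun k => by
    simp [CounterMachine.outcome, hq, input]
  rcases X with ⟨_ | _⟩ | _ | _ | _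
  · exact computable_two_pow.of_eq fun k => by simp [simStart, Sim.start, Sim.gconf, input]
  all_goals
    simp only [simStart, Sim.start, h, Sim.gconf, input]
    exact Computable.const _

theorem undecidable_fair_cases (hAB : Inseparable A B) (h01 : h0 ≠ h1) (hq0 : q₀ ≠ h1)
    (hq : M.test q₀ = false) (hA : ∀ k ∈ A, M.Reaches h0 h1 (q₀, input k) h0)
    (hB : ∀ k ∈ B, M.Reaches h0 h1 (q₀, input k) h1) :
    Undecidable (fun I => I.S.typeChain.hitProb I.α₀ I.F.toSet = 1) ∧
    Undecidable (fun I => I.S.procChain.hitProb I.α₀ I.F.toSet = 1) ∧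
    Undecidable (fun I => ∀ σ : I.S.mdp.Scheduler,
      I.S.mdp.Fair 7 I.α₀ σ → I.S.mdp.hitProb σ I.α₀ I.F.toSet = 1) := by
  obtain ⟨n, ⟨e⟩⟩ := Finite.exists_equiv_fin (Ty Q)
  obtain ⟨S, hS⟩ := exists_pbpp e (Sim.rules M h0) fun X => Sim.rules_nonempty X (q₀, true, 0)
  -- A run hits this target by leaving the faithful simulation without having produced `fin`.
  obtain ⟨F, hF⟩ := exists_pres e ((Sim.isSemilinearSet_goodSet (M := M) (h1 := h1)).union
    Sim.isSemilinearSet_finSet).compl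
  have hα : ∀ i, Computable fun k => (simStart M q₀ k ∘ e.symm) i := fun i =>
    computable_simStart hq (e.symm i)
  have hαe : ∀ k, (simStart M q₀ k ∘ e.symm) ∘ e = simStart M q₀ k := fun k => by
    funext
    simp
  have hfA := fun k hk => Sim.forced_of_reaches_h0 hq0 (hA k hk) h01 (Nat.zero_mod 7) 0
  have hfB := fun k hk => Sim.forced_of_reaches_h1 hq0 (hB k hk) (Nat.zero_mod 7) 0
  have hpath : ∀ k ∈ B, ∀ ω : ℕ → Config (Ty Q), ω 0 = (simStart M q₀ k ∘ e.symm) ∘ e →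
      (∀ i, Succ (Sim.rules M h0) (ω i) (ω (i + 1))) →
      ∃ i, ω i ∈ (Sim.goodSet M h1 ∪ Sim.finSet Q)ᶜ := fun k hk ω h0' hω =>
    (hfB k hk).exists_notMem Sim.goodSet_disjoint_wrongSet Sim.wrongSet_disjoint_finSet ω
      (h0'.trans (hαe k)) hω
  have hfin : ∀ α ∈ Sim.finSet Q, α ∉ (Sim.goodSet M h1 ∪ Sim.finSet Q)ᶜ := fun α h h' =>
    h' (Or.inr h)
  have hchain : ∀ C : MarkovChain (Config (Fin n)),
      (∀ α γ, C α γ ≠ 0 ↔ (∃ X, S.Step α X γ) ∨ α = 0 ∧ γ = 0) → ∀ k ∈ A,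
      C.hitProb (simStart M q₀ k ∘ e.symm) F.toSet ≠ 1 := by
    intro C hC k hk
    obtain ⟨w, N, h1, h2, h3, h4⟩ := (hfA k hk).exists_path
    rw [hF]
    exact chain_hitProb_ne_one hC hS Sim.finSet_closed hfin w N (h1.trans (hαe k).symm) h2 h3
      fun i hi h => h (Or.inl (h4 i hi))
  refine ⟨undecidable_of_inseparable hAB _ S F _ hα ?_ ?_,
    undecidable_of_inseparable hAB _ S F _ hα ?_ ?_,
    undecidable_of_inseparable hAB _ S F _ hα ?_ ?_⟩
  · exact fun k hk => hchain _ S.typeChain_ne_zero_iff k hk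
  · intro k hk
    simp only [hF]
    exact chain_hitProb_eq_one S.typeChain_ne_zero_iff hS (hpath k hk)
  · exact fun k hk => hchain _ S.procChain_ne_zero_iff k hk
  · intro k hk
    simp only [hF]
    exact chain_hitProb_eq_one S.procChain_ne_zero_iff hS (hpath k hk)
  · intro k hk h
    simp only [hF] at h
    refine pickScheduler_hitProb_ne_one (S := S) hS Sim.finSet_closed hfin Sim.pick Sim.pick_pos
      (α₀ := simStart M q₀ k ∘ e.symm) ?_ (h _ ?_)
    · rw [hαe]
      exact (hfA k hk).avoid
    · refine pickScheduler_fair hS _ _ 7 (by norm_num) fun ω h0' hω => ?_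
      have hreg := Sim.regular_of_pick (h0'.trans (hαe k) ▸ Sim.regular_start _ _) hω
      refine ⟨fun i => ?_, Sim.pick_fair hreg⟩
      obtain ⟨_, _, _, hω, -⟩ := hreg i
      exact hω ▸ Sim.gconf_ne_zero _ _ _
  · intro k hk σ _
    simp only [hF]
    exact mdp_hitProb_eq_one hS (hpath k hk) σ

/-- The existential scheduler now seeks the target, so the alarm makes good configurations rewarding
instead of safe. -/
theorem undecidable_exists_case (hAB : Inseparable A B) (h01 : h0 ≠ h1) (hq0 : q₀ ≠ h1)
    (hq : M.test q₀ = false) (hA : ∀ k ∈ A, M.Reaches h0 h1 (q₀, input k) h0)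
    (hB : ∀ k ∈ B, M.Reaches h0 h1 (q₀, input k) h1) :
    Undecidable (fun I => ∃ σ : I.S.mdp.Scheduler,
      I.S.mdp.hitProb σ I.α₀ I.F.toSet = 1) := by
  obtain ⟨n, ⟨e⟩⟩ := Finite.exists_equiv_fin (Option (Ty Q))
  have hR0 : ∀ X, (Sim.rules M h0 X).Nonempty := fun X => Sim.rules_nonempty _ (q₀, true, 0)
  obtain ⟨S, hS⟩ := exists_pbpp e (alarmRules (Sim.rules M h0)) (alarmRules_nonempty hR0)
  obtain ⟨F, hF⟩ := exists_pres e (isSemilinearSet_alarmTarget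
    (Sim.isSemilinearSet_goodSet (M := M) (h1 := h1)) (Sim.isSemilinearSet_wrongSet (M := M) (h1 := h1)))
  have hα : ∀ i, Computable fun k => (lift (simStart M q₀ k) 0 ∘ e.symm) i := fun i => by
    simp only [Function.comp_apply]
    cases e.symm i with
    | none => exact Computable.const 0
    | some X => exact computable_simStart hq X
  have hαe : ∀ k, (lift (simStart M q₀ k) 0 ∘ e.symm) ∘ e = lift (simStart M q₀ k) 0 := fun k => by
    funext
    simp
  have hfA := fun k hk => Sim.forced_of_reaches_h0 hq0 (hA k hk) h01 (Nat.zero_mod 7) 0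
  have hfB := fun k hk => Sim.forced_of_reaches_h1 hq0 (hB k hk) (Nat.zero_mod 7) 0
  refine undecidable_of_inseparable hAB _ S F _ hα ?_ ?_
  · rintro k hk ⟨σ, hσ⟩
    refine mdp_hitProb_ne_one hS (alarmTrap_closed Sim.finSet_closed (by simp [Sim.finSet]))
      (alarmTrap_disjoint (fun α h h' => Sim.goodSet_disjoint_finSet α h' h)
        fun α h h' => Sim.wrongSet_disjoint_finSet α h' h) (fun _ _ _ => True) ?_ σ (fun _ _ _ _ => trivial)
      (hF ▸ hσ)
    rw [hαe]
    exact (hfA k hk).avoid_alarm hR0 Sim.goodSet_disjoint_wrongSet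
  · intro k hk
    simp only [hF]
    exact exists_scheduler_eq_one hS _ (alarmPick_pos Sim.pick_pos) fun ω h0' hω =>
      (hfB k hk).exists_mem_alarmTarget ω (h0'.trans (hαe k)) hω

end Main

/-! ### Register programs coded in a single number. -/

/-- A machine with a single number. In the state `q`, if `d q` divides the number, then it is
replaced by its quotient multiplied by `mul q` and the next state is `yes q`; otherwise the number
is unchanged and the next state is `no q`. -/
structure DivMachine (S : Type) where
  d : S → ℕ
  d_pos : ∀ q, 0 < d q
  mul : S → ℕ
  yes : S → S
  no : S → S

/-- The successor of a configuration. -/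
def DivMachine.next {S : Type} (D : DivMachine S) (c : S × ℕ) : S × ℕ :=
  if D.d c.1 ∣ c.2 then (D.yes c.1, c.2 / D.d c.1 * D.mul c.1) else (D.no c.1, c.2)

/-- A step of the machine before it has reached the state `exit`. -/
def DivMachine.StepBefore {S : Type} (D : DivMachine S) (exit : S) (c c' : S × ℕ) : Prop :=
  c.1 ≠ exit ∧ c' = D.next c

/-- The prime that represents the register `i`. -/
noncomputable def regPrime (i : ℕ) : ℕ := Nat.nth Nat.Prime i

theorem regPrime_prime (i : ℕ) : (regPrime i).Prime := Nat.prime_nth_prime i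

theorem regPrime_injective : Function.Injective regPrime :=
  Nat.nth_injective Nat.infinite_setOfPred_prime

/-- The number that represents the registers `s`. -/
noncomputable def regCode (s : ℕ →₀ ℕ) : ℕ := s.prod fun i e => regPrime i ^ e

theorem regCode_update_succ (s : ℕ →₀ ℕ) (i : ℕ) :
    regCode (s.update i (s i + 1)) = regCode s * regPrime i := by
  have : s.update i (s i + 1) = s + Finsupp.single i 1 := by
    ext j
    by_cases h : j = i
    · subst h
      simp
    · simp [Finsupp.update_apply, h]
  rw [this, regCode, Finsupp.prod_add_index' (by simp) (by simp [pow_add]),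
    Finsupp.prod_single_index (by simp), pow_one, regCode]

theorem regCode_update_pred {s : ℕ →₀ ℕ} {i : ℕ} (h : s i ≠ 0) :
    regCode s = regCode (s.update i (s i - 1)) * regPrime i := by
  rw [← regCode_update_succ]
  congr 1
  ext j
  by_cases h' : j = i
  · subst h'
    simp
    omega
  · simp [Finsupp.update_apply, h']

theorem regPrime_dvd_iff {s : ℕ →₀ ℕ} {i : ℕ} : regPrime i ∣ regCode s ↔ s i ≠ 0 := by
  constructor
  · intro h
    rw [regCode, Finsupp.prod, (regPrime_prime i).prime.dvd_finsetProd_iff] at h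
    obtain ⟨j, hj, h⟩ := h
    have := (Nat.prime_dvd_prime_iff_eq (regPrime_prime i) (regPrime_prime j)).1
      ((regPrime_prime i).dvd_of_dvd_pow h)
    rw [regPrime_injective this]
    exact Finsupp.mem_support_iff.1 hj
  · intro h
    rw [regCode_update_pred h]
    exact dvd_mul_left _ _

/-- Some machine takes the registers `s` to the registers `s'` whenever `R s s'`. -/
def Realizable (R : (ℕ →₀ ℕ) → (ℕ →₀ ℕ) → Prop) : Prop :=
  ∃ (S : Type) (_ : Finite S) (D : DivMachine S) (entry exit : S), ∀ s s', R s s' →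
    Relation.ReflTransGen (D.StepBefore exit) (entry, regCode s) (exit, regCode s')

namespace Realizable

variable {R R' : (ℕ →₀ ℕ) → (ℕ →₀ ℕ) → Prop}

theorem mono (h : Realizable R) (hR : ∀ s s', R' s s' → R s s') : Realizable R' := by
  obtain ⟨S, hS, D, entry, exit, h⟩ := h
  exact ⟨S, hS, D, entry, exit, fun s s' h' => h s s' (hR s s' h')⟩

theorem skip : Realizable fun s s' => s' = s := by
  refine ⟨Unit, inferInstance, ⟨fun _ => 1, fun _ => one_pos, fun _ => 1, id, id⟩, (), (), ?_⟩
  rintro s _ rfl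
  exact .refl

theorem inc (i : ℕ) : Realizable fun s s' => s' = s.update i (s i + 1) := by
  refine ⟨Bool, inferInstance, ⟨fun _ => 1, fun _ => one_pos, fun _ => regPrime i, fun _ => true,
    id⟩, false, true, ?_⟩
  rintro s _ rfl
  refine .single ⟨by simp, ?_⟩
  simp [DivMachine.next, regCode_update_succ]

/-- The exit of the first machine becomes a jump: it divides by 1 and multiplies by 1. This is
harmless because `StepBefore` uses no step from the exit. -/
theorem seq (h : Realizable R) (h' : Realizable R') :
    Realizable fun s s' => ∃ u, R s u ∧ R' u s' := by
  classical
  obtain ⟨S, hS, D, entry, exit, h⟩ := h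
  obtain ⟨S', hS', D', entry', exit', h'⟩ := h'
  let E : DivMachine (S ⊕ S') :=
    { d := Sum.elim (fun q => if q = exit then 1 else D.d q) D'.d
      d_pos := by
        rintro (q | q)
        · simp only [Sum.elim_inl]
          split_ifs
          exacts [one_pos, D.d_pos q]
        · exact D'.d_pos q
      mul := Sum.elim (fun q => if q = exit then 1 else D.mul q) D'.mul
      yes := Sum.elim (fun q => if q = exit then .inr entry' else .inl (D.yes q))
        (fun q => .inr (D'.yes q))
      no := Sum.elim (fun q => .inl (D.no q)) (fun q => .inr (D'.no q)) }
  refine ⟨S ⊕ S', inferInstance, E, .inl entry, .inr exit', ?_⟩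
  rintro s s' ⟨u, h1, h2⟩
  have e1 := (h s u h1).lift (p := E.StepBefore (.inr exit')) (fun c => (Sum.inl c.1, c.2)) (by
    rintro ⟨q, N⟩ _ ⟨hq, rfl⟩
    refine ⟨by simp, ?_⟩
    have hq : q ≠ exit := hq
    by_cases hd : D.d q ∣ N <;> simp [DivMachine.next, E, hq, hd])
  have e2 := (h' u s' h2).lift (p := E.StepBefore (.inr exit')) (fun c => (Sum.inr c.1, c.2)) (by
    rintro ⟨q, N⟩ _ ⟨hq, rfl⟩
    refine ⟨by simpa using hq, ?_⟩
    by_cases hd : D'.d q ∣ N <;> simp [DivMachine.next, E, hd])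
  refine e1.trans (.head ⟨by simp, ?_⟩ e2)
  simp [DivMachine.next, E]

end Realizable

/-- The iteration of `R`, where the register `i` is decremented before each execution of `R`, until
the register `i` is zero. -/
inductive Loop (i : ℕ) (R : (ℕ →₀ ℕ) → (ℕ →₀ ℕ) → Prop) : (ℕ →₀ ℕ) → (ℕ →₀ ℕ) → Prop
  | base (s : ℕ →₀ ℕ) : s i = 0 → Loop i R s s
  | step (s u s' : ℕ →₀ ℕ) : s i ≠ 0 → R (s.update i (s i - 1)) u → Loop i R u s' → Loop i R s s'

namespace Realizable

variable {R R' : (ℕ →₀ ℕ) → (ℕ →₀ ℕ) → Prop}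

/-- The new state `inr false` divides by the prime of the register, which both tests and decrements
it; the exit of the body jumps back there. -/
theorem loop (h : Realizable R) (i : ℕ) : Realizable (Loop i R) := by
  classical
  obtain ⟨S, hS, D, entry, exit, h⟩ := h
  let E : DivMachine (S ⊕ Bool) :=
    { d := Sum.elim (fun q => if q = exit then 1 else D.d q) (fun _ => regPrime i)
      d_pos := by
        rintro (q | q)
        · simp only [Sum.elim_inl]
          split_ifs
          exacts [one_pos, D.d_pos q]
        · exact (regPrime_prime i).pos
      mul := Sum.elim (fun q => if q = exit then 1 else D.mul q) (fun _ => 1)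
      yes := Sum.elim (fun q => if q = exit then .inr false else .inl (D.yes q))
        (fun _ => .inl entry)
      no := Sum.elim (fun q => .inl (D.no q)) (fun _ => .inr true) }
  refine ⟨S ⊕ Bool, inferInstance, E, .inr false, .inr true, ?_⟩
  intro s s' hs
  induction hs with
  | base s hs =>
    refine .single ⟨by simp, ?_⟩
    have : ¬ regPrime i ∣ regCode s := by simp [regPrime_dvd_iff, hs]
    simp [DivMachine.next, E, this]
  | step s u s' hs hR _ ih =>
    have e1 := (h _ u hR).lift (p := E.StepBefore (.inr true)) (fun c => (Sum.inl c.1, c.2)) (by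
      rintro ⟨q, N⟩ _ ⟨hq, rfl⟩
      refine ⟨by simp, ?_⟩
      have hq : q ≠ exit := hq
      by_cases hd : D.d q ∣ N <;> simp [DivMachine.next, E, hq, hd])
    refine .head ⟨by simp, ?_⟩ (e1.trans (.head ⟨by simp, ?_⟩ ih))
    · have : regPrime i ∣ regCode s := regPrime_dvd_iff.2 hs
      simp only [DivMachine.next, E, Sum.elim_inr, this, if_true, mul_one]
      rw [regCode_update_pred hs, Nat.mul_div_cancel _ (regPrime_prime i).pos]
    · simp [DivMachine.next, E]

/-- Clear a register. -/
theorem clear (i : ℕ) : Realizable fun s s' => s' = s.update i 0 := by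
  refine (skip.loop i).mono ?_
  rintro s _ rfl
  induction hk : s i generalizing s with
  | zero =>
    convert Loop.base s hk
    ext j
    by_cases h : j = i <;> simp [Finsupp.update_apply, h, hk]
  | succ k ih =>
    refine .step s _ _ (by omega) rfl ?_
    convert ih (s.update i (s i - 1)) (by simp [hk]) using 1
    simp

/-- Add a register to another register and clear it. -/
theorem move {i j : ℕ} (hij : i ≠ j) :
    Realizable fun s s' => s' = (s.update j (s j + s i)).update i 0 := by
  refine ((inc j).loop i).mono ?_
  rintro s _ rfl
  induction hk : s i generalizing s with
  | zero =>
    convert Loop.base s hk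
    ext l
    simp only [Finsupp.update_apply]
    grind
  | succ k ih =>
    refine .step s _ _ (by omega) rfl ?_
    convert ih ((s.update i (s i - 1)).update j ((s.update i (s i - 1)) j + 1))
      (by simp [Finsupp.update_apply, hij, hk]) using 1
    · ext l
      simp only [Finsupp.update_apply]
      grind

/-- Add a register to another register, with the help of a third one. -/
theorem copy {i j t : ℕ} (hij : i ≠ j) (hit : i ≠ t) (hjt : j ≠ t) :
    Realizable fun s s' => s t = 0 ∧ s' = s.update j (s j + s i) := by
  -- The register is moved to `t`, and emptying `t` then increments both `i` and `j`.
  refine ((move hit).seq (((inc i).seq (inc j)).loop t)).mono ?_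
  rintro s _ ⟨ht, rfl⟩
  refine ⟨_, rfl, ?_⟩
  have key : ∀ k (s u : ℕ →₀ ℕ), s t = k → u = ((s.update i (s i + k)).update j (s j + k)).update
      t 0 → Loop t (fun s s' => ∃ u, u = s.update i (s i + 1) ∧ s' = u.update j (u j + 1)) s u := by
    intro k
    induction k with
    | zero =>
      rintro s _ hk rfl
      convert Loop.base s hk
      ext l
      simp only [Finsupp.update_apply]
      grind
    | succ k ih =>
      rintro s _ hk rfl
      refine .step s _ _ (by omega) ⟨_, rfl, rfl⟩ (ih _ _ ?_ ?_)
      · simp only [Finsupp.update_apply]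
        grind
      · ext l
        simp only [Finsupp.update_apply]
        grind
  refine key (s i) _ _ ?_ ?_
  · simp only [Finsupp.update_apply]
    grind
  · ext l
    simp only [Finsupp.update_apply]
    grind

end Realizable
-- Primitive recursive functions on registers.
namespace Realizable

/-- The function `f` can be computed: from the registers `i` into the register `o`, using the
registers from `z` on as scratch space. -/
def Computes {n : ℕ} (f : List.Vector ℕ n → ℕ) : Prop :=
  ∀ (i : Fin n → ℕ) (o z : ℕ), (∀ j, i j < z) → o < z → (∀ j, i j ≠ o) →
    Realizable fun s s' => s o = 0 ∧ (∀ r, z ≤ r → s r = 0) ∧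
      s' = s.update o (f (.ofFn fun j => s (i j)))

/-- Composition of relations needs explicit intermediate contents, and these must be finitely
supported. -/
theorem exists_overwrite (s : ℕ →₀ ℕ) (F : ℕ → ℕ) (z l : ℕ) :
    ∃ u : ℕ →₀ ℕ, ∀ r, u r = if z ≤ r ∧ r < z + l then F r else s r := by
  refine ⟨Finsupp.onFinset (s.support ∪ Finset.Ico z (z + l))
    (fun r => if z ≤ r ∧ r < z + l then F r else s r) fun r hr => ?_, fun r => rfl⟩
  split_ifs at hr with h
  · simp [h]
  · simp [hr]

/-- Clear a block of registers. -/
theorem clearBlock (z l : ℕ) :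
    Realizable fun s s' => ∀ r, s' r = if z ≤ r ∧ r < z + l then 0 else s r := by
  induction l with
  | zero =>
    refine skip.mono fun s s' h => ?_
    ext r
    simpa [show ¬ (z ≤ r ∧ r < z) by omega] using h r
  | succ l ih =>
    refine (ih.seq (clear (z + l))).mono fun s s' h => ?_
    -- The intermediate contents are the final ones with the last cleared register restored.
    refine ⟨s'.update (z + l) (s (z + l)), fun r => ?_, ?_⟩
    · simp only [Finsupp.update_apply]
      grind
    · ext r
      simp only [Finsupp.update_apply]
      grind

/-- Compute several functions into a block of registers. -/
theorem computeBlock {n : ℕ} {G : ℕ → List.Vector ℕ n → ℕ} (z : ℕ) (i : Fin n → ℕ)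
    (hi : ∀ j, i j < z) (l : ℕ) (hG : ∀ a < l, Computes (G a)) :
    Realizable fun s s' => (∀ r, z ≤ r → s r = 0) ∧
      ∀ r, s' r = if z ≤ r ∧ r < z + l then G (r - z) (.ofFn fun j => s (i j)) else s r := by
  induction l with
  | zero =>
    refine skip.mono fun s s' h => ?_
    ext r
    simpa [show ¬ (z ≤ r ∧ r < z) by omega] using h.2 r
  | succ l ih =>
    refine ((ih fun a ha => hG a (by omega)).seq (hG l (by omega) i (z + l) (z + l + 1)
      (fun j => by have := hi j; omega) (by omega) (fun j => by have := hi j; omega))).mono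
      fun s s' h => ?_
    obtain ⟨h0, h⟩ := h
    refine ⟨s'.update (z + l) 0, ⟨h0, fun r => ?_⟩, ?_, fun r hr => ?_, ?_⟩
    · simp only [Finsupp.update_apply]
      grind
    · simp
    · simp only [Finsupp.update_apply]
      grind
    · have : (fun j => s'.update (z + l) 0 (i j)) = fun j => s (i j) := by
        funext j
        have := hi j
        simp only [Finsupp.update_apply]
        grind
      rw [this]
      ext r
      simp only [Finsupp.update_apply]
      grind

/-- The inner values occupy the registers from `z` to `z + m - 1`, the outer function has its
scratch space beyond, and the block is cleared afterwards. -/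
theorem Computes.comp {m n : ℕ} {f : List.Vector ℕ m → ℕ} {g : Fin m → List.Vector ℕ n → ℕ}
    (hf : Computes f) (hg : ∀ a, Computes (g a)) :
    Computes fun v => f (.ofFn fun a => g a v) := by
  intro i o z hi ho hio
  let G : ℕ → List.Vector ℕ n → ℕ := fun a => if h : a < m then g ⟨a, h⟩ else fun _ => 0
  refine (((computeBlock (G := G) z i hi m ?_).seq (hf (fun a => z + a) o (z + m)
    (fun a => by have := a.2; omega) (by omega) (fun a => by omega))).seq (clearBlock z m)).mono ?_
  · intro a ha
    simp only [G, ha, dif_pos]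
    exact hg _
  · rintro s _ ⟨h0, hz, rfl⟩
    obtain ⟨u, hu⟩ := exists_overwrite s (fun r => G (r - z) (.ofFn fun j => s (i j))) z m
    refine ⟨u.update o _, ⟨u, ⟨hz, hu⟩, ?_, fun r hr => ?_, rfl⟩, fun r => ?_⟩
    · grind
    · grind
    · have : (fun a : Fin m => u (z + a)) = fun a => g a (.ofFn fun j => s (i j)) := by
        funext a
        simp [hu, G]
      simp only [this, Finsupp.update_apply]
      grind

/-- Register `z` holds the current value, `z + 1` the index, `z + 2` the next value, and `z + 3` the
number of rounds left; scratch space starts at `z + 4`. -/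
theorem Computes.prec {n : ℕ} {f : List.Vector ℕ n → ℕ} {g : List.Vector ℕ (n + 2) → ℕ}
    (hf : Computes f) (hg : Computes g) :
    Computes fun v : List.Vector ℕ (n + 1) =>
      v.head.rec (f v.tail) fun y IH => g (y ::ᵥ IH ::ᵥ v.tail) := by
  intro i o z hi ho hio
  let rest : (ℕ →₀ ℕ) → List.Vector ℕ n := fun s => .ofFn fun j => s (i j.succ)
  have hi0 := hi 0
  have body : Realizable fun s s' => s (z + 2) = 0 ∧ (∀ r, z + 4 ≤ r → s r = 0) ∧
      s' = (s.update z (g (s (z + 1) ::ᵥ s z ::ᵥ rest s))).update (z + 1) (s (z + 1) + 1) := by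
    refine ((((hg (Fin.cons (z + 1) (Fin.cons z fun j => i j.succ)) (z + 2) (z + 4) ?_ (by omega)
      ?_).seq (clear z)).seq (move (show z + 2 ≠ z by omega))).seq (inc (z + 1))).mono ?_
    · refine Fin.cases (by simp) (Fin.cases (by simp) fun j => ?_)
      have := hi j.succ
      simp only [Fin.cons_succ]
      omega
    · refine Fin.cases (by simp) (Fin.cases (by simp) fun j => ?_)
      have := hi j.succ
      simp only [Fin.cons_succ]
      omega
    · rintro s _ ⟨h2, h4, rfl⟩
      refine ⟨_, ⟨_, ⟨_, ⟨h2, h4, rfl⟩, rfl⟩, rfl⟩, ?_⟩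
      have : (List.Vector.ofFn fun j => s ((Fin.cons (z + 1) (Fin.cons z fun j => i j.succ) :
          Fin (n + 2) → ℕ) j)) = s (z + 1) ::ᵥ s z ::ᵥ rest s := by
        simp [List.Vector.ofFn, rest]
      rw [this]
      ext l
      simp only [Finsupp.update_apply]
      grind
  let val : List.Vector ℕ n → ℕ → ℕ := fun v a => a.rec (f v) fun y IH => g (y ::ᵥ IH ::ᵥ v)
  -- The invariant is that `z` holds the value of the recursion at the index in `z + 1`.
  have hloop : ∀ (k : ℕ) (s u : ℕ →₀ ℕ), s (z + 3) = k → s z = val (rest s) (s (z + 1)) →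
      s (z + 2) = 0 → (∀ r, z + 4 ≤ r → s r = 0) →
      u = ((s.update z (val (rest s) (s (z + 1) + k))).update (z + 1) (s (z + 1) + k)).update
        (z + 3) 0 →
      Loop (z + 3) (fun s s' => s (z + 2) = 0 ∧ (∀ r, z + 4 ≤ r → s r = 0) ∧
        s' = (s.update z (g (s (z + 1) ::ᵥ s z ::ᵥ rest s))).update (z + 1) (s (z + 1) + 1)) s u := by
    intro k
    induction k with
    | zero =>
      rintro s _ h3 h0 h2 h4 rfl
      convert Loop.base s h3
      ext l
      simp only [Finsupp.update_apply]
      grind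
    | succ k ih =>
      rintro s _ h3 h0 h2 h4 rfl
      have hrest : ∀ u : ℕ →₀ ℕ, (∀ r < z, u r = s r) → rest u = rest s := by
        intro u hu
        simp only [rest]
        congr 1
        funext j
        exact hu _ (hi _)
      have hr : ∀ r < z, (s.update (z + 3) (s (z + 3) - 1)) r = s r := by
        intro r hr
        simp only [Finsupp.update_apply]
        grind
      refine .step s _ _ (by omega) ⟨?_, fun r hr => ?_, rfl⟩ (ih _ _ ?_ ?_ ?_ ?_ ?_)
      · simp only [Finsupp.update_apply]
        grind
      · simp only [Finsupp.update_apply]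
        grind
      · simp only [Finsupp.update_apply]
        grind
      · rw [hrest _ hr, hrest (Finsupp.update _ _ _)]
        · simp [Finsupp.update_apply, h0, val]
        · intro r hr
          simp only [Finsupp.update_apply]
          grind
      · simp only [Finsupp.update_apply]
        grind
      · intro r hr
        simp only [Finsupp.update_apply]
        grind
      · rw [hrest _ hr, hrest (Finsupp.update _ _ _)]
        · ext l
          simp only [Finsupp.update_apply]
          grind
        · intro r hr
          simp only [Finsupp.update_apply]
          grind
  refine ((((((copy (i := i 0) (j := z + 3) (t := z + 2) (by omega) (by omega) (by omega)).seq
    (hf (fun j => i j.succ) z (z + 4) (fun j => by have := hi j.succ; omega) (by omega)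
      (fun j => by have := hi j.succ; omega))).seq (body.loop (z + 3))).seq
      (clear (z + 1))).seq (move (show z ≠ o by omega)))).mono ?_
  rintro s _ ⟨h0, hz, rfl⟩
  have hrest : ∀ u : ℕ →₀ ℕ, (∀ r < z, u r = s r) → rest u = rest s := by
    intro u hu
    simp only [rest]
    congr 1
    funext j
    exact hu _ (hi _)
  have e : (List.Vector.ofFn fun j => (s.update (z + 3) (s (z + 3) + s (i 0))) (i j.succ)) =
      rest s := by
    refine hrest _ fun r hr => ?_
    simp only [Finsupp.update_apply]
    grind
  refine ⟨_, ⟨_, ⟨_, ⟨_, ⟨hz _ (by omega), rfl⟩, ?_, fun r hr => ?_, rfl⟩,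
    hloop (s (i 0)) _ _ ?_ ?_ ?_ ?_ rfl⟩, rfl⟩, ?_⟩
  · simp only [Finsupp.update_apply]
    grind
  · simp only [Finsupp.update_apply]
    grind
  · simp only [Finsupp.update_apply]
    grind
  · rw [e, hrest (Finsupp.update _ _ _)]
    · simp [Finsupp.update_apply, hz, val]
    · intro r hr
      simp only [Finsupp.update_apply]
      grind
  · simp only [Finsupp.update_apply]
    grind
  · intro r hr
    simp only [Finsupp.update_apply]
    grind
  · rw [e, hrest (Finsupp.update _ _ _)]
    · have e' : (List.Vector.ofFn fun j => s (i j)) = s (i 0) ::ᵥ rest s := by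
        simp [List.Vector.ofFn, rest]
      rw [e']
      simp only [List.Vector.head_cons, List.Vector.tail_cons]
      change s.update o (val (rest s) (s (i 0))) = _
      have := hio 0
      ext l
      simp only [Finsupp.update_apply]
      grind
    · intro r hr
      simp only [Finsupp.update_apply]
      grind

theorem computes {n : ℕ} {f : List.Vector ℕ n → ℕ} (hf : Nat.Primrec' f) : Computes f := by
  induction hf with
  | zero =>
    intro i o z _ _ _
    refine skip.mono ?_
    rintro s _ ⟨h0, -, rfl⟩
    ext l
    simp only [Finsupp.update_apply]
    grind
  | succ =>
    intro i o z hi ho hio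
    have hi0 := hi 0
    refine ((copy (hio 0) (show i 0 ≠ z by omega) (show o ≠ z by omega)).seq (inc o)).mono ?_
    rintro s _ ⟨h0, hz, rfl⟩
    refine ⟨_, ⟨hz _ le_rfl, rfl⟩, ?_⟩
    ext l
    simp only [Finsupp.update_apply]
    simp [List.Vector.ofFn]
    grind
  | get a =>
    intro i o z hi ho hio
    have hia := hi a
    refine (copy (hio a) (show i a ≠ z by omega) (show o ≠ z by omega)).mono ?_
    rintro s _ ⟨h0, hz, rfl⟩
    refine ⟨hz _ le_rfl, ?_⟩
    ext l
    simp only [Finsupp.update_apply, List.Vector.get_ofFn]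
    grind
  | comp g _ _ hf hg => exact hf.comp hg
  | prec _ _ hf hg => exact hf.prec hg

end Realizable
-- Unbounded search.
namespace Realizable

/-- Search for the least number `k` with `cont k n = 0`, and compute `out k n`. -/
theorem search {cont out : ℕ → ℕ → ℕ} (hc : Primrec₂ cont) (ho : Primrec₂ out) :
    Realizable fun s s' => ∃ n k, s = Finsupp.single 0 n ∧ (∀ j < k, cont j n ≠ 0) ∧
      cont k n = 0 ∧ s' = ((Finsupp.single 0 n).update 1 k).update 2 (out k n) := by
  -- Register 0 holds the input, 1 the candidate, 2 the result, and 3 the value of `cont`, which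
  -- drives the loop.
  have hcR : Realizable fun s s' => s 3 = 0 ∧ (∀ r, 4 ≤ r → s r = 0) ∧
      s' = s.update 3 (cont (s 1) (s 0)) := by
    refine (computes (Nat.Primrec'.prim_iff₂.2 hc) ![1, 0] 3 4 (by decide) (by decide)
      (by decide)).mono ?_
    rintro s _ ⟨h3, h4, rfl⟩
    exact ⟨h3, h4, by simp [List.Vector.ofFn]⟩
  have hoR : Realizable fun s s' => s 2 = 0 ∧ (∀ r, 4 ≤ r → s r = 0) ∧
      s' = s.update 2 (out (s 1) (s 0)) := by
    refine (computes (Nat.Primrec'.prim_iff₂.2 ho) ![1, 0] 2 4 (by decide) (by decide)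
      (by decide)).mono ?_
    rintro s _ ⟨h3, h4, rfl⟩
    exact ⟨h3, h4, by simp [List.Vector.ofFn]⟩
  have body : Realizable fun s s' => (∀ r, 4 ≤ r → s r = 0) ∧
      s' = (s.update 1 (s 1 + 1)).update 3 (cont (s 1 + 1) (s 0)) := by
    -- The loop decrements register 3 by one only, so the rest is cleared before `cont` is evaluated
    -- at the next candidate.
    refine (((clear 3).seq (inc 1)).seq hcR).mono ?_
    rintro s _ ⟨h4, rfl⟩
    refine ⟨_, ⟨_, rfl, rfl⟩, ?_, fun r hr => ?_, ?_⟩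
    · simp [Finsupp.update_apply]
    · simp only [Finsupp.update_apply]
      grind
    · ext l
      simp only [Finsupp.update_apply]
      grind
  have hloop : ∀ (d : ℕ) (s u : ℕ →₀ ℕ), (∀ r, 4 ≤ r → s r = 0) → s 3 = cont (s 1) (s 0) →
      (∀ j < s 1 + d, cont j (s 0) ≠ 0) → cont (s 1 + d) (s 0) = 0 →
      u = (s.update 1 (s 1 + d)).update 3 0 →
      Loop 3 (fun s s' => (∀ r, 4 ≤ r → s r = 0) ∧
        s' = (s.update 1 (s 1 + 1)).update 3 (cont (s 1 + 1) (s 0))) s u := by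
    intro d
    induction d with
    | zero =>
      rintro s _ h4 h3 hj hd rfl
      convert Loop.base s (by rw [h3]; exact hd)
      ext l
      simp only [Finsupp.update_apply]
      grind
    | succ d ih =>
      rintro s _ h4 h3 hj hd rfl
      refine .step s _ _ (by rw [h3]; exact hj _ (by omega)) ⟨fun r hr => ?_, rfl⟩
        (ih _ _ (fun r hr => ?_) ?_ ?_ ?_ ?_)
      · simp only [Finsupp.update_apply]
        grind
      · simp only [Finsupp.update_apply]
        grind
      · simp [Finsupp.update_apply]
      · simp only [Finsupp.update_apply]
        grind
      · simp only [Finsupp.update_apply]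
        grind
      · ext l
        simp only [Finsupp.update_apply]
        grind
  refine ((hcR.seq (body.loop 3)).seq hoR).mono ?_
  rintro _ _ ⟨n, k, rfl, hj, hk, rfl⟩
  refine ⟨_, ⟨_, ⟨?_, fun r hr => ?_, rfl⟩, hloop k _ _ (fun r hr => ?_) ?_ ?_ ?_ rfl⟩,
    ?_, fun r hr => ?_, ?_⟩
  · simp
  · simp only [Finsupp.single_apply]
    grind
  · simp only [Finsupp.update_apply, Finsupp.single_apply]
    grind
  · simp [Finsupp.update_apply]
  · simpa [Finsupp.update_apply] using hj
  · simpa [Finsupp.update_apply] using hk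
  · simp [Finsupp.update_apply]
  · simp only [Finsupp.update_apply, Finsupp.single_apply]
    grind
  · ext l
    simp only [Finsupp.update_apply, Finsupp.single_apply]
    grind

end Realizable

/-! ### From a single number to two counters. -/

/-- The numbers `a` and `b` as the values of the two counters. -/
def pair (a b : ℕ) (c : Bool) : ℕ := if c then b else a

namespace DivMachine

variable {S : Type} (D : DivMachine S) (K : ℕ)

/-- The states of the simulation of a machine with a single number by a counter machine. -/
abbrev CtrState (S : Type) (K : ℕ) := S × (Fin (K + 1) ⊕ Option (Fin (K + 1)))

/-- The simulation by a counter machine. In the state `(q, inl j)` it divides the first counter by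
`d q`, where `j` is the part of the remainder found so far; the quotient is built in the second
counter, which is then multiplied by `mul q` if the remainder is zero (`inr none`) and otherwise
by `d q` again (`inr (some j)`). -/
def toCounter : CounterMachine (CtrState S K) where
  test q := match q.2 with
    | .inl _ => false
    | .inr _ => true
  target q nz := match q.2, nz with
    | .inl j, true => (q.1, .inl (if (j : ℕ) + 1 = D.d q.1 then 0 else Fin.ofNat (K + 1) (j + 1)))
    | .inl j, false => (q.1, .inr (if j = 0 then none else some j))
    | .inr none, false => (D.yes q.1, .inl 0)
    | .inr (some _), false => (D.no q.1, .inl 0)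
    | .inr _, true => q
  incr q nz := match q.2, nz with
    | .inl j, true => pair 0 (if (j : ℕ) + 1 = D.d q.1 then 1 else 0)
    | .inl _, false => pair 0 0
    | .inr none, true => pair (D.mul q.1) 0
    | .inr none, false => pair 0 0
    | .inr (some _), true => pair (D.d q.1) 0
    | .inr (some j), false => pair j 0

variable {D K}

/-- The second configuration of the counter machine is reached from the first one. -/
def Leads (D : DivMachine S) (K : ℕ) (s t : CtrState S K × (Bool → ℕ)) : Prop :=
  ∃ r, (D.toCounter K).next^[r] s = t

theorem Leads.refl (s : CtrState S K × (Bool → ℕ)) : Leads D K s s := ⟨0, rfl⟩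

theorem Leads.trans {s t u : CtrState S K × (Bool → ℕ)} (h : Leads D K s t) (h' : Leads D K t u) :
    Leads D K s u := by
  obtain ⟨r, rfl⟩ := h
  obtain ⟨r', rfl⟩ := h'
  exact ⟨r' + r, Function.iterate_add_apply _ _ _ _⟩

theorem Leads.head {s t u : CtrState S K × (Bool → ℕ)} (h : (D.toCounter K).next s = t)
    (h' : Leads D K t u) : Leads D K s u := by
  obtain ⟨r, rfl⟩ := h'
  exact ⟨r + 1, by rw [Function.iterate_succ_apply, h]⟩

theorem pair_ext {f : Bool → ℕ} {a b : ℕ} (h : f false = a) (h' : f true = b) : f = pair a b := by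
  funext c
  cases c <;> simpa [pair]

theorem leads_cut {q : S} (hK : D.d q ≤ K) (a : ℕ) {j : ℕ} (hj : j < D.d q) (b : ℕ) :
    Leads D K ((q, .inl (Fin.ofNat (K + 1) j)), pair a b)
      ((q, .inl (Fin.ofNat (K + 1) ((a + j) % D.d q))), pair 0 (b + (a + j) / D.d q)) := by
  induction a generalizing j b with
  | zero =>
    rw [zero_add, Nat.mod_eq_of_lt hj, Nat.div_eq_of_lt hj]
    exact .refl _
  | succ a ih =>
    have hmod : j % (K + 1) = j := Nat.mod_eq_of_lt (by omega)
    by_cases h : j + 1 = D.d q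
    · refine .head (t := ((q, .inl (Fin.ofNat (K + 1) 0)), pair a (b + 1))) ?_ ?_
      · refine Prod.ext ?_ (pair_ext ?_ ?_) <;>
          simp [CounterMachine.next, CounterMachine.outcome, CounterMachine.decr, toCounter, pair,
            hmod, h]
      · have := ih (D.d_pos q) (b + 1)
        rw [show a + 1 + j = a + D.d q by omega, Nat.add_mod_right,
          Nat.add_div_right _ (D.d_pos q)]
        rwa [add_zero, show b + 1 + a / D.d q = b + (a / D.d q).succ by omega] at this
    · refine .head (t := ((q, .inl (Fin.ofNat (K + 1) (j + 1))), pair a b)) ?_ ?_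
      · refine Prod.ext ?_ (pair_ext ?_ ?_) <;>
          simp [CounterMachine.next, CounterMachine.outcome, CounterMachine.decr, toCounter, pair,
            hmod, h]
      · have := ih (j := j + 1) (by omega) b
        rwa [show a + 1 + j = a + (j + 1) by omega]

theorem leads_multiply (q : S) (a b : ℕ) :
    Leads D K ((q, .inr none), pair a b) ((D.yes q, .inl 0), pair (a + b * D.mul q) 0) := by
  induction b generalizing a with
  | zero =>
    refine .head (Prod.ext ?_ (pair_ext ?_ ?_)) (.refl _) <;>
      simp [CounterMachine.next, CounterMachine.outcome, CounterMachine.decr, toCounter, pair]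
  | succ b ih =>
    refine .head (t := ((q, .inr none), pair (a + D.mul q) b)) (Prod.ext ?_ (pair_ext ?_ ?_)) ?_
    · simp [CounterMachine.next, CounterMachine.outcome, CounterMachine.decr, toCounter, pair]
    · simp [CounterMachine.next, CounterMachine.outcome, CounterMachine.decr, toCounter, pair]
    · simp [CounterMachine.next, CounterMachine.outcome, CounterMachine.decr, toCounter, pair]
    · convert ih (a + D.mul q) using 3
      ring

/-- If the division leaves a remainder, the number is rebuilt as quotient times divisor plus
remainder. -/
theorem leads_restore (q : S) (j : Fin (K + 1)) (a b : ℕ) :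
    Leads D K ((q, .inr (some j)), pair a b)
      ((D.no q, .inl 0), pair (a + b * D.d q + j) 0) := by
  induction b generalizing a with
  | zero =>
    refine .head (Prod.ext ?_ (pair_ext ?_ ?_)) (.refl _) <;>
      simp [CounterMachine.next, CounterMachine.outcome, CounterMachine.decr, toCounter, pair]
  | succ b ih =>
    refine .head (t := ((q, .inr (some j)), pair (a + D.d q) b)) (Prod.ext ?_ (pair_ext ?_ ?_)) ?_
    · simp [CounterMachine.next, CounterMachine.outcome, CounterMachine.decr, toCounter, pair]
    · simp [CounterMachine.next, CounterMachine.outcome, CounterMachine.decr, toCounter, pair]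
    · simp [CounterMachine.next, CounterMachine.outcome, CounterMachine.decr, toCounter, pair]
    · convert ih (a + D.d q) using 3
      ring

theorem leads_next (hK : ∀ q, D.d q ≤ K) (c : S × ℕ) :
    Leads D K ((c.1, .inl 0), pair c.2 0) (((D.next c).1, .inl 0), pair (D.next c).2 0) := by
  obtain ⟨q, N⟩ := c
  have h1 := leads_cut (hK q) N (D.d_pos q) 0
  simp only [add_zero, zero_add] at h1
  have hlt : N % D.d q < K + 1 := by
    have := Nat.mod_lt N (D.d_pos q)
    have := hK q
    omega
  refine Leads.trans h1 ?_
  by_cases hd : D.d q ∣ N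
  · have h0 : N % D.d q = 0 := Nat.mod_eq_zero_of_dvd hd
    refine .head (t := ((q, .inr none), pair 0 (N / D.d q))) (Prod.ext ?_ (pair_ext ?_ ?_)) ?_
    · simp [CounterMachine.next, CounterMachine.outcome, toCounter, pair, h0]
    · simp [CounterMachine.next, CounterMachine.outcome, CounterMachine.decr, toCounter, pair]
    · simp [CounterMachine.next, CounterMachine.outcome, CounterMachine.decr, toCounter, pair]
    · simpa [DivMachine.next, hd] using leads_multiply (D := D) (K := K) q 0 (N / D.d q)
  · have h0 : N % D.d q ≠ 0 := fun h => hd (Nat.dvd_of_mod_eq_zero h)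
    refine .head (t := ((q, .inr (some (Fin.ofNat (K + 1) (N % D.d q)))), pair 0 (N / D.d q)))
      (Prod.ext ?_ (pair_ext ?_ ?_)) ?_
    · simp [CounterMachine.next, CounterMachine.outcome, toCounter, pair]
      exact fun h => h0 (Nat.eq_zero_of_dvd_of_lt h hlt)
    · simp [CounterMachine.next, CounterMachine.outcome, CounterMachine.decr, toCounter, pair]
    · simp [CounterMachine.next, CounterMachine.outcome, CounterMachine.decr, toCounter, pair]
    · have h2 := leads_restore (D := D) q (Fin.ofNat (K + 1) (N % D.d q)) 0 (N / D.d q)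
      rw [Fin.val_ofNat, Nat.mod_eq_of_lt hlt, zero_add, mul_comm, Nat.div_add_mod] at h2
      simpa [DivMachine.next, hd] using h2

theorem leads_of_stepBefore (hK : ∀ q, D.d q ≤ K) {exit : S} {c c' : S × ℕ}
    (h : Relation.ReflTransGen (D.StepBefore exit) c c') :
    Leads D K ((c.1, .inl 0), pair c.2 0) ((c'.1, .inl 0), pair c'.2 0) := by
  induction h with
  | refl => exact .refl _
  | tail _ h ih =>
    obtain ⟨-, rfl⟩ := h
    exact ih.trans (leads_next hK _)

/-- States in which the machine stays for ever are not left by the simulation. -/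
theorem toCounter_absorbing {q : S} (hy : D.yes q = q) (hn : D.no q = q)
    {s : CtrState S K × (Bool → ℕ)} (hs : s.1.1 = q) (r : ℕ) :
    ((D.toCounter K).next^[r] s).1.1 = q := by
  induction r with
  | zero => exact hs
  | succ r ih =>
    rw [Function.iterate_succ_apply']
    generalize (D.toCounter K).next^[r] s = t at ih
    obtain ⟨⟨q', j⟩, n⟩ := t
    obtain rfl : q' = q := ih
    simp only [CounterMachine.next]
    generalize (D.toCounter K).outcome _ = nz
    rcases j with j | _ | j <;> cases nz <;> simp [toCounter, hy, hn]

/-- The simulated states `a` and `b` are never left, so whichever is visited first must be the one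
visited later. -/
theorem reaches_of_leads {q₀ a b : S} (hab : a ≠ b) (ha : D.yes a = a ∧ D.no a = a)
    (hb : D.yes b = b ∧ D.no b = b) {n : Bool → ℕ} {t : CtrState S K × (Bool → ℕ)}
    (h : Leads D K ((q₀, .inl 0), n) t) {x : S} (hx : x = a ∨ x = b) (ht : t.1 = (x, .inl 0)) :
    (D.toCounter K).Reaches (a, .inl 0) (b, .inl 0) ((q₀, .inl 0), n) (x, .inl 0) := by
  classical
  obtain ⟨r, hr⟩ := h
  let P : ℕ → Prop := fun r => ((D.toCounter K).next^[r] ((q₀, .inl 0), n)).1 = (a, .inl 0) ∨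
    ((D.toCounter K).next^[r] ((q₀, .inl 0), n)).1 = (b, .inl 0)
  have hP : ∃ r, P r := ⟨r, by
    simp only [P, hr, ht]
    rcases hx with rfl | rfl <;> simp⟩
  have hle : Nat.find hP ≤ r := Nat.find_min' hP (by
    simp only [P, hr, ht]
    rcases hx with rfl | rfl <;> simp)
  refine ⟨Nat.find hP, ?_, fun j hj => not_or.1 (Nat.find_min hP hj)⟩
  have key : ∀ y, D.yes y = y → D.no y = y →
      ((D.toCounter K).next^[Nat.find hP] ((q₀, .inl 0), n)).1 = (y, .inl 0) → y = x := by
    intro y hy hn h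
    have := toCounter_absorbing hy hn (congrArg Prod.fst h) (r - Nat.find hP)
    rw [← Function.iterate_add_apply, Nat.sub_add_cancel hle, hr, ht] at this
    exact this.symm
  rcases Nat.find_spec hP with h | h
  · rw [h, key a ha.1 ha.2 h]
  · rw [h, key b hb.1 hb.2 h]

end DivMachine

/-! ### The diagonal sets and their machine. -/

/-- Some counter machine separates two computably inseparable sets by its halting states. -/
theorem exists_machine : ∃ (A B : Set ℕ) (Q : Type) (_ : Fintype Q) (M : CounterMachine Q)
    (q₀ h0 h1 : Q), Inseparable A B ∧ h0 ≠ h1 ∧ q₀ ≠ h1 ∧ M.test q₀ = false ∧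
    (∀ k ∈ A, M.Reaches h0 h1 (q₀, input k) h0) ∧ ∀ k ∈ B, M.Reaches h0 h1 (q₀, input k) h1 := by
  classical
  let ev : ℕ → ℕ → Option ℕ := fun k n => Nat.Partrec.Code.evaln k (Denumerable.ofNat Nat.Partrec.Code n) n
  have hev : Primrec₂ ev := Nat.Partrec.Code.primrec_evaln.comp
    ((Primrec.fst.pair ((Primrec.ofNat Nat.Partrec.Code).comp .snd)).pair .snd)
  have hc : Primrec₂ fun k n => if (ev k n).isSome = true then 0 else 1 :=
    Primrec.ite (Primrec.eq.comp (Primrec.option_isSome.comp hev) (.const true)) (.const 0)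
      (.const 1)
  -- The default value is never output, as the search stops only when the evaluation has succeeded.
  have ho : Primrec₂ fun k n => (ev k n).getD 0 := Primrec.option_getD.comp hev (.const 0)
  obtain ⟨S, _, D, entry, exit, hD⟩ := Realizable.search hc ho
  -- The former exit tests whether register 2, the output, is nonzero, and branches to one of two
  -- absorbing states.
  let E : DivMachine (S ⊕ Bool) :=
    { d := Sum.elim (fun q => if q = exit then regPrime 2 else D.d q) fun _ => 1
      d_pos := by
        rintro (q | q)
        · simp only [Sum.elim_inl]
          split_ifs
          exacts [(regPrime_prime 2).pos, D.d_pos q]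
        · exact one_pos
      mul := Sum.elim D.mul fun _ => 1
      yes := Sum.elim (fun q => if q = exit then .inr true else .inl (D.yes q)) .inr
      no := Sum.elim (fun q => if q = exit then .inr false else .inl (D.no q)) .inr }
  obtain ⟨K, hK⟩ : ∃ K, ∀ q, E.d q ≤ K := by
    obtain ⟨K, hK⟩ := (Set.finite_range E.d).bddAbove
    exact ⟨K, fun q => hK ⟨q, rfl⟩⟩
  -- The first prime is 2, so the input `2 ^ n` is already the code of `n` in register 0.
  have hreg : ∀ n, regCode (Finsupp.single 0 n) = 2 ^ n := by
    intro n
    rw [regCode, Finsupp.prod_single_index (by simp), regPrime, Nat.nth_prime_zero_eq_two]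
  have main : ∀ n y, y ∈ Nat.Partrec.Code.eval (Denumerable.ofNat Nat.Partrec.Code n) n →
      (E.toCounter K).Reaches (.inr false, .inl 0) (.inr true, .inl 0)
        ((.inl entry, .inl 0), input n) (.inr (decide (y ≠ 0)), .inl 0) := by
    intro n y hy
    have hex : ∃ k, (ev k n).isSome = true := by
      obtain ⟨k, hk⟩ := Nat.Partrec.Code.evaln_complete.1 hy
      exact ⟨k, Option.isSome_iff_exists.2 ⟨y, hk⟩⟩
    have hspec := Nat.find_spec hex
    obtain ⟨y', hy'⟩ := Option.isSome_iff_exists.1 hspec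
    obtain rfl : y' = y := Part.mem_unique (Nat.Partrec.Code.evaln_sound hy') hy
    have h := hD _ _ ⟨n, Nat.find hex, rfl, fun j hj => by simp [Nat.find_min hex hj],
      by simp [hspec], rfl⟩
    rw [hreg, hy'] at h
    have h := h.lift (p := E.StepBefore (.inr true)) (fun c => (Sum.inl c.1, c.2)) (by
      rintro ⟨q, N⟩ _ ⟨hq, rfl⟩
      refine ⟨by simp, ?_⟩
      have hq : q ≠ exit := hq
      by_cases hd : D.d q ∣ N <;> simp [DivMachine.next, E, hq, hd])
    refine DivMachine.reaches_of_leads (by simp) ⟨rfl, rfl⟩ ⟨rfl, rfl⟩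
      ((DivMachine.leads_of_stepBefore hK h).trans (DivMachine.leads_next hK _)) ?_ ?_
    · by_cases h0 : y' = 0 <;> simp [h0]
    · by_cases h0 : y' = 0 <;> simp [DivMachine.next, E, regPrime_dvd_iff, h0]
  refine ⟨{n | 0 ∈ Nat.Partrec.Code.eval (Denumerable.ofNat Nat.Partrec.Code n) n},
    {n | 1 ∈ Nat.Partrec.Code.eval (Denumerable.ofNat Nat.Partrec.Code n) n}, DivMachine.CtrState (S ⊕ Bool) K,
    Fintype.ofFinite _, E.toCounter K, (.inl entry, .inl 0), (.inr false, .inl 0),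
    (.inr true, .inl 0), ?_, by simp, by simp, rfl, fun n hn => main n 0 hn,
    fun n hn => main n 1 hn⟩
  intro g hg
  -- Diagonalisation: the program that outputs 0 where `g` is true and 1 elsewhere is misclassified
  -- by `g` at its own code.
  have hp : Partrec fun n => Part.some (if g n = true then 0 else 1) :=
    (((Primrec.dom_bool fun b => if b = true then 0 else 1).to_comp.comp hg).partrec :)
  obtain ⟨c, hc⟩ := Nat.Partrec.Code.exists_code.1 (Partrec.nat_iff.1 hp)
  refine ⟨Encodable.encode c, ?_⟩
  by_cases h : g (Encodable.encode c) = true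
  · exact Or.inl ⟨by simp [hc, h], h⟩
  · exact Or.inr ⟨by simp [hc, h], by simpa using h⟩

end BPP

/-- Almost-sure reachability of semilinear target sets for probabilistic BPPs is undecidable: for
both versions of the induced Markov chain, for all `7`-fair schedulers of the induced MDP, and for
some scheduler of the induced MDP. -/
theorem mainTheorem5 :
    BPP.Undecidable (fun I => I.S.typeChain.hitProb I.α₀ I.F.toSet = 1) ∧
    BPP.Undecidable (fun I => I.S.procChain.hitProb I.α₀ I.F.toSet = 1) ∧
    BPP.Undecidable (fun I => ∀ σ : I.S.mdp.Scheduler,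
      I.S.mdp.Fair 7 I.α₀ σ → I.S.mdp.hitProb σ I.α₀ I.F.toSet = 1) ∧
    BPP.Undecidable (fun I => ∃ σ : I.S.mdp.Scheduler,
      I.S.mdp.hitProb σ I.α₀ I.F.toSet = 1) := by
  classical
  obtain ⟨A, B, Q, _, M, q₀, h0, h1, hAB, h01, hq0, hq, hA, hB⟩ := BPP.exists_machine
  obtain ⟨ha, hb, hc⟩ := BPP.undecidable_fair_cases hAB h01 hq0 hq hA hB
  exact ⟨ha, hb, hc, BPP.undecidable_exists_case hAB h01 hq0 hq hA hB⟩
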